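/- Setting. Let $R\subset V$ be a reduced irreducible (crystallographic) root system in a finite dimensional $\mathbb Q$-vector space, $R^+$ a system of positive roots, $R^-=-R^+$, and $\widehat W$ the affine Weyl group, generated by the reflections $s_{\alpha,n}(v)=v-(\langle\alpha,v\rangle-n)\alpha^\vee$ of $V^*$ ($\alpha\in R$, $n\in\mathbb Z$) at the hyperplanes $H_{\alpha,n}=\{\langle\alpha,\cdot\rangle=n\}$; for $\alpha\in R^+$ put $H^{\pm}_{\alpha,n}=\{v\mid \pm(\langle\alpha,v\rangle-n)>0\}$. Let $\widehat{\mathcal S}$ be the set of simple affine reflections, $A_e=\{v\mid 0<\langle\alpha,v\rangle<1\ \forall\alpha\in R^+\}$ the fundamental alcove, $\mathscr A$ the set of alcoves, and for $s\in\widehat{\mathcal S}$ let $\mathscr A^s$ be the $\widehat W$-orbit of the wall of $A_e$ fixed by $s$. Every alcove $A$ has exactly one wall $\overline A$ in $\mathscr A^s$. For a wall $B\subset H_{\alpha,n}$ (one hyperplane only) put $\alpha_B=\alpha\in R^+$, and let $B_\pm$ be the alcove with wall $B$ in $H_{\alpha,n}^{\pm}$. For $\beta\in R^+$ and a facet $F$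 put $\beta\uparrow F=s_{\beta,n}F$, where $n$ is the smallest integer with $F\subset H_{\beta,n}^-\cup H_{\beta,n}$; let $\beta\downarrow$ be the inverse of $\beta\uparrow$. Let $k$ be a field with $\operatorname{char}k\neq2$, and $\operatorname{char} k\neq 3$ if $R$ is of type $G_2$. Let $X$ be the weight lattice, $S=S(X\otimes k)$ (with $X\otimes k$ in degree 2), $S^\emptyset=S[\alpha^{-1}\mid\alpha\in R^+]$ and $S^\beta=S[\alpha^{-1}\mid\alpha\in R^+,\alpha\ne\beta]$. Categories. For $\mathscr O=\mathscr A$ or $\mathscr O=\mathscr A^s$ an object $M$ of $\mathcal K(\mathscr O)$ consists of a $\mathbb Z$-graded $S^\emptyset$-module $M(F)$ for each $F\in\mathscr O$, and for all $F\in\mathscr O$, $\beta\in R^+$, of an $S^\beta$-submodule $M(F,\beta)$ (not required to be homogeneous) of $M(F)\oplus M(\beta\uparrow F)$ if $\beta\uparrow F\ne F$, and of $M(F)$ if $\beta\uparrow F=F$. A morphism is a family of homomorphisms $M(F)\to N(F)$ of graded $S^\emptyset$-modules that maps all $M(F,\beta)$ into $N(F,\beta)$. Let $\langle n\rangle$ be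 the degree shift. Write $\mathcal K=\mathcal K(\mathscr A)$, $\mathcal K^s=\mathcal K(\mathscr A^s)$. Constants. For $s\in\widehat{\mathcal S}$, $A\in\mathscr A$ and $\beta\in R^+$ put $a_A^\beta=1$ if $s_\beta(\alpha_{\overline A})\in R^+$; if $s_\beta(\alpha_{\overline A})\in R^-$, put $a_A^\beta=-\alpha_{\overline A}$ for $A=\overline A_+$ and $a_A^\beta=\alpha_{\overline A}^{-1}$ for $A=\overline A_-$. Let $$d_A^\beta=\prod\alpha^{-1},$$ the product being over all hyperplanes $H_{\alpha,n}$ with $\alpha\in R^+$, $A\subset H_{\alpha,n}^-$, $\beta\uparrow A\subset H_{\alpha,n}^+$ and $s_\beta(\alpha)\in R^-$. For a wall $B$ put $d_B^\beta=\alpha_B\, d_{B_-}^\beta$ if $s_\beta(\alpha_B)\in R^-$ and $d_B^\beta=d_{B_-}^\beta$ if $s_\beta(\alpha_B)\in R^+$. Translation functors. $\mathcal T^{s}_{on},\mathcal T'^{s}_{on}\colon\mathcal K\to\mathcal K^s$ and $\mathcal T^{s}_{out},\mathcal T'^{s}_{out}\colon\mathcal K^s\to\mathcal K$ are given by $\mathcal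 T_{on}M(B)=\mathcal T'_{on}M(B)=M(B_-)\oplus M(B_+)$, $\mathcal T_{out}N(A)=\mathcal T'_{out}N(A)=N(\overline A)$ and $$\mathcal T_{on}M(B,\beta)=\begin{cases}M(B_-,\beta)&\beta\uparrow B=B\\ M(B_-,\beta)\oplus M(B_+,\beta)&\beta\uparrow B\ne B\end{cases}$$ $$\mathcal T'_{on}M(B,\beta)=\begin{cases}((a_{B_-}^\beta)^{-1},1)M(B_-,\beta)&\beta\uparrow B=B\\ ((a_{B_-}^\beta)^{-1},1)M(B_-,\beta)\oplus((a_{B_+}^\beta)^{-1},1)M(B_+,\beta)&\beta\uparrow B\ne B\end{cases}$$ $$\mathcal T_{out}N(A,\beta)=\begin{cases}\{(\beta x+y,y)\mid x,y\in N(\overline A,\beta)\}&\beta\uparrow\overline A=\overline A,\ A=\overline A_-\\ \beta N(\overline A,\beta)\oplus N(\overline{\beta\uparrow A},\beta)&\beta\uparrow\overline A=\overline A,\ A=\overline A_+\\ N(\overline A,\beta)&\beta\uparrow\overline A\neq\overline A\end{cases}$$ $$\mathcal T'_{out}N(A,\beta)=\begin{cases}\{(x+a_A^\beta y,y)\mid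 x,y\in N(\overline A,\beta)\}&\beta\uparrow\overline A=\overline A,\ A=\overline A_-\\ N(\overline A,\beta)\oplus N(\overline{\beta\uparrow A},\beta)&\beta\uparrow\overline A=\overline A,\ A=\overline A_+\\ (a_A^\beta,1)N(\overline A,\beta)&\beta\uparrow\overline A\neq\overline A.\end{cases}$$ Put $\mathcal T^s=\mathcal T^s_{out}\circ\mathcal T^s_{on}$ and $\mathcal T'^s=\mathcal T'^s_{out}\circ\mathcal T'^s_{on}$. Special objects. Let $P_0,P_0'\in\mathcal K$ be the objects with $P_0(A_e)=P_0'(A_e)=S^\emptyset$ and $P_0(A)=P'_0(A)=0$ for $A\neq A_e$, with $P_0(A_e,\beta)=P_0(\beta\downarrow A_e,\beta)=S^\beta$, respectively $P_0'(A_e,\beta)=S^\beta$ and $P_0'(\beta\downarrow A_e,\beta)=\beta S^\beta$, and with zero at all other $(A,\beta)$. Let $\mathcal M_k\subset\mathcal K$ be the full subcategory of the objects that are isomorphic to a direct summand of a finite direct sum of objects $\mathcal T^{s}\circ\dots\circ\mathcal T^{t}(P_0)\langle n\rangle$ ($s,\dots,t\in\widehat{\mathcal S}$, $n\in\mathbb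 Z$), and let $\mathcal M_k'$ be defined in the same way with $\mathcal T'^s$ and $P_0'$ in place of $\mathcal T^s$ and $P_0$. Let $\mathcal M_k^s\subset\mathcal K^s$ be the full subcategory of the objects isomorphic to a direct summand of $\mathcal T^s_{on}(M)$ for some $M\in\mathcal M_k$. Theorem. Let $\gamma\colon\mathcal K\to\mathcal K$ be the functor with $\gamma M(A)=M(A)$, $\gamma M(A,\beta)=(d_A^\beta,1)\,M(A,\beta)$, and let $\gamma^s\colon\mathcal K^s\to\mathcal K^s$ be the functor with $\gamma^sN(B)=N(B)$, $\gamma^sN(B,\beta)=(d_B^\beta,1)N(B,\beta)$ if $\beta\uparrow B\neq B$ and $\gamma^sN(B,\beta)=N(B,\beta)$ if $\beta\uparrow B=B$. Then $\gamma$ and all $\gamma^s$ ($s\in\widehat{\mathcal S}$) are equivalences, and for all $s\in\widehat{\mathcal S}$ $$\mathcal T'^s_{on}\circ\gamma\cong\gamma^s\circ\mathcal T^s_{on}\ \text{ on }\mathcal M_k,\qquad \mathcal T'^s_{out}\circ\gamma^s\cong\gamma\circ\mathcal T^s_{out}\ \text{ on }\mathcal M^s_k .$$ Moreover $\mathcal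 T^s$ preserves $\mathcal M_k$, $\mathcal T'^s$ preserves $\mathcal M_k'$, and $\gamma$ restricts to an equivalence $\gamma\colon\mathcal M_k\to\mathcal M_k'$ with $\mathcal T'^s\circ\gamma\cong\gamma\circ\mathcal T^s$ as functors $\mathcal M_k\to\mathcal M'_k$ for all $s\in\widehat{\mathcal S}$. -/

import Mathlib

open CategoryTheory
open scoped TensorProduct

noncomputable section

namespace AJS

universe t u v w x y z

/-! ### Gradings -/

/-- A finite product of graded abelian groups is graded. -/
theorem isInternal_pi {J : Type x} [Finite J] {M : J → Type w} [∀ j, AddCommGroup (M j)]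
    (gr : ∀ j, ℤ → AddSubgroup (M j)) (h : ∀ j, DirectSum.IsInternal (gr j)) :
    DirectSum.IsInternal (fun i : ℤ => AddSubgroup.pi Set.univ (fun j => gr j i)) := by
  classical
  have := Fintype.ofFinite J
  constructor
  · rw [injective_iff_map_eq_zero]
    intro a ha
    have key : ∀ j, ∃ c : (DirectSum ℤ fun i => gr j i), (∀ i, (c i : M j) = (a i : ∀ j, M j) j) ∧
        c = 0 := by
      intro j
      let e : ∀ i : ℤ, (AddSubgroup.pi Set.univ (fun j => gr j i)) →+ gr j i := fun i =>
        { toFun := fun y => ⟨y.1 j, y.2 j (Set.mem_univ j)⟩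
          map_zero' := rfl
          map_add' := fun _ _ => rfl }
      have he : (DirectSum.coeAddMonoidHom (gr j)).comp (DirectSum.map e) =
          (Pi.evalAddMonoidHom M j).comp (DirectSum.coeAddMonoidHom
            (fun i : ℤ => AddSubgroup.pi Set.univ (fun j => gr j i))) := by
        apply DirectSum.addHom_ext
        intro i y
        simp [e]
      refine ⟨DirectSum.map e a, fun i => rfl, (h j).1 ?_⟩
      rw [map_zero]
      exact (DFunLike.congr_fun he a).trans (by simp [ha])
    ext i j
    obtain ⟨c, hc, rfl⟩ := key j
    exact (hc i).symm
  · intro m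
    have hs : ∀ j (y : M j), ∃ a, DirectSum.coeAddMonoidHom
        (fun i : ℤ => AddSubgroup.pi Set.univ (fun j => gr j i)) a = Pi.single j y := by
      intro j y
      obtain ⟨c, rfl⟩ := (h j).2 y
      induction c using DirectSum.induction_on with
      | zero => exact ⟨0, by simp⟩
      | of i c =>
        refine ⟨DirectSum.of (fun i => AddSubgroup.pi Set.univ (fun j => gr j i)) i
          ⟨Pi.single j c, ?_⟩, by simp⟩
        rw [AddSubgroup.single_mem_pi]
        exact fun _ => c.2
      | add c d hc hd =>
        obtain ⟨a, ha⟩ := hc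
        obtain ⟨a', ha'⟩ := hd
        exact ⟨a + a', by rw [map_add, ha, ha', map_add, Pi.single_add]⟩
    choose a ha using hs
    exact ⟨∑ j, a j (m j), by simp [ha, Finset.univ_sum_single]⟩

/-- The sum of two graded abelian groups is graded. -/
theorem isInternal_prod {M : Type w} {N : Type w} [AddCommGroup M] [AddCommGroup N]
    (gM : ℤ → AddSubgroup M) (gN : ℤ → AddSubgroup N) (hM : DirectSum.IsInternal gM)
    (hN : DirectSum.IsInternal gN) :
    DirectSum.IsInternal (fun i : ℤ => (gM i).prod (gN i)) := by
  constructor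
  · rw [injective_iff_map_eq_zero]
    intro a ha
    let e₁ : ∀ i : ℤ, ((gM i).prod (gN i)) →+ gM i := fun i =>
      { toFun := fun y => ⟨y.1.1, y.2.1⟩
        map_zero' := rfl
        map_add' := fun _ _ => rfl }
    let e₂ : ∀ i : ℤ, ((gM i).prod (gN i)) →+ gN i := fun i =>
      { toFun := fun y => ⟨y.1.2, y.2.2⟩
        map_zero' := rfl
        map_add' := fun _ _ => rfl }
    have h₁ : (DirectSum.coeAddMonoidHom gM).comp (DirectSum.map e₁) =
        (AddMonoidHom.fst M N).comp (DirectSum.coeAddMonoidHom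
          (fun i : ℤ => (gM i).prod (gN i))) := by
      apply DirectSum.addHom_ext
      intro i y
      simp [e₁]
    have h₂ : (DirectSum.coeAddMonoidHom gN).comp (DirectSum.map e₂) =
        (AddMonoidHom.snd M N).comp (DirectSum.coeAddMonoidHom
          (fun i : ℤ => (gM i).prod (gN i))) := by
      apply DirectSum.addHom_ext
      intro i y
      simp [e₂]
    have z₁ : DirectSum.map e₁ a = 0 := hM.1 <| by
      rw [map_zero]
      exact (DFunLike.congr_fun h₁ a).trans (by simp [ha])
    have z₂ : DirectSum.map e₂ a = 0 := hN.1 <| by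
      rw [map_zero]
      exact (DFunLike.congr_fun h₂ a).trans (by simp [ha])
    ext i
    · exact congrArg (fun c : DirectSum ℤ fun i => gM i => (c i : M)) z₁
    · exact congrArg (fun c : DirectSum ℤ fun i => gN i => (c i : N)) z₂
  · let f₁ : ∀ i : ℤ, gM i →+ ((gM i).prod (gN i)) := fun i =>
      { toFun := fun y => ⟨(y.1, 0), y.2, zero_mem _⟩
        map_zero' := rfl
        map_add' := fun x y => by ext <;> simp }
    let f₂ : ∀ i : ℤ, gN i →+ ((gM i).prod (gN i)) := fun i =>
      { toFun := fun y => ⟨(0, y.1), zero_mem _, y.2⟩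
        map_zero' := rfl
        map_add' := fun x y => by ext <;> simp }
    have h₁ : (DirectSum.coeAddMonoidHom (fun i : ℤ => (gM i).prod (gN i))).comp
        (DirectSum.map f₁) = (AddMonoidHom.inl M N).comp (DirectSum.coeAddMonoidHom gM) := by
      apply DirectSum.addHom_ext
      intro i y
      simp [f₁]
    have h₂ : (DirectSum.coeAddMonoidHom (fun i : ℤ => (gM i).prod (gN i))).comp
        (DirectSum.map f₂) = (AddMonoidHom.inr M N).comp (DirectSum.coeAddMonoidHom gN) := by
      apply DirectSum.addHom_ext
      intro i y
      simp [f₂]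
    rintro ⟨m, n⟩
    obtain ⟨c, rfl⟩ := hM.2 m
    obtain ⟨d, rfl⟩ := hN.2 n
    refine ⟨DirectSum.map f₁ c + DirectSum.map f₂ d, ?_⟩
    have t₁ := DFunLike.congr_fun h₁ c
    have t₂ := DFunLike.congr_fun h₂ d
    simp only [AddMonoidHom.comp_apply] at t₁ t₂
    rw [map_add, t₁, t₂]
    simp

/-- Shifting the indices of a grading gives a grading. -/
theorem isInternal_shift {M : Type w} [AddCommGroup M] (g : ℤ → AddSubgroup M)
    (h : DirectSum.IsInternal g) (n : ℤ) :
    DirectSum.IsInternal (fun i : ℤ => g (i + n)) := by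
  have e : (DirectSum.coeAddMonoidHom g).comp
      (DirectSum.toAddMonoid (fun i => DirectSum.of (fun i => g i) (i + n))) =
      DirectSum.coeAddMonoidHom (fun i : ℤ => g (i + n)) := by
    apply DirectSum.addHom_ext
    intro i y
    simp
  have hb : Function.Bijective (DirectSum.toAddMonoid
      (fun i => DirectSum.of (fun i => g i) (i + n)) :
      (DirectSum ℤ fun i => g (i + n)) →+ DirectSum ℤ fun i => g i) := by
    constructor
    · rw [injective_iff_map_eq_zero]
      intro a ha
      have hc : ∀ (i : ℤ) (a : DirectSum ℤ fun i => g (i + n)),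
          (DirectSum.toAddMonoid (fun i => DirectSum.of (fun i => g i) (i + n)) a :
            DirectSum ℤ fun i => g i) (i + n) = a i := by
        intro i a
        induction a using DirectSum.induction_on with
        | zero => simp
        | of j y =>
          rw [DirectSum.toAddMonoid_of]
          by_cases hij : j = i
          · subst hij
            rw [DirectSum.of_eq_same, DirectSum.of_eq_same]
          · rw [DirectSum.of_eq_of_ne _ _ _ (by omega), DirectSum.of_eq_of_ne _ _ _ (by omega)]
        | add c d hc hd => rw [map_add, DirectSum.add_apply, hc, hd, DirectSum.add_apply]
      refine DFinsupp.ext fun i => ?_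
      rw [← hc i a, ha]
      rfl
    · intro m
      induction m using DirectSum.induction_on with
      | zero => exact ⟨0, map_zero _⟩
      | of j y =>
        obtain ⟨i, rfl⟩ : ∃ i, j = i + n := ⟨j - n, by omega⟩
        exact ⟨DirectSum.of (fun i => g (i + n)) i y, by rw [DirectSum.toAddMonoid_of]⟩
      | add c d hc hd =>
        obtain ⟨a, rfl⟩ := hc
        obtain ⟨a', rfl⟩ := hd
        exact ⟨a + a', map_add _ _ _⟩
  exact (congrArg (fun f : (DirectSum ℤ fun i => g (i + n)) →+ M => Function.Bijective f) e).mp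
    (h.comp hb)

/-! ### The combinatorial category over a set of facets

`A` is the graded ring written `S^∅`, with `deg d` its part of degree `d`; `Rp` is the set of
positive roots; `loc β` is the subring `S^β` of `A`; `O` is an orbit of facets and `up β F` is
the facet `β ↑ F`. -/

section Category

variable {A : Type w} [CommRing A] {Rp : Type x} {O : Type y}

/-- An object: graded `S^∅`-modules `M(F)`, and for all `F`, `β` an `S^β`-submodule `M(F, β)` of
`M(F) ⊕ M(β ↑ F)` if `β ↑ F ≠ F`, and of `M(F)` if `β ↑ F = F`. The sum of the `M(G)` over the set
`{F, β ↑ F}` is realized as the set of all families in `∏ G, M(G)` that vanish outside this set. -/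
structure KObj (deg : ℤ → AddSubgroup A) (loc : Rp → Subring A) (up : Rp → O → O) where
  carrier : O → Type w
  [grp : ∀ F, AddCommGroup (carrier F)]
  [mod : ∀ F, Module A (carrier F)]
  gr : ∀ F, ℤ → AddSubgroup (carrier F)
  internal : ∀ F, DirectSum.IsInternal (gr F)
  smul_mem : ∀ F i j, ∀ a ∈ deg i, ∀ m ∈ gr F j, a • m ∈ gr F (i + j)
  sub : O → ∀ β : Rp, Submodule (loc β) (∀ F, carrier F)
  supp : ∀ F β, ∀ m ∈ sub F β, ∀ G, G ≠ F → G ≠ up β F → m G = 0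

attribute [instance] KObj.grp KObj.mod

variable {deg : ℤ → AddSubgroup A} {loc : Rp → Subring A} {up : Rp → O → O}

/-- A morphism: homomorphisms `f_F : M(F) → N(F)` of graded `S^∅`-modules that map `M(F, β)` into
`N(F, β)`. -/
@[ext]
structure KHom (M N : KObj deg loc up) where
  app : ∀ F, M.carrier F →ₗ[A] N.carrier F
  app_gr : ∀ F i, ∀ m ∈ M.gr F i, app F m ∈ N.gr F i
  app_sub : ∀ F β, ∀ m ∈ M.sub F β, (fun G => app G (m G)) ∈ N.sub F β

instance : Category (KObj deg loc up) where
  Hom M N := KHom M N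
  id M := ⟨fun _ => LinearMap.id, fun _ _ _ h => h, fun _ _ _ h => h⟩
  comp f g := ⟨fun F => (g.app F).comp (f.app F), fun F i m h => g.app_gr F i _ (f.app_gr F i m h),
    fun F β m h => g.app_sub F β _ (f.app_sub F β m h)⟩

/-- The image of an `S^β`-submodule under an `S^∅`-linear map. -/
def img {M N : Type*} [AddCommGroup M] [Module A M] [AddCommGroup N] [Module A N] {B : Subring A}
    (L : M →ₗ[A] N) (p : Submodule B M) : Submodule B N :=
  p.map (L.restrictScalars B)

theorem mem_img {M N : Type*} [AddCommGroup M] [Module A M] [AddCommGroup N] [Module A N]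
    {B : Subring A} (L : M →ₗ[A] N) (p : Submodule B M) (n : N) :
    n ∈ img L p ↔ ∃ m ∈ p, L m = n :=
  Iff.rfl

theorem map_img {M N M' N' : Type*} [AddCommGroup M] [Module A M] [AddCommGroup N] [Module A N]
    [AddCommGroup M'] [Module A M'] [AddCommGroup N'] [Module A N'] {B : Subring A}
    {L : M →ₗ[A] N} {L' : M' →ₗ[A] N'} {f : M → M'} {g : N → N'} (h : ∀ m, g (L m) = L' (f m))
    {p : Submodule B M} {p' : Submodule B M'} (hf : ∀ m ∈ p, f m ∈ p') :
    ∀ n ∈ img L p, g n ∈ img L' p' := by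
  rintro _ ⟨m, hm, rfl⟩
  exact ⟨f m, hf m hm, (h m).symm⟩

theorem map_sup {N N' : Type*} [AddCommGroup N] [Module A N] [AddCommGroup N'] [Module A N']
    {B : Subring A} {g : N → N'} (hg : ∀ x y, g (x + y) = g x + g y)
    {p q : Submodule B N} {p' q' : Submodule B N'} (hp : ∀ n ∈ p, g n ∈ p')
    (hq : ∀ n ∈ q, g n ∈ q') : ∀ n ∈ p ⊔ q, g n ∈ p' ⊔ q' := by
  intro n hn
  obtain ⟨x, hx, y, hy, rfl⟩ := Submodule.mem_sup.mp hn
  rw [hg]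
  exact Submodule.add_mem_sup (hp x hx) (hq y hy)

/-- The degree shift `M⟨n⟩`, with `M⟨n⟩_i = M_{i+n}`. -/
def KObj.shift (M : KObj deg loc up) (n : ℤ) : KObj deg loc up where
  carrier := M.carrier
  gr F i := M.gr F (i + n)
  internal F := isInternal_shift _ (M.internal F) n
  smul_mem F i j a ha m hm := by
    rw [add_assoc]
    exact M.smul_mem F i (j + n) a ha m hm
  sub := M.sub
  supp := M.supp

/-- The direct sum of a finite family of objects. -/
def KObj.dsum {J : Type} [Finite J] (M : J → KObj deg loc up) : KObj deg loc up where
  carrier F := ∀ j, (M j).carrier F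
  gr F i := AddSubgroup.pi Set.univ fun j => (M j).gr F i
  internal F := isInternal_pi _ fun j => (M j).internal F
  smul_mem F i l a ha m hm j hj := (M j).smul_mem F i l a ha (m j) (hm j hj)
  sub F β :=
    { carrier := {m | ∀ j, (fun G => m G j) ∈ (M j).sub F β}
      add_mem' := fun ha hb j => add_mem (ha j) (hb j)
      zero_mem' := fun j => zero_mem ((M j).sub F β)
      smul_mem' := fun c _ ha j => Submodule.smul_mem _ c (ha j) }
  supp F β _ hm G hG hG' := funext fun j => (M j).supp F β _ (hm j) G hG hG'

/-- `M` is isomorphic to a direct summand of `N`, i.e. `M ⊕ Z ≅ N` for some `Z`. -/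
def IsDirectSummand (M N : KObj deg loc up) : Prop :=
  ∃ Z : KObj deg loc up, Nonempty (KObj.dsum (fun i : Bool => cond i M Z) ≅ N)

/-- Multiplication of the component at `G` by `c G`, for all `G`. -/
def scaleMap {M : O → Type w} [∀ F, AddCommGroup (M F)] [∀ F, Module A (M F)] (c : O → A) :
    (∀ F, M F) →ₗ[A] (∀ F, M F) :=
  LinearMap.pi fun G => c G • LinearMap.proj G

open Classical in
/-- `(c, 1)`: multiplication of the component at `F` by `c`, and of all others by `1`. -/
def twist {M : O → Type w} [∀ F, AddCommGroup (M F)] [∀ F, Module A (M F)] (F : O) (c : A) :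
    (∀ F, M F) →ₗ[A] (∀ F, M F) :=
  scaleMap fun G => if G = F then c else 1

/-- The functor `γ` given by invertible scalars: `γM(F) = M(F)`, and `γM(F, β)` is obtained from
`M(F, β)` by multiplying the component at `G` by `g F β G`, for `G ∈ {F, β ↑ F}`. -/
def scaleFunctor (g : O → Rp → O → Aˣ) : KObj deg loc up ⥤ KObj deg loc up where
  obj M :=
    { carrier := M.carrier
      gr := M.gr
      internal := M.internal
      smul_mem := M.smul_mem
      sub := fun F β => img (scaleMap fun G => (g F β G : A)) (M.sub F β)
      supp := by
        rintro F β _ ⟨m, hm, rfl⟩ G hG hG'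
        change (g F β G : A) • m G = 0
        rw [M.supp F β m hm G hG hG', smul_zero] }
  map {M N} f :=
    { app := f.app
      app_gr := f.app_gr
      app_sub := by
        rintro F β _ ⟨m, hm, rfl⟩
        refine ⟨_, f.app_sub F β m hm, ?_⟩
        funext G
        exact ((f.app G).map_smul (g F β G : A) (m G)).symm }

/-- The object `P` with `P(F₀) = S^∅`, `P(F) = 0` for `F ≠ F₀`, and
`P(F₀, β) = c β • S^β ⊆ P(F₀) ⊕ 0`, `P(F, β) = c' β • S^β ⊆ 0 ⊕ P(F₀)` if `β ↑ F = F₀ ≠ F`,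
and `P(F, β) = 0` for all other `F`. (A function on `PLift p` is an element of `S^∅` if `p` holds,
and there is only one if `p` fails.) -/
def unitObj (hint : DirectSum.IsInternal deg)
    (hmul : ∀ i j, ∀ a ∈ deg i, ∀ b ∈ deg j, a * b ∈ deg (i + j)) (F₀ : O) (c c' : Rp → A) :
    KObj deg loc up where
  carrier F := PLift (F = F₀) → A
  gr F i := AddSubgroup.pi Set.univ fun _ => deg i
  internal F := isInternal_pi _ fun _ => hint
  smul_mem F i l a ha m hm j hj := hmul i l a ha (m j) (hm j hj)
  sub F β :=
    { carrier := {m | (F = F₀ ∧ m F₀ ⟨rfl⟩ ∈ Submodule.span (loc β) {c β}) ∨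
        (F ≠ F₀ ∧ up β F = F₀ ∧ m F₀ ⟨rfl⟩ ∈ Submodule.span (loc β) {c' β}) ∨ m = 0}
      add_mem' := by
        rintro a b (⟨h, ha⟩ | ⟨h, h', ha⟩ | rfl) (⟨l, hb⟩ | ⟨l, l', hb⟩ | rfl)
        · exact Or.inl ⟨h, add_mem ha hb⟩
        · exact absurd h l
        · rw [add_zero]
          exact Or.inl ⟨h, ha⟩
        · exact absurd l h
        · exact Or.inr (Or.inl ⟨h, h', add_mem ha hb⟩)
        · rw [add_zero]
          exact Or.inr (Or.inl ⟨h, h', ha⟩)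
        · rw [zero_add]
          exact Or.inl ⟨l, hb⟩
        · rw [zero_add]
          exact Or.inr (Or.inl ⟨l, l', hb⟩)
        · rw [zero_add]
          exact Or.inr (Or.inr rfl)
      zero_mem' := Or.inr (Or.inr rfl)
      smul_mem' := by
        rintro r a (⟨h, ha⟩ | ⟨h, h', ha⟩ | rfl)
        · exact Or.inl ⟨h, Submodule.smul_mem _ r ha⟩
        · exact Or.inr (Or.inl ⟨h, h', Submodule.smul_mem _ r ha⟩)
        · rw [smul_zero]
          exact Or.inr (Or.inr rfl) }
  supp F β m hm G hG hG' := by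
    funext ⟨h⟩
    rcases hm with ⟨h', -⟩ | ⟨-, h', -⟩ | rfl
    · exact absurd (h.trans h'.symm) hG
    · exact absurd (h.trans h'.symm) hG'
    · rfl

end Category

/-! ### Translation functors

`O₁` plays the role of the set of alcoves, `O₂` that of an orbit of walls; `minus`, `plus` are the
maps `B ↦ B₋, B₊`, and `bar` is the map that sends an alcove to its wall in `O₂`. -/

section Translation

variable {A : Type w} [CommRing A] {Rp : Type x} {O₁ : Type y} {O₂ : Type z}
  {deg : ℤ → AddSubgroup A} {loc : Rp → Subring A} {up₁ : Rp → O₁ → O₁} {up₂ : Rp → O₂ → O₂}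

open Classical in
/-- The family that is `(m(B₋), m(B₊))` at the wall `B` and zero at all other walls. -/
def placeOn (minus plus : O₂ → O₁) (M : O₁ → Type w) [∀ F, AddCommGroup (M F)]
    [∀ F, Module A (M F)] (B : O₂) : (∀ F, M F) →ₗ[A] (∀ B, M (minus B) × M (plus B)) :=
  LinearMap.pi fun B' =>
    if B' = B then (LinearMap.proj (minus B')).prod (LinearMap.proj (plus B')) else 0

open Classical in
/-- The family that is `n(A̅)` at the alcove `C` (`A̅` being the wall of `C`) and zero at all other
alcoves. -/
def placeOut (bar : O₁ → O₂) (N : O₂ → Type w) [∀ F, AddCommGroup (N F)]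
    [∀ F, Module A (N F)] (C : O₁) : (∀ F, N F) →ₗ[A] (∀ C, N (bar C)) :=
  LinearMap.pi fun C' => if C' = C then LinearMap.proj (bar C') else 0

open Classical in
/-- Translation onto the walls, with scalars `a`: `TM(B) = M(B₋) ⊕ M(B₊)`, and `TM(B, β)` is
`(a(B₋, β)⁻¹, 1) M(B₋, β)` if `β ↑ B = B`, and
`(a(B₋, β)⁻¹, 1) M(B₋, β) ⊕ (a(B₊, β)⁻¹, 1) M(B₊, β)` if `β ↑ B ≠ B`. -/
def onFunctor (minus plus : O₂ → O₁) (a : O₁ → Rp → Aˣ) :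
    KObj deg loc up₁ ⥤ KObj deg loc up₂ where
  obj M :=
    { carrier := fun B => M.carrier (minus B) × M.carrier (plus B)
      gr := fun B i => (M.gr (minus B) i).prod (M.gr (plus B) i)
      internal := fun B => isInternal_prod _ _ (M.internal _) (M.internal _)
      smul_mem := fun B i j r hr m hm =>
        ⟨M.smul_mem _ i j r hr m.1 hm.1, M.smul_mem _ i j r hr m.2 hm.2⟩
      sub := fun B β =>
        if up₂ β B = B then
          img (placeOn minus plus M.carrier B)
            (img (twist (minus B) ↑(a (minus B) β)⁻¹) (M.sub (minus B) β))
        else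
          img (placeOn minus plus M.carrier B + placeOn minus plus M.carrier (up₂ β B))
            (img (twist (minus B) ↑(a (minus B) β)⁻¹) (M.sub (minus B) β) ⊔
              img (twist (plus B) ↑(a (plus B) β)⁻¹) (M.sub (plus B) β))
      supp := by
        intro B β m hm G hG hG'
        split_ifs at hm
        · obtain ⟨m, -, rfl⟩ := hm
          simp [placeOn, hG]
        · obtain ⟨m, -, rfl⟩ := hm
          simp [placeOn, hG, hG'] }
  map {M N} f :=
    { app := fun B => (f.app (minus B)).prodMap (f.app (plus B))
      app_gr := fun B i m hm => ⟨f.app_gr _ i _ hm.1, f.app_gr _ i _ hm.2⟩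
      app_sub := by
        have ht : ∀ F (c : A) (m : ∀ F, M.carrier F),
            (fun G => f.app G (twist F c m G)) = twist F c fun G => f.app G (m G) :=
          fun F c m => funext fun G => (f.app G).map_smul _ _
        have hp : ∀ (B : O₂) (m : ∀ F, M.carrier F),
            (fun G => ((f.app (minus G)).prodMap (f.app (plus G)))
              (placeOn (A := A) minus plus M.carrier B m G)) =
            placeOn (A := A) minus plus N.carrier B fun G => f.app G (m G) := by
          intro B m
          funext G
          by_cases hG : G = B <;> simp [placeOn, hG]
        have hq : ∀ {β : Rp} (F F' : O₁) {c : A},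
            ∀ m ∈ img (twist F c) (M.sub F' β), (fun G => f.app G (m G)) ∈
              img (twist F c) (N.sub F' β) :=
          fun F F' => map_img (ht _ _) (f.app_sub _ _)
        intro B β
        dsimp only
        split_ifs
        · exact map_img (hp B) (hq _ _)
        · refine map_img (fun m => ?_) (map_sup (fun x y => funext fun G => map_add _ _ _)
            (hq _ _) (hq _ _))
          rw [LinearMap.add_apply, LinearMap.add_apply, ← hp, ← hp]
          exact funext fun G => map_add _ _ _ }

open Classical in
/-- Translation out of the walls, with scalars `e`, `a`: `TN(C) = N(C̅)`, and `TN(C, β)` is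
`{(e x + a y, y) | x, y ∈ N(C̅, β)}` if `β ↑ C̅ = C̅` and `C = C̅₋`;
`e N(C̅, β) ⊕ N(D̅, β)`, with `D = β ↑ C`, if `β ↑ C̅ = C̅` and `C ≠ C̅₋` (so `C = C̅₊`);
`(a, 1) N(C̅, β)` if `β ↑ C̅ ≠ C̅`. Here `e = e(β)` and `a = a(C, β)`. -/
def outFunctor (minus : O₂ → O₁) (bar : O₁ → O₂) (e : Rp → Aˣ) (a : O₁ → Rp → Aˣ) :
    KObj deg loc up₂ ⥤ KObj deg loc up₁ where
  obj N :=
    { carrier := fun C => N.carrier (bar C)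
      gr := fun C => N.gr (bar C)
      internal := fun C => N.internal _
      smul_mem := fun C => N.smul_mem _
      sub := fun C β =>
        if up₂ β (bar C) = bar C then
          if C = minus (bar C) then
            img ((e β : A) • placeOut bar N.carrier C) (N.sub (bar C) β) ⊔
              img ((a C β : A) • placeOut bar N.carrier C + placeOut bar N.carrier (up₁ β C))
                (N.sub (bar C) β)
          else
            img ((e β : A) • placeOut bar N.carrier C) (N.sub (bar C) β) ⊔
              img (placeOut bar N.carrier (up₁ β C)) (N.sub (bar (up₁ β C)) β)
        else
          img ((a C β : A) • placeOut bar N.carrier C + placeOut bar N.carrier (up₁ β C))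
            (N.sub (bar C) β)
      supp := by
        intro C β m hm G hG hG'
        split_ifs at hm
        · obtain ⟨_, ⟨m, -, rfl⟩, _, ⟨n, -, rfl⟩, rfl⟩ := Submodule.mem_sup.mp hm
          simp [placeOut, hG, hG']
        · obtain ⟨_, ⟨m, -, rfl⟩, _, ⟨n, -, rfl⟩, rfl⟩ := Submodule.mem_sup.mp hm
          simp [placeOut, hG, hG']
        · obtain ⟨m, -, rfl⟩ := hm
          simp [placeOut, hG, hG'] }
  map {M N} f :=
    { app := fun C => f.app (bar C)
      app_gr := fun C => f.app_gr _
      app_sub := by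
        have hp : ∀ (C : O₁) (m : ∀ F, M.carrier F),
            (fun G => f.app (bar G) (placeOut (A := A) bar M.carrier C m G)) =
            placeOut (A := A) bar N.carrier C fun G => f.app G (m G) := by
          intro C m
          funext G
          by_cases hG : G = C <;> simp [placeOut, hG]
        have hs : ∀ (c : A) (C : O₁) (m : ∀ F, M.carrier F),
            (fun G => f.app (bar G) ((c • placeOut (A := A) bar M.carrier C) m G)) =
            (c • placeOut (A := A) bar N.carrier C) fun G => f.app G (m G) := by
          intro c C m
          rw [LinearMap.smul_apply, LinearMap.smul_apply, ← hp]
          exact funext fun G => map_smul _ _ _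
        have ha : ∀ (c : A) (C D : O₁) (m : ∀ F, M.carrier F),
            (fun G => f.app (bar G) (((c • placeOut (A := A) bar M.carrier C) m +
              placeOut (A := A) bar M.carrier D m) G)) =
            (c • placeOut (A := A) bar N.carrier C) (fun G => f.app G (m G)) +
              placeOut (A := A) bar N.carrier D fun G => f.app G (m G) := by
          intro c C D m
          rw [← hs, ← hp]
          exact funext fun G => map_add _ _ _
        have hadd : ∀ x y : ∀ C, M.carrier (bar C), (fun G => f.app (bar G) ((x + y) G)) =
            (fun G => f.app (bar G) (x G)) + fun G => f.app (bar G) (y G) :=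
          fun x y => funext fun G => map_add _ _ _
        intro C β
        dsimp only
        split_ifs
        · exact map_sup hadd (map_img (hs _ _) (f.app_sub _ _))
            (map_img (ha _ _ _) (f.app_sub _ _))
        · exact map_sup hadd (map_img (hs _ _) (f.app_sub _ _)) (map_img (hp _) (f.app_sub _ _))
        · exact map_img (ha _ _ _) (f.app_sub _ _) }

end Translation

/-! ### The affine Weyl group, alcoves and walls

`P` is a root system in `V`, with `W` in the role of the dual space `V*`, and `b` is a base. -/

section Geometry

variable {ι : Type t} {V : Type u} {W : Type v} [AddCommGroup V] [Module ℚ V] [AddCommGroup W]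
  [Module ℚ W] (P : RootPairing ι ℚ V W)

/-- The affine reflection `v ↦ v - (⟨α, v⟩ - n) α^∨`. -/
def affRefl (i : ι) (n : ℤ) : W ≃ᵃ[ℚ] W :=
  (P.coreflection i).toAffineEquiv.trans (AffineEquiv.constVAdd ℚ W ((n : ℚ) • P.coroot i))

theorem affRefl_apply (i : ι) (n : ℤ) (v : W) :
    affRefl P i n v = v - (P.root' i v - n) • P.coroot i := by
  simp only [affRefl, AffineEquiv.trans_apply, LinearEquiv.coe_toAffineEquiv,
    AffineEquiv.constVAdd_apply, RootPairing.coreflection_apply, vadd_eq_add, sub_smul]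
  abel

/-- The affine Weyl group. -/
def affWeyl : Subgroup (W ≃ᵃ[ℚ] W) :=
  Subgroup.closure {r | ∃ i n, r = affRefl P i n}

/-- The orbit of a subset `F₀` of `V*` (a facet) under the affine Weyl group. -/
def Orb (F₀ : Set W) : Type v :=
  {F : Set W // ∃ g : affWeyl P, F = (g : W ≃ᵃ[ℚ] W) '' F₀}

/-- The subset `F₀` as an element of its orbit. -/
def Orb.base (F₀ : Set W) : Orb P F₀ :=
  ⟨F₀, 1, by simp⟩

/-- The hyperplane `H_{α,n}`. -/
def hyp (i : ι) (n : ℤ) : Set W := {v | P.root' i v = n}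

/-- The open half space `H_{α,n}^+`. -/
def hypPos (i : ι) (n : ℤ) : Set W := {v | (n : ℚ) < P.root' i v}

/-- The open half space `H_{α,n}^-`. -/
def hypNeg (i : ι) (n : ℤ) : Set W := {v | P.root' i v < n}

variable {P} (b : P.Base)

variable [P.IsCrystallographic]

/-- The set `R⁺` of positive roots. -/
abbrev PosRoot : Type t := {i : ι // b.IsPos i}

variable {b} in
/-- `β ↑ F = s_{β,n} F`, where `n` is the smallest integer such that `F` lies on or below
`H_{β,n}`. -/
def up {F₀ : Set W} (β : PosRoot b) (F : Orb P F₀) : Orb P F₀ :=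
  ⟨affRefl P β (sInf {n : ℤ | F.1 ⊆ hypNeg P β n ∪ hyp P β n}) '' F.1, by
    obtain ⟨_, g, rfl⟩ := F
    exact ⟨⟨affRefl P β (sInf {n : ℤ | g.1 '' F₀ ⊆ hypNeg P β n ∪ hyp P β n}),
      Subgroup.subset_closure ⟨_, _, rfl⟩⟩ * g, Set.image_image _ _ _⟩⟩

/-- The fundamental dominant alcove `A_e`. -/
def fundAlcove : Set W := {v | ∀ β : PosRoot b, 0 < P.root' β v ∧ P.root' β v < 1}

/-- The set of alcoves. (The affine Weyl group acts simply transitively on it.) -/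
abbrev Alcove : Type v := Orb P (fundAlcove b)

/-- The highest root. -/
def IsHighest (γ : PosRoot b) : Prop :=
  ∀ β : PosRoot b, P.root γ - P.root β ∈ AddSubmonoid.closure (P.root '' b.support)

/-- The simple affine reflections: `s_{α,0}` for simple `α`, and `s_{γ,1}` for the highest root
`γ`. -/
structure SimpleRefl where
  root : PosRoot b
  level : ℤ
  simple : (root : ι) ∈ b.support ∧ level = 0 ∨ IsHighest b root ∧ level = 1

variable {b}

/-- The wall `A_{e,s}` of the fundamental alcove that is fixed by the simple affine
reflection `s`. -/
def fundWall (s : SimpleRefl b) : Set W :=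
  {v | P.root' s.root v = s.level ∧
    ∀ β : PosRoot b, β ≠ s.root → 0 < P.root' β v ∧ P.root' β v < 1}

/-- The orbit of walls that contains `A_{e,s}`. -/
abbrev Wall (s : SimpleRefl b) : Type v := Orb P (fundWall s)

/-- The unique equivariant map from alcoves to the orbit of `A_{e,s}` that sends `A_e` to
`A_{e,s}`. -/
def bar (s : SimpleRefl b) (C : Alcove b) : Wall s :=
  ⟨(C.2.choose : W ≃ᵃ[ℚ] W) '' fundWall s, C.2.choose, rfl⟩

variable (b) in
/-- The closure of an alcove: the intersection of all closed half spaces of reflection hyperplanes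
that contain it. -/
def clos (F : Set W) : Set W :=
  {v | ∀ (β : PosRoot b) (n : ℤ), (F ⊆ hypPos P β n → (n : ℚ) ≤ P.root' β v) ∧
    (F ⊆ hypNeg P β n → P.root' β v ≤ n)}

/-- `B₋`: the unique alcove with wall `B` that lies below the hyperplane containing `B`. -/
def minus (s : SimpleRefl b) (B : Wall s) : Alcove b :=
  @Classical.epsilon _ ⟨Orb.base P _⟩ fun C => B.1 ⊆ clos b C.1 ∧
    ∃ (α : PosRoot b) (n : ℤ), B.1 ⊆ hyp P α n ∧ C.1 ⊆ hypNeg P α n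

/-- `B₊`: the unique alcove with wall `B` that lies above the hyperplane containing `B`. -/
def plus (s : SimpleRefl b) (B : Wall s) : Alcove b :=
  @Classical.epsilon _ ⟨Orb.base P _⟩ fun C => B.1 ⊆ clos b C.1 ∧
    ∃ (α : PosRoot b) (n : ℤ), B.1 ⊆ hyp P α n ∧ C.1 ⊆ hypPos P α n

/-- The type `α_B` of a wall: the unique positive root `α` such that `B` lies in a hyperplane
`H_{α,n}`. -/
def wallType (s : SimpleRefl b) (B : Wall s) : PosRoot b :=
  @Classical.epsilon _ ⟨s.root⟩ fun α => ∃ n : ℤ, B.1 ⊆ hyp P α n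

/-- `s_β(α) ∈ R⁻`. -/
def ReflNeg (β α : PosRoot b) : Prop := ¬ b.IsPos (P.reflectionPerm β α)

end Geometry

/-! ### The rings `S_k`, `S_k^∅` and `S_k^β` -/

section Rings

variable (k : Type z) [Field k] {ι : Type t} {V : Type u} {W : Type v} [AddCommGroup V]
  [Module ℚ V] [AddCommGroup W] [Module ℚ W] (P : RootPairing ι ℚ V W)

/-- The weight lattice `X`. -/
def weightLattice : Submodule ℤ V where
  carrier := {l | ∀ i, ∃ n : ℤ, P.coroot' i l = n}
  add_mem' := by
    intro l m hl hm i
    obtain ⟨n, hn⟩ := hl i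
    obtain ⟨n', hn'⟩ := hm i
    exact ⟨n + n', by rw [map_add, hn, hn', Int.cast_add]⟩
  zero_mem' := fun i => ⟨0, by simp⟩
  smul_mem' := by
    intro c l hl i
    obtain ⟨n, hn⟩ := hl i
    exact ⟨c * n, by rw [map_zsmul, hn, zsmul_eq_mul, Int.cast_mul]⟩

/-- `S_k`, the symmetric algebra of `X ⊗ k`. -/
abbrev Sk : Type (max z u) := SymmetricAlgebra k (k ⊗[ℤ] weightLattice P)

variable {P} [P.IsCrystallographic]

/-- The root `α` as an element of `S_k`. -/
def rootElt (i : ι) : Sk k P :=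
  SymmetricAlgebra.ι k _ (1 ⊗ₜ[ℤ] (⟨P.root i, fun j => by
    obtain ⟨n, hn⟩ := P.exists_value (S := ℤ) i j
    exact ⟨n, hn.symm⟩⟩ : weightLattice P))

variable (b : P.Base)

/-- The submonoid of `S_k` generated by the positive roots. -/
def rootMonoid : Submonoid (Sk k P) :=
  Submonoid.closure (Set.range fun β : PosRoot b => rootElt k (β : ι))

/-- `S_k^∅ = S_k[α⁻¹ | α ∈ R⁺]`. -/
def Sempty : Type (max z u) := Localization (rootMonoid k b)

instance : CommRing (Sempty k b) := inferInstanceAs (CommRing (Localization (rootMonoid k b)))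

instance : Algebra (Sk k P) (Sempty k b) :=
  inferInstanceAs (Algebra (Sk k P) (Localization (rootMonoid k b)))

instance : IsLocalization (rootMonoid k b) (Sempty k b) :=
  inferInstanceAs (IsLocalization (rootMonoid k b) (Localization (rootMonoid k b)))

instance : Algebra k (Sempty k b) :=
  ((algebraMap (Sk k P) (Sempty k b)).comp (algebraMap k (Sk k P))).toAlgebra

instance : IsScalarTower k (Sk k P) (Sempty k b) := IsScalarTower.of_algebraMap_eq fun _ => rfl

variable {b}

/-- The root `α` as an invertible element of `S_k^∅`. -/
def rootUnit (β : PosRoot b) : (Sempty k b)ˣ :=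
  IsUnit.unit (IsLocalization.map_units (Sempty k b)
    (⟨rootElt k (β : ι), Submonoid.subset_closure ⟨β, rfl⟩⟩ : rootMonoid k b))

/-- `S_k^β = S_k[α⁻¹ | α ∈ R⁺, α ≠ β]`, as a subring of `S_k^∅`. -/
def Sbeta (β : PosRoot b) : Subring (Sempty k b) :=
  (Algebra.adjoin (Sk k P)
    {x : Sempty k b | ∃ α : PosRoot b, α ≠ β ∧ x = ↑(rootUnit k α)⁻¹}).toSubring

variable (b)

/-- The part of degree `d` of `S_k^∅`, where `X ⊗ k` has degree `2`: it is generated by the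
elements `p α₁⁻¹ ⋯ α_l⁻¹`, where `p` is a product of `m` elements of `X ⊗ k` or a linear
combination of such products, `α₁, …, α_l` are positive roots, and `d = 2(m - l)`. -/
def degS (d : ℤ) : AddSubgroup (Sempty k b) :=
  AddSubgroup.closure {x | ∃ (m : ℕ) (p : Sk k P) (l : Multiset (PosRoot b)),
    p ∈ LinearMap.range (SymmetricAlgebra.ι k (k ⊗[ℤ] weightLattice P)) ^ m ∧
    d = 2 * ((m : ℤ) - Multiset.card l) ∧
    x = algebraMap (Sk k P) (Sempty k b) p * ↑(l.map fun α => (rootUnit k α)⁻¹).prod}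

theorem degS_mul (i j : ℤ) : ∀ x ∈ degS k b i, ∀ y ∈ degS k b j, x * y ∈ degS k b (i + j) := by
  intro x hx y hy
  have h₁ : ∀ z ∈ degS k b i, ∀ y ∈ {x | ∃ (m : ℕ) (p : Sk k P) (l : Multiset (PosRoot b)),
      p ∈ LinearMap.range (SymmetricAlgebra.ι k (k ⊗[ℤ] weightLattice P)) ^ m ∧
      j = 2 * ((m : ℤ) - Multiset.card l) ∧
      x = algebraMap (Sk k P) (Sempty k b) p * ↑(l.map fun α => (rootUnit k α)⁻¹).prod},
      z * y ∈ degS k b (i + j) := by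
    rintro z hz _ ⟨m', p', l', hp', rfl, rfl⟩
    unfold degS at hz
    induction hz using AddSubgroup.closure_induction with
    | mem x hx =>
      obtain ⟨m, p, l, hp, rfl, rfl⟩ := hx
      refine AddSubgroup.subset_closure ⟨m + m', p * p', l + l', ?_, ?_, ?_⟩
      · rw [pow_add]
        exact Submodule.mul_mem_mul hp hp'
      · rw [Multiset.card_add]
        push_cast
        ring
      · rw [Multiset.map_add, Multiset.prod_add, map_mul, Units.val_mul]
        ring
    | zero => rw [zero_mul]; exact zero_mem _
    | add x y hx hy h h' => rw [add_mul]; exact add_mem h h'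
    | neg x hx h => rw [neg_mul]; exact neg_mem h
  have hy' := hy
  unfold degS at hy'
  induction hy' using AddSubgroup.closure_induction with
  | mem y hy' => exact h₁ x hx y hy'
  | zero => rw [mul_zero]; exact zero_mem _
  | add y y' h₂ h₃ h h' => rw [mul_add]; exact add_mem (h h₂) (h' h₃)
  | neg y h₂ h => rw [mul_neg]; exact neg_mem (h h₂)

theorem degS_one : (1 : Sempty k b) ∈ degS k b 0 :=
  AddSubgroup.subset_closure ⟨0, 1, 0, by simp, by simp, by simp⟩

instance : SetLike.GradedMonoid (degS k b) where
  one_mem := degS_one k b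
  mul_mem i j x y hx hy := degS_mul k b i j x hx y hy

open LaurentPolynomial in
/-- The homomorphism `S_k → S_k^∅[T, T⁻¹]` that multiplies an element of degree `d` by `T^d`. -/
def coactS : Sk k P →ₐ[k] LaurentPolynomial (Sempty k b) :=
  SymmetricAlgebra.lift
    (((LinearMap.mul k (LaurentPolynomial (Sempty k b))).flip (T 2)).comp
      ((Algebra.linearMap (Sempty k b) (LaurentPolynomial (Sempty k b))).restrictScalars k ∘ₗ
        (Algebra.linearMap (Sk k P) (Sempty k b)).restrictScalars k ∘ₗ SymmetricAlgebra.ι k _))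

open LaurentPolynomial in
theorem coactS_ι (x : k ⊗[ℤ] weightLattice P) :
    coactS k b (SymmetricAlgebra.ι k _ x) =
      C (algebraMap (Sk k P) (Sempty k b) (SymmetricAlgebra.ι k _ x)) * T 2 := by
  rw [coactS, SymmetricAlgebra.lift_ι_apply]
  rfl

open LaurentPolynomial in
theorem coactS_pow (m : ℕ) (p : Sk k P)
    (hp : p ∈ LinearMap.range (SymmetricAlgebra.ι k (k ⊗[ℤ] weightLattice P)) ^ m) :
    coactS k b p = C (algebraMap (Sk k P) (Sempty k b) p) * T (2 * m) := by
  induction hp using Submodule.pow_induction_on_left' with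
  | algebraMap r =>
    rw [AlgHom.commutes, ← IsScalarTower.algebraMap_apply]
    simp only [Nat.cast_zero, mul_zero, T_zero, mul_one]
    rfl
  | add x y i hx hy h h' => rw [map_add, h, h', map_add, map_add, add_mul]
  | mem_mul x hx i y hy h =>
    obtain ⟨z, rfl⟩ := hx
    rw [map_mul, h, coactS_ι, map_mul, map_mul, Nat.cast_succ, mul_add_one, T_add]
    ring

open LaurentPolynomial in
theorem coactS_isUnit' (t : Sk k P) (ht : t ∈ rootMonoid k b) : IsUnit (coactS k b t) := by
  unfold rootMonoid at ht
  induction ht using Submonoid.closure_induction with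
  | mem x hx =>
    obtain ⟨β, rfl⟩ := hx
    rw [show coactS k b (rootElt k (β : ι)) = _ from coactS_ι k b _]
    exact ((rootUnit k β).isUnit.map C).mul (isUnit_T 2)
  | one => rw [map_one]; exact isUnit_one
  | mul x y hx hy h h' => rw [map_mul]; exact h.mul h'

/-- `coactS` as a homomorphism of commutative rings. -/
def coactR : Sk k P →+* LaurentPolynomial (Sempty k b) := (coactS k b).toRingHom

theorem coactS_isUnit (t : rootMonoid k b) : IsUnit (coactR k b t) :=
  coactS_isUnit' k b t t.2

/-- The extension of `coactS` to `S_k^∅`. -/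
def coactE : Sempty k b →+* LaurentPolynomial (Sempty k b) :=
  IsLocalization.lift (M := rootMonoid k b) (g := coactR k b) (coactS_isUnit k b)

theorem coactE_algebraMap (p : Sk k P) :
    coactE k b (algebraMap (Sk k P) (Sempty k b) p) = coactS k b p :=
  IsLocalization.lift_eq (M := rootMonoid k b) (g := coactR k b) (coactS_isUnit k b) p

open LaurentPolynomial in
theorem coactE_unit (β : PosRoot b) :
    coactE k b (rootUnit k β) = C (rootUnit k β : Sempty k b) * T 2 := by
  have h : (rootUnit k β : Sempty k b) = algebraMap (Sk k P) (Sempty k b) (rootElt k (β : ι)) :=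
    rfl
  rw [h, coactE_algebraMap]
  exact coactS_ι k b _

open LaurentPolynomial in
theorem coactE_inv (β : PosRoot b) :
    coactE k b ↑(rootUnit k β)⁻¹ = C (↑(rootUnit k β)⁻¹ : Sempty k b) * T (-2) := by
  have h : coactE k b ↑(rootUnit k β)⁻¹ * coactE k b (rootUnit k β) = 1 := by
    rw [← map_mul, Units.inv_mul, map_one]
  rw [coactE_unit] at h
  calc _ = coactE k b ↑(rootUnit k β)⁻¹ * (C (↑(rootUnit k β) * ↑(rootUnit k β)⁻¹ : Sempty k b) *
        (T 2 * T (-2))) := by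
          rw [Units.mul_inv, ← T_add]
          simp
    _ = (coactE k b ↑(rootUnit k β)⁻¹ * (C (rootUnit k β : Sempty k b) * T 2)) *
        (C (↑(rootUnit k β)⁻¹ : Sempty k b) * T (-2)) := by
          rw [map_mul]
          ring
    _ = _ := by rw [h, one_mul]

open LaurentPolynomial in
theorem coactE_deg (d : ℤ) (x : Sempty k b) (hx : x ∈ degS k b d) :
    coactE k b x = C x * T d := by
  unfold degS at hx
  induction hx using AddSubgroup.closure_induction with
  | mem x hx =>
    obtain ⟨m, p, l, hp, rfl, rfl⟩ := hx
    have h : ∀ l : Multiset (PosRoot b),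
        coactE k b ↑(l.map fun α => (rootUnit k α)⁻¹).prod =
          C (↑(l.map fun α => (rootUnit k α)⁻¹).prod : Sempty k b) *
            T (-(2 * (Multiset.card l : ℤ))) := by
      intro l
      induction l using Multiset.induction with
      | empty => simp
      | cons α l ih =>
        rw [Multiset.map_cons, Multiset.prod_cons, Units.val_mul, map_mul, ih, coactE_inv, map_mul,
          Multiset.card_cons, Nat.cast_succ,
          show -(2 * ((Multiset.card l : ℤ) + 1)) = -2 + -(2 * (Multiset.card l : ℤ)) by ring,
          T_add]
        ring
    rw [map_mul, h l, coactE_algebraMap, coactS_pow k b m p hp, map_mul, mul_sub, sub_eq_add_neg, T_add]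
    ring
  | zero => simp
  | add x y hx hy h h' => rw [map_add, h, h', map_add, add_mul]
  | neg x hx h => rw [map_neg, h, map_neg]; ring

theorem degS_internal : DirectSum.IsInternal (degS k b) := by
  constructor
  · rw [injective_iff_map_eq_zero]
    intro a ha
    have h : ∀ (a : DirectSum ℤ fun i => degS k b i) (i : ℤ),
        (coactE k b (DirectSum.coeAddMonoidHom (degS k b) a)).coeff i = (a i : Sempty k b) := by
      intro a i
      induction a using DirectSum.induction_on with
      | zero => simp
      | of j x =>
        rw [DirectSum.coeAddMonoidHom_of, coactE_deg k b j x x.2,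
          ← LaurentPolynomial.single_eq_C_mul_T, AddMonoidAlgebra.coeff_single]
        by_cases hij : j = i
        · subst hij
          rw [Finsupp.single_eq_same, DirectSum.of_eq_same]
        · rw [DirectSum.of_eq_of_ne _ _ _ (Ne.symm hij), Finsupp.single_eq_of_ne (Ne.symm hij)]
          rfl
      | add x y hx hy => simp [hx, hy]
    refine DFinsupp.ext fun i => Subtype.ext ?_
    rw [← h a i, ha]
    simp
  · have hr : ∀ d, ∀ x ∈ degS k b d, x ∈ (DirectSum.coeRingHom (degS k b)).range := fun d x hx =>
      ⟨DirectSum.of (fun i => degS k b i) d ⟨x, hx⟩, DirectSum.coeRingHom_of _ _ _⟩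
    have hS : ∀ p : Sk k P, algebraMap (Sk k P) (Sempty k b) p ∈
        (DirectSum.coeRingHom (degS k b)).range := by
      intro p
      induction p using SymmetricAlgebra.induction with
      | algebraMap r =>
        refine hr 0 _ (AddSubgroup.subset_closure ⟨0, algebraMap k _ r, 0, ?_, by simp, by simp⟩)
        rw [pow_zero]
        exact Submodule.algebraMap_mem r
      | ι x =>
        refine hr 2 _ (AddSubgroup.subset_closure
          ⟨1, SymmetricAlgebra.ι k _ x, 0, ?_, by simp, by simp⟩)
        rw [pow_one]
        exact ⟨x, rfl⟩
      | mul x y hx hy => rw [map_mul]; exact mul_mem hx hy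
      | add x y hx hy => rw [map_add]; exact add_mem hx hy
    have ht : ∀ t ∈ rootMonoid k b, ∃ y ∈ (DirectSum.coeRingHom (degS k b)).range,
        algebraMap (Sk k P) (Sempty k b) t * y = 1 := by
      intro t ht
      unfold rootMonoid at ht
      induction ht using Submonoid.closure_induction with
      | mem x hx =>
        obtain ⟨β, rfl⟩ := hx
        refine ⟨↑(rootUnit k β)⁻¹, hr (-2) _ (AddSubgroup.subset_closure
          ⟨0, 1, {β}, by simp, by simp, by simp⟩), (rootUnit k β).mul_inv⟩
      | one => exact ⟨1, one_mem _, by simp⟩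
      | mul x y hx hy h h' =>
        obtain ⟨a, ha, ha'⟩ := h
        obtain ⟨c, hc, hc'⟩ := h'
        refine ⟨a * c, mul_mem ha hc, ?_⟩
        rw [map_mul, mul_mul_mul_comm, ha', hc', one_mul]
    intro x
    obtain ⟨⟨p, t⟩, hp⟩ := IsLocalization.surj (rootMonoid k b) x
    obtain ⟨y, hy, hty⟩ := ht t t.2
    have hx : x = algebraMap (Sk k P) (Sempty k b) p * y := by
      rw [← hp, mul_assoc, hty, mul_one]
    obtain ⟨a, ha⟩ : x ∈ (DirectSum.coeRingHom (degS k b)).range := by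
      rw [hx]
      exact mul_mem (hS p) hy
    exact ⟨a, ha⟩

end Rings

/-! ### The two families of translation functors, and special objects -/

section Special

variable (k : Type z) [Field k] {ι : Type t} {V : Type u} {W : Type v} [AddCommGroup V]
  [Module ℚ V] [AddCommGroup W] [Module ℚ W] {P : RootPairing ι ℚ V W} [P.IsCrystallographic]
  (b : P.Base)

/-- The category `K_k(O)`, for the orbit `O` of the facet `F₀`. -/
abbrev KCat (F₀ : Set W) : Type _ :=
  KObj (degS k b) (fun β : PosRoot b => Sbeta k β) (up (b := b) (F₀ := F₀))

/-- The category `K_k`. -/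
abbrev KAlc : Type _ := KCat k b (fundAlcove b)

variable {b}

/-- The category `K_k^s`. -/
abbrev KWall (s : SimpleRefl b) : Type _ := KCat k b (fundWall s)

/-- The translation functor onto the walls, without constants. -/
def Ton (s : SimpleRefl b) : KAlc k b ⥤ KWall k s :=
  onFunctor (minus s) (plus s) fun _ _ => 1

/-- The translation functor out of the walls, without constants. -/
def Tout (s : SimpleRefl b) : KWall k s ⥤ KAlc k b :=
  outFunctor (minus s) (bar s) (fun β => rootUnit k β) fun _ _ => 1

/-- `T^s = T_out^s ∘ T_on^s`. -/
def Tr (s : SimpleRefl b) : KAlc k b ⥤ KAlc k b := Ton k s ⋙ Tout k s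

open Classical in
/-- The constants `a_C^β` of Andersen, Jantzen and Soergel. -/
def aConst (s : SimpleRefl b) (C : Alcove b) (β : PosRoot b) : (Sempty k b)ˣ :=
  if ReflNeg β (wallType s (bar s C)) then
    if C = plus s (bar s C) then -rootUnit k (wallType s (bar s C))
    else (rootUnit k (wallType s (bar s C)))⁻¹
  else 1

/-- The translation functor of Andersen, Jantzen and Soergel onto the walls. -/
def Ton' (s : SimpleRefl b) : KAlc k b ⥤ KWall k s :=
  onFunctor (minus s) (plus s) (aConst k s)

/-- The translation functor of Andersen, Jantzen and Soergel out of the walls. -/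
def Tout' (s : SimpleRefl b) : KWall k s ⥤ KAlc k b :=
  outFunctor (minus s) (bar s) (fun _ => 1) (aConst k s)

/-- `T'^s = T'_out^s ∘ T'_on^s`. -/
def Tr' (s : SimpleRefl b) : KAlc k b ⥤ KAlc k b := Ton' k s ⋙ Tout' k s

variable (b)

/-- The unit object `P₀`: `P₀(A_e, β) = S^β` and `P₀(β ↓ A_e, β) = S^β`. -/
def P₀ : KAlc k b :=
  unitObj (degS_internal k b) (degS_mul k b) (Orb.base P (fundAlcove b)) (fun _ => 1) fun _ => 1

/-- The unit object of Andersen, Jantzen and Soergel: `P₀'(A_e, β) = S^β` and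
`P₀'(β ↓ A_e, β) = β S^β`. -/
def P₀' : KAlc k b :=
  unitObj (degS_internal k b) (degS_mul k b) (Orb.base P (fundAlcove b)) (fun _ => 1)
    fun β => rootUnit k β

variable {k b}

/-- The object `T^s (… (T^t U))` for a sequence `s, …, t`. -/
def iterTr (T : SimpleRefl b → KAlc k b ⥤ KAlc k b) (U : KAlc k b) (l : List (SimpleRefl b)) :
    KAlc k b :=
  l.foldr (fun s N => (T s).obj N) U

/-- The objects of `K_k` that are isomorphic to a direct summand of a finite direct sum of objects
`T^s (… (T^t U))⟨n⟩`. -/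
def IsSpecial (T : SimpleRefl b → KAlc k b ⥤ KAlc k b) (U : KAlc k b) :
    ObjectProperty (KAlc k b) := fun M =>
  ∃ (m : ℕ) (l : Fin m → List (SimpleRefl b)) (n : Fin m → ℤ),
    IsDirectSummand M (KObj.dsum fun i => (iterTr T U (l i)).shift (n i))

variable (k b)

/-- The property that defines the full subcategory `M_k` of `K_k`. -/
def SpecialM : ObjectProperty (KAlc k b) := IsSpecial (Tr k) (P₀ k b)

/-- The property that defines the full subcategory `M_k'` of `K_k`. -/
def SpecialM' : ObjectProperty (KAlc k b) := IsSpecial (Tr' k) (P₀' k b)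

variable {b}

/-- The property that defines the full subcategory `M_k^s` of `K_k^s`. -/
def SpecialW (s : SimpleRefl b) : ObjectProperty (KWall k s) := fun N =>
  ∃ M : KAlc k b, SpecialM k b M ∧ IsDirectSummand N ((Ton k s).obj M)

/-! ### The rescaling functors -/

open Classical in
/-- `d_C^β`: the product of the `α⁻¹` over all reflection hyperplanes `H_{α,n}` with
`C ⊆ H_{α,n}^-`, `β ↑ C ⊆ H_{α,n}^+` and `s_β(α) ∈ R⁻`. -/
def dAlc (C : Alcove b) (β : PosRoot b) : (Sempty k b)ˣ :=
  ∏ᶠ (p : PosRoot b × ℤ) (_ : C.1 ⊆ hypNeg P p.1 p.2 ∧ (up β C).1 ⊆ hypPos P p.1 p.2 ∧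
    ReflNeg β p.1), (rootUnit k p.1)⁻¹

open Classical in
/-- `d_B^β` for a wall `B`. -/
def dWall (s : SimpleRefl b) (B : Wall s) (β : PosRoot b) : (Sempty k b)ˣ :=
  if ReflNeg β (wallType s B) then rootUnit k (wallType s B) * dAlc k (minus s B) β
  else dAlc k (minus s B) β

variable (b)

open Classical in
/-- The functor `γ : K_k → K_k` given by the scalars `γ_C^{β,-} = d_C^β`, `γ_C^{β,+} = 1`. -/
def gammaAlc : KAlc k b ⥤ KAlc k b :=
  scaleFunctor fun C β G => if G = C then dAlc k C β else 1

variable {b}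

open Classical in
/-- The functor `γ^s : K_k^s → K_k^s` given by the scalars `γ_B^{β,-} = d_B^β`, `γ_B^{β,+} = 1` if
`β ↑ B ≠ B`, and `γ_B^β = 1` if `β ↑ B = B`. -/
def gammaWall (s : SimpleRefl b) : KWall k s ⥤ KWall k s :=
  scaleFunctor fun B β G => if up β B ≠ B ∧ G = B then dWall k s B β else 1

end Special

end AJS

end

noncomputable section

namespace AJS

universe t u v w x y z

/-! ### Finite root systems: dominance and the highest root. -/

section Roots

variable {ι : Type t} {V : Type u} {W : Type v} [AddCommGroup V] [Module ℚ V] [AddCommGroup W]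
  [Module ℚ W] {P : RootPairing ι ℚ V W}

/-! Both families of translation functors have the same underlying modules, so the comparison
isomorphisms can be taken to be the identity on every `M(F)`. The intertwining statements then
become equalities of submodules, and these come down to identities between the constants `a_C^β`,
`d_C^β` and `d_B^β`.

At a wall `B` with `β ↑ B ≠ B` one wants `d_C = a_C d_B` for both alcoves `C` at `B`. For `C = B₋`
this is how `d_B` is defined. For `C = B₊` write `α = α_B`. The products `d_{B₋}` and `d_{B₊}` can
differ only in the hyperplane of `B` and its mirror image, which contains `β ↑ B`. If `s_β(α)` is
positive, neither of these is counted. Otherwise both are counted for `B₋` only, and `d_{B₋} = α⁻¹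
γ⁻¹ d_{B₊}` with `γ = -s_β(α) = cβ - α`. Hence `d_{B₊} = u a_{B₊} d_B` with `u = -γ α⁻¹ = 1 -
cβα⁻¹`: the wanted identity fails by a unit which, like its inverse, lies in `1 + β S^β`
(`dAlc_plus_eq`).

This defect is invisible on special objects. Their submodules `M(F, β)` with `β ↑ F ≠ F` are stable
under `(m, m') ↦ (βm, 0)`, so that `(u, 1)` maps each of them onto itself (`img_stretch_of_stable`).
The property, called `Stab`, holds for `P₀` and passes to translates, shifts, direct sums and direct
summands.

At a wall with `β ↑ B = B` one has `d_{B₋} = a_{B₋} = β⁻¹`, and the factor `β` in `T_out` disappears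
because `d_C β` is a unit of `S^β` (`dAlc_mul_rootUnit_mem`).

Multiplication by the product of all positive roots identifies `γP₀` with a shift of `P₀'`
(`gammaUnitIso`). Together with the intertwining isomorphisms this matches the generators of the two
categories up to shift, which gives the equivalence on special objects.

The geometry rests on the free action of the affine Weyl group on alcoves
(`eq_one_of_mem_fundAlcove`): it makes the map from alcoves to walls equivariant. Freeness follows
from an exchange argument for words in the simple affine reflections, whose description of `A_e`
needs the highest root (`exists_isHighest`). -/

theorem root'_indexNeg (i : ι) (v : W) : P.root' (P.reflectionPerm i i) v = -P.root' i v := by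
  simp [RootPairing.root', RootPairing.root_reflectionPerm]

theorem root'_reflectionPerm (i j : ι) (v : W) :
    P.root' (P.reflectionPerm i j) v = P.root' j v - P.pairing j i * P.root' i v := by
  simp [RootPairing.root', RootPairing.root_reflectionPerm, RootPairing.reflection_apply]

theorem pairing_pos_iff [P.IsCrystallographic] (i j : ι) :
    0 < P.pairing i j ↔ 0 < P.pairingIn ℤ i j := by
  rw [← P.algebraMap_pairingIn ℤ]
  simp

theorem pairing_neg_iff [P.IsCrystallographic] (i j : ι) :
    P.pairing i j < 0 ↔ P.pairingIn ℤ i j < 0 := by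
  rw [← P.algebraMap_pairingIn ℤ]
  simp

theorem pairing_pos_comm [Finite ι] [P.IsCrystallographic] (i j : ι) :
    0 < P.pairing i j ↔ 0 < P.pairing j i := by
  rw [pairing_pos_iff, pairing_pos_iff, P.zero_lt_pairingIn_iff']

theorem exists_pairing_eq_intCast [P.IsCrystallographic] (i j : ι) :
    ∃ n : ℤ, P.pairing i j = n :=
  ⟨P.pairingIn ℤ i j, by rw [← P.algebraMap_pairingIn ℤ]; rfl⟩

variable (b : P.Base)

/-- The simple roots form a basis of `V`, and the perfect pairing makes `W` the dual of `V`. -/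
theorem exists_root'_eq [P.IsRootSystem] (c : ι → ℚ) :
    ∃ v : W, ∀ i ∈ b.support, P.root' i v = c i := by
  let f : V →ₗ[ℚ] ℚ := b.toWeightBasis.constr ℚ fun i => c i
  obtain ⟨v, hv⟩ := (LinearMap.IsPerfPair.bijective_right P.toLinearMap).2 f
  refine ⟨v, fun i hi => ?_⟩
  have := LinearMap.congr_fun hv (P.root i)
  rw [← b.toWeightBasis_apply ⟨i, hi⟩, Module.Basis.constr_basis] at this
  rw [← this, b.toWeightBasis_apply]
  rfl

variable {b}

theorem root_mem_closure [Finite ι] [P.IsCrystallographic] {i : ι} (hi : b.IsPos i) :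
    P.root i ∈ AddSubmonoid.closure (P.root '' b.support) := by
  refine RootPairing.Base.IsPos.induction_on_add hi
    (p := fun i => P.root i ∈ AddSubmonoid.closure (P.root '' b.support))
    (fun i hi => AddSubmonoid.subset_closure ⟨i, hi, rfl⟩) fun i j l h hi hj => ?_
  rw [h]
  exact add_mem hi (AddSubmonoid.subset_closure ⟨j, hj, rfl⟩)

theorem toLinearMap_nonneg_of_mem_closure {x : V}
    (hx : x ∈ AddSubmonoid.closure (P.root '' b.support))
    {v : W} (hv : ∀ i ∈ b.support, 0 ≤ P.root' i v) : 0 ≤ P.toLinearMap x v := by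
  induction hx using AddSubmonoid.closure_induction with
  | mem x hx =>
    obtain ⟨i, hi, rfl⟩ := hx
    exact hv i hi
  | zero => simp
  | add x y _ _ hx hy =>
    rw [map_add, LinearMap.add_apply]
    exact add_nonneg hx hy

theorem toLinearMap_pos_of_mem_closure {x : V}
    (hx : x ∈ AddSubmonoid.closure (P.root '' b.support)) (h0 : x ≠ 0)
    {v : W} (hv : ∀ i ∈ b.support, 0 < P.root' i v) : 0 < P.toLinearMap x v := by
  have : x = 0 ∨ 0 < P.toLinearMap x v := by
    clear h0
    induction hx using AddSubmonoid.closure_induction with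
    | mem x hx =>
      obtain ⟨i, hi, rfl⟩ := hx
      exact Or.inr (hv i hi)
    | zero => simp
    | add x y _ _ hx hy =>
      rcases hx with rfl | hx
      · simpa using hy
      rcases hy with rfl | hy
      · simpa using Or.inr hx
      rw [map_add, LinearMap.add_apply]
      exact Or.inr (add_pos hx hy)
  exact this.resolve_left h0

theorem root'_pos_of_isPos [Finite ι] [P.IsCrystallographic] {i : ι} (hi : b.IsPos i)
    {v : W} (hv : ∀ i ∈ b.support, 0 < P.root' i v) : 0 < P.root' i v :=
  toLinearMap_pos_of_mem_closure (root_mem_closure hi) (P.ne_zero i) hv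

theorem isPos_reflectionPerm_self (i : ι) : b.IsPos (P.reflectionPerm i i) ↔ ¬ b.IsPos i :=
  RootPairing.Base.IsPos.neg_iff_not b i

variable (b)

/-- The vector on which all simple roots take the value `1`, half the sum of the positive
coroots. -/
theorem exists_root'_eq_height [P.IsRootSystem] :
    ∃ v : W, ∀ i, P.root' i v = b.height i := by
  obtain ⟨v, hv⟩ := exists_root'_eq b 1
  refine ⟨v, fun i => ?_⟩
  obtain ⟨f, -, -, hf⟩ := b.exists_root_eq_sum_int i
  rw [RootPairing.Base.height_eq_sum hf, RootPairing.root', hf, map_sum, LinearMap.sum_apply,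
    Int.cast_sum]
  refine Finset.sum_congr rfl fun j hj => ?_
  rw [map_zsmul, LinearMap.smul_apply, zsmul_eq_mul, show P.toLinearMap (P.root j) v = 1 from hv j hj,
    mul_one]

variable {b}

theorem pairing_nonpos_of_mem_support [Finite ι] [P.IsCrystallographic] {i j : ι}
    (hi : i ∈ b.support) (hj : j ∈ b.support) (h : i ≠ j) : P.pairing i j ≤ 0 := by
  have := b.pairingIn_le_zero_of_ne h hi hj
  rw [← not_lt, pairing_pos_iff, not_lt]
  exact this

/-- A positive root whose pairings with the simple coroots are nonnegative involves all simple
roots. -/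
theorem coeff_pos_of_dominant [Finite ι] [P.IsRootSystem] [P.IsCrystallographic] [P.IsReduced]
    [P.IsIrreducible] {θ : ι} (hd : ∀ i ∈ b.support, 0 ≤ P.pairing θ i)
    {c : ι → ℚ} (hc : P.root θ = ∑ i ∈ b.support, c i • P.root i)
    (hc0 : ∀ i ∈ b.support, 0 ≤ c i) : ∀ i ∈ b.support, 0 < c i := by
  classical
  let I : Set ι := {i | i ∈ b.support ∧ 0 < c i}
  -- For `j` outside the support `I` of `θ`, the pairing of `θ` with the coroot of `j` is a sum of
  -- nonpositive terms. It is nonnegative by dominance, so every term vanishes.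
  have horth : ∀ j ∈ b.support, j ∉ I → ∀ i ∈ I, P.IsOrthogonal j i := by
    intro j hj hjI i hi
    have hsum : P.pairing θ j = ∑ i ∈ b.support, c i * P.pairing i j := by
      rw [← P.root_coroot_eq_pairing, hc, map_sum, LinearMap.sum_apply]
      refine Finset.sum_congr rfl fun i _ => ?_
      rw [map_smul, LinearMap.smul_apply, P.root_coroot_eq_pairing, smul_eq_mul]
    have hterm : ∀ i ∈ b.support, c i * P.pairing i j ≤ 0 := by
      intro i hi
      rcases eq_or_ne i j with rfl | hij
      · have : c i = 0 := le_antisymm (not_lt.mp fun h => hjI ⟨hi, h⟩) (hc0 i hi)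
        rw [this, zero_mul]
      · exact mul_nonpos_of_nonneg_of_nonpos (hc0 i hi) (pairing_nonpos_of_mem_support hi hj hij)
    have h0 := (Finset.sum_eq_zero_iff_of_nonpos hterm).mp
      (le_antisymm (Finset.sum_nonpos hterm) (hsum ▸ hd j hj)) i hi.1
    have h1 : P.pairing i j = 0 := (mul_eq_zero.mp h0).resolve_left hi.2.ne'
    exact ⟨P.pairing_eq_zero_iff.mp h1, h1⟩
  -- Simple reflections with index in `I` preserve the span of `I`, all others fix it pointwise;
  -- irreducibility then makes it the whole space.
  have hinv : ∀ j, Submodule.span ℚ (P.root '' I) ∈ Module.End.invtSubmodule (P.reflection j) := by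
    rw [← b.forall_mem_support_invtSubmodule_iff]
    intro j hj
    by_cases hjI : j ∈ I
    · exact Submodule.mem_invtSubmodule_reflection_of_mem _ _
        (Submodule.subset_span ⟨j, hjI, rfl⟩)
    · refine (Module.End.mem_invtSubmodule _).mpr fun x hx => ?_
      rwa [Submodule.mem_comap, LinearEquiv.coe_coe,
        (P.isFixedPt_reflection_of_isOrthogonal (horth j hj hjI) hx).eq]
  have hne : Submodule.span ℚ (P.root '' I) ≠ ⊥ := by
    intro h
    apply P.ne_zero θ
    rw [hc]
    refine Finset.sum_eq_zero fun i hi => ?_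
    by_cases hiI : i ∈ I
    · exact absurd (Submodule.mem_bot ℚ |>.mp (h ▸ Submodule.subset_span ⟨i, hiI, rfl⟩))
        (P.ne_zero i)
    · rw [le_antisymm (not_lt.mp fun h => hiI ⟨hi, h⟩) (hc0 i hi), zero_smul]
  have htop := RootPairing.IsIrreducible.eq_top_of_invtSubmodule_reflection _ hinv hne
  intro i hi
  by_contra hci
  -- A fundamental coweight at a missing simple root vanishes on the span of `I`, but not on that
  -- root.
  obtain ⟨v, hv⟩ := exists_root'_eq b (Pi.single i 1)
  have hker : Submodule.span ℚ (P.root '' I) ≤ LinearMap.ker (P.toLinearMap.flip v) := by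
    rw [Submodule.span_le]
    rintro _ ⟨j, hj, rfl⟩
    have := hv j hj.1
    rw [Pi.single_eq_of_ne (by rintro rfl; exact hci hj.2)] at this
    exact this
  have h1 : P.root i ∈ LinearMap.ker (P.toLinearMap.flip v) := hker (htop ▸ Submodule.mem_top)
  have h2 := hv i hi
  rw [Pi.single_eq_same] at h2
  exact one_ne_zero (h2.symm.trans h1)

theorem exists_root_eq_sum_of_isPos [Finite ι] [P.IsCrystallographic] {θ : ι} (hθ : b.IsPos θ) :
    ∃ c : ι → ℚ, P.root θ = ∑ i ∈ b.support, c i • P.root i ∧ ∀ i ∈ b.support, 0 ≤ c i := by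
  obtain ⟨f, -, hf, h⟩ := b.exists_root_eq_sum_int θ
  have hf' : 0 < f := by
    refine hf.resolve_right fun hneg => ?_
    have := RootPairing.Base.height_eq_sum h
    rw [RootPairing.Base.isPos_iff, this] at hθ
    exact hθ.not_ge (Finset.sum_nonpos fun i _ => hneg.le i)
  refine ⟨fun i => f i, ?_, fun i _ => Int.cast_nonneg (hf'.le i)⟩
  rw [h]
  exact Finset.sum_congr rfl fun i _ => (Int.cast_smul_eq_zsmul ℚ _ _).symm

/-- Expand `θ'` in simple roots: all coefficients are positive, every simple root pairs
nonnegatively with the coroot of `θ`, and at least one does so positively. -/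
theorem pairing_pos_of_dominant [Finite ι] [P.IsRootSystem] [P.IsCrystallographic] [P.IsReduced]
    [P.IsIrreducible] {θ θ' : ι} (hθ : b.IsPos θ) (hd : ∀ i ∈ b.support, 0 ≤ P.pairing θ i)
    (hθ' : b.IsPos θ') (hd' : ∀ i ∈ b.support, 0 ≤ P.pairing θ' i) : 0 < P.pairing θ' θ := by
  obtain ⟨c, hc, hc0⟩ := exists_root_eq_sum_of_isPos hθ'
  have hcpos := coeff_pos_of_dominant hd' hc hc0
  obtain ⟨j, hj, hjθ⟩ := hθ.exists_mem_support_pos_pairingIn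
  rw [← pairing_pos_iff] at hjθ
  rw [← P.root_coroot_eq_pairing, hc, map_sum, LinearMap.sum_apply]
  refine Finset.sum_pos' (fun i hi => ?_) ⟨j, hj, ?_⟩
  · rw [map_smul, LinearMap.smul_apply, P.root_coroot_eq_pairing, smul_eq_mul]
    refine mul_nonneg (hc0 i hi) ?_
    rcases (hd i hi).eq_or_lt with h | h
    · rw [P.pairing_eq_zero_iff.mp h.symm]
    · exact ((pairing_pos_comm _ _).mp h).le
  · rw [map_smul, LinearMap.smul_apply, P.root_coroot_eq_pairing, smul_eq_mul]
    exact mul_pos (hcpos j hj) hjθ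

/-- If the pairing with a simple coroot were negative, adding that simple root to `θ` would give a
root. -/
theorem pairing_nonneg_of_maximal [Finite ι] [P.IsCrystallographic] {θ : ι} (hθ : b.IsPos θ)
    (hmax : ∀ i ∈ b.support, ∀ η, P.root η ≠ P.root θ + P.root i) :
    ∀ i ∈ b.support, 0 ≤ P.pairing θ i := by
  intro i hi
  by_contra! h
  rw [pairing_neg_iff] at h
  obtain ⟨η, hη⟩ := P.root_add_root_mem_of_pairingIn_neg h (by
    intro h'
    have : θ = P.reflectionPerm i i := P.root.injective (by
      rw [h', RootPairing.root_reflectionPerm, RootPairing.reflection_apply_self])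
    rw [this, isPos_reflectionPerm_self] at hθ
    exact hθ (RootPairing.Base.isPos_of_mem_support hi))
  exact hmax i hi η hη

variable (b)

/-- Let `θ` have maximal height, and for given `β` let `θ'` have maximal height among the positive
roots above `β`. Both are dominant, hence pair positively, so if they differ then `η = θ - θ'` is a
root. By maximality of `θ` it is positive; but then `θ` lies above `β` and is higher than `θ'`, a
contradiction. -/
theorem exists_isHighest [Finite ι] [P.IsRootSystem] [P.IsCrystallographic] [P.IsReduced]
    [P.IsIrreducible] : ∃ γ : PosRoot b, IsHighest b γ := by
  have hV : Nontrivial V := RootPairing.IsIrreducible.nontrivial P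
  have hι : Nonempty ι := by
    by_contra h
    rw [not_nonempty_iff] at h
    have := RootPairing.IsRootSystem.span_root_eq_top (P := P)
    rw [Set.range_eq_empty, Submodule.span_empty] at this
    exact bot_ne_top this
  obtain ⟨α, hα⟩ := b.support_nonempty
  obtain ⟨θ, hθ, hθmax⟩ := Set.exists_max_image {i | b.IsPos i} b.height (Set.toFinite _)
    ⟨α, RootPairing.Base.isPos_of_mem_support hα⟩
  refine ⟨⟨θ, hθ⟩, fun β => ?_⟩
  obtain ⟨θ', ⟨hθ', hβ⟩, hmax'⟩ := Set.exists_max_image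
    {i | b.IsPos i ∧ P.root i - P.root β ∈ AddSubmonoid.closure (P.root '' b.support)} b.height
    (Set.toFinite _) ⟨β, β.2, by rw [sub_self]; exact zero_mem _⟩
  have hd : ∀ i ∈ b.support, 0 ≤ P.pairing θ i := by
    refine pairing_nonneg_of_maximal hθ fun i hi η h => ?_
    have h1 := b.height_add h
    rw [RootPairing.Base.height_one_of_mem_support hi] at h1
    have := hθmax η (RootPairing.Base.IsPos.add hθ (RootPairing.Base.isPos_of_mem_support hi) h)
    omega
  have hd' : ∀ i ∈ b.support, 0 ≤ P.pairing θ' i := by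
    refine pairing_nonneg_of_maximal hθ' fun i hi η h => ?_
    have h1 := b.height_add h
    rw [RootPairing.Base.height_one_of_mem_support hi] at h1
    have := hmax' η ⟨RootPairing.Base.IsPos.add hθ' (RootPairing.Base.isPos_of_mem_support hi) h, by
      rw [h, add_sub_right_comm]
      exact add_mem hβ (AddSubmonoid.subset_closure ⟨i, hi, rfl⟩)⟩
    omega
  have hp := pairing_pos_of_dominant hθ' hd' hθ hd
  rw [pairing_pos_iff] at hp
  rcases eq_or_ne θ θ' with rfl | hne
  · exact hβ
  obtain ⟨η, hη⟩ := P.root_sub_root_mem_of_pairingIn_pos hp hne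
  have hh := b.height_sub hη
  have h2 := hθmax θ' hθ'
  have hη0 := b.height_ne_zero η
  have hηpos : b.IsPos η := by
    rw [RootPairing.Base.isPos_iff]
    omega
  have h3 := hmax' θ ⟨hθ, by
    have : P.root θ - P.root β = P.root η + (P.root θ' - P.root β) := by rw [hη]; abel
    rw [this]
    exact add_mem (root_mem_closure hηpos) hβ⟩
  rw [RootPairing.Base.isPos_iff] at hηpos
  omega

end Roots

/-! ### Affine roots and their reflections. -/

section AffineRoots

variable {ι : Type t} {V : Type u} {W : Type v} [AddCommGroup V] [Module ℚ V] [AddCommGroup W]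
  [Module ℚ W] (P : RootPairing ι ℚ V W)

/-- The value of the affine root `α - n` at a vector. -/
def affEval (p : ι × ℤ) (v : W) : ℚ := P.root' p.1 v - p.2

/-- The affine root `-(α - n)`. -/
def affNeg (p : ι × ℤ) : ι × ℤ := (P.reflectionPerm p.1 p.1, -p.2)

theorem affEval_affNeg (p : ι × ℤ) (v : W) : affEval P (affNeg P p) v = -affEval P p v := by
  simp only [affEval, affNeg, root'_indexNeg, Int.cast_neg]
  ring

/-- Evaluation at `0` recovers the level, and perfectness of the pairing then recovers the root. -/
theorem affEval_injective {p q : ι × ℤ} (h : ∀ v, affEval P p v = affEval P q v) : p = q := by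
  have h2 : p.2 = q.2 := by simpa [affEval] using h 0
  have h1 : P.root p.1 = P.root q.1 := by
    apply (LinearMap.IsPerfPair.bijective_left P.toLinearMap).1
    ext v
    have := h v
    simp only [affEval, h2, sub_left_inj] at this
    exact this
  exact Prod.ext (P.root.injective h1) h2

theorem affNeg_affNeg (p : ι × ℤ) : affNeg P (affNeg P p) = p :=
  affEval_injective P fun v => by rw [affEval_affNeg, affEval_affNeg, neg_neg]

/-- The reflection in the zero set of an affine root. -/
def reflOf (p : ι × ℤ) : W ≃ᵃ[ℚ] W := affRefl P p.1 p.2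

theorem reflOf_apply (p : ι × ℤ) (v : W) :
    reflOf P p v = v - affEval P p v • P.coroot p.1 :=
  affRefl_apply P _ _ _

theorem reflOf_mem (p : ι × ℤ) : reflOf P p ∈ affWeyl P :=
  Subgroup.subset_closure ⟨_, _, rfl⟩

theorem affEval_reflOf_self (p : ι × ℤ) (v : W) :
    affEval P p (reflOf P p v) = -affEval P p v := by
  rw [reflOf_apply]
  simp only [affEval, map_sub, map_smul, P.root'_coroot_eq_pairing, P.pairing_same, smul_eq_mul]
  ring

theorem reflOf_reflOf (p : ι × ℤ) (v : W) : reflOf P p (reflOf P p v) = v := by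
  rw [reflOf_apply, affEval_reflOf_self, reflOf_apply]
  module

theorem reflOf_mul_self (p : ι × ℤ) : reflOf P p * reflOf P p = 1 :=
  AffineEquiv.ext fun v => reflOf_reflOf P p v

theorem reflOf_inv (p : ι × ℤ) : (reflOf P p)⁻¹ = reflOf P p :=
  inv_eq_of_mul_eq_one_left (reflOf_mul_self P p)

theorem reflOf_affNeg (p : ι × ℤ) : reflOf P (affNeg P p) = reflOf P p := by
  refine AffineEquiv.ext fun v => ?_
  have : P.coroot (affNeg P p).1 = -P.coroot p.1 := by
    simp [affNeg, RootPairing.coroot_reflectionPerm]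
  rw [reflOf_apply, reflOf_apply, affEval_affNeg, this, neg_smul_neg]

theorem affEval_reflOf (p q : ι × ℤ) (v : W) :
    affEval P q (reflOf P p v) = affEval P q v - affEval P p v * P.pairing q.1 p.1 := by
  rw [reflOf_apply]
  simp only [affEval, map_sub, map_smul, P.root'_coroot_eq_pairing, smul_eq_mul]
  ring

variable [P.IsCrystallographic]

/-- Affine reflections permute the affine roots: integrality of the pairing keeps the level an
integer. The reflection in the transformed root is the conjugate one. -/
theorem exists_affEval_reflOf (p q : ι × ℤ) :
    ∃ r : ι × ℤ, (∀ v, affEval P r v = affEval P q (reflOf P p v)) ∧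
      reflOf P r = reflOf P p * reflOf P q * reflOf P p := by
  obtain ⟨n, hn⟩ := exists_pairing_eq_intCast (P := P) q.1 p.1
  have h1 : ∀ v, affEval P (P.reflectionPerm p.1 q.1, q.2 - n * p.2) v =
      affEval P q (reflOf P p v) := by
    intro v
    rw [affEval_reflOf]
    simp only [affEval, root'_reflectionPerm, hn, Int.cast_sub, Int.cast_mul]
    ring
  refine ⟨_, h1, AffineEquiv.ext fun v => ?_⟩
  rw [reflOf_apply, h1]
  simp only [AffineEquiv.mul_def, AffineEquiv.trans_apply]
  rw [reflOf_apply P q, reflOf_apply P p (_ - _)]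
  have h2 : affEval P p (reflOf P p v - affEval P q (reflOf P p v) • P.coroot q.1) =
      -affEval P p v - affEval P q (reflOf P p v) * P.pairing p.1 q.1 := by
    rw [← affEval_reflOf_self]
    simp only [affEval, map_sub, map_smul, P.root'_coroot_eq_pairing, smul_eq_mul]
    ring
  rw [h2, RootPairing.coroot_reflectionPerm, RootPairing.coreflection_apply,
    P.root'_coroot_eq_pairing]
  nth_rw 2 [reflOf_apply P p v]
  module

/-- The claim for `g⁻¹` is carried along so that the induction over the generated subgroup passes
through inverses. -/
theorem exists_affEval_comp' (g : W ≃ᵃ[ℚ] W) (hg : g ∈ affWeyl P) :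
    (∀ p, ∃ q, ∀ v, affEval P q v = affEval P p (g v)) ∧
      ∀ p, ∃ q, ∀ v, affEval P q v = affEval P p (g⁻¹ v) := by
  unfold affWeyl at hg
  induction hg using Subgroup.closure_induction with
  | mem g hg =>
    obtain ⟨i, n, rfl⟩ := hg
    have h : ∀ p, ∃ q, ∀ v, affEval P q v = affEval P p (reflOf P (i, n) v) := fun p => by
      obtain ⟨r, hr, -⟩ := exists_affEval_reflOf P (i, n) p
      exact ⟨r, hr⟩
    refine ⟨h, fun p => ?_⟩
    have : (affRefl P i n)⁻¹ = reflOf P (i, n) := reflOf_inv P (i, n)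
    rw [this]
    exact h p
  | one => exact ⟨fun p => ⟨p, fun _ => rfl⟩, fun p => ⟨p, fun _ => by rw [inv_one]; rfl⟩⟩
  | mul g h _ _ ihg ihh =>
    refine ⟨fun p => ?_, fun p => ?_⟩
    · obtain ⟨q, hq⟩ := ihg.1 p
      obtain ⟨r, hr⟩ := ihh.1 q
      exact ⟨r, fun v => by rw [hr, hq]; rfl⟩
    · obtain ⟨q, hq⟩ := ihh.2 p
      obtain ⟨r, hr⟩ := ihg.2 q
      exact ⟨r, fun v => by rw [hr, hq, mul_inv_rev]; rfl⟩
  | inv g _ ih => exact ⟨ih.2, fun p => by rw [inv_inv]; exact ih.1 p⟩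

theorem exists_affEval_comp (g : affWeyl P) (p : ι × ℤ) :
    ∃ q, ∀ v, affEval P q v = affEval P p ((g : W ≃ᵃ[ℚ] W) v) :=
  (exists_affEval_comp' P g g.2).1 p

theorem exists_affEval_comp_inv (g : affWeyl P) (p : ι × ℤ) :
    ∃ q, ∀ v, affEval P q ((g : W ≃ᵃ[ℚ] W) v) = affEval P p v := by
  obtain ⟨q, hq⟩ := (exists_affEval_comp' P g g.2).2 p
  exact ⟨q, fun v => by rw [hq]; exact congrArg _ ((g : W ≃ᵃ[ℚ] W).symm_apply_apply v)⟩

end AffineRoots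

/-! ### The fundamental alcove and its walls. -/

section FundamentalAlcove

variable {ι : Type t} {V : Type u} {W : Type v} [AddCommGroup V] [Module ℚ V] [AddCommGroup W]
  [Module ℚ W] {P : RootPairing ι ℚ V W} [P.IsCrystallographic]

omit [P.IsCrystallographic] in
theorem affine_root_cases (b : P.Base) (p : ι × ℤ) :
    ∃ (β : PosRoot b) (n : ℤ), p = (β.1, n) ∨ p = affNeg P (β.1, n) := by
  by_cases h : b.IsPos p.1
  · exact ⟨⟨p.1, h⟩, p.2, Or.inl rfl⟩
  · refine ⟨⟨P.reflectionPerm p.1 p.1, (isPos_reflectionPerm_self _).mpr h⟩, -p.2, Or.inr ?_⟩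
    exact (affNeg_affNeg P p).symm

variable (b : P.Base)

omit [P.IsCrystallographic] in
theorem affEval_pos_of_nonpos (β : PosRoot b) {n : ℤ} (hn : n ≤ 0) {v : W}
    (hv : 0 < P.root' β v) : 0 < affEval P (β.1, n) v := by
  have : (n : ℚ) ≤ 0 := by exact_mod_cast hn
  simp only [affEval]
  linarith

omit [P.IsCrystallographic] in
theorem affEval_neg_of_pos (β : PosRoot b) {n : ℤ} (hn : 1 ≤ n) {v : W}
    (hv : P.root' β v < 1) : affEval P (β.1, n) v < 0 := by
  have : (1 : ℚ) ≤ n := by exact_mod_cast hn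
  simp only [affEval]
  linarith

-- Positive roots take values strictly between `0` and `1` on `A_e`, so only the alternative `n ≤ 0`
-- or `n ≥ 1` for the level matters.
omit [P.IsCrystallographic] in
theorem affEval_fundAlcove (p : ι × ℤ) :
    (∀ v ∈ fundAlcove b, 0 < affEval P p v) ∨ ∀ v ∈ fundAlcove b, affEval P p v < 0 := by
  obtain ⟨β, n, h⟩ := affine_root_cases b p
  have h1 : (∀ v ∈ fundAlcove b, 0 < affEval P (β.1, n) v) ∨
      ∀ v ∈ fundAlcove b, affEval P (β.1, n) v < 0 := by
    rcases le_or_gt n 0 with hn | hn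
    · exact Or.inl fun v hv => affEval_pos_of_nonpos b β hn (hv β).1
    · exact Or.inr fun v hv => affEval_neg_of_pos b β hn (hv β).2
  rcases h with rfl | rfl
  · exact h1
  · simp only [affEval_affNeg, neg_pos, neg_neg_iff_pos]
    exact h1.symm

-- A description of `A_e` by affine roots alone, which the affine Weyl group carries to every other
-- alcove.
omit [P.IsCrystallographic] in
theorem mem_fundAlcove_iff (v : W) :
    v ∈ fundAlcove b ↔
      ∀ p, (∀ w ∈ fundAlcove b, 0 < affEval P p w) → 0 < affEval P p v := by
  refine ⟨fun hv p hp => hp v hv, fun h β => ⟨?_, ?_⟩⟩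
  · have := h (β.1, 0) fun w hw => affEval_pos_of_nonpos b β le_rfl (hw β).1
    simpa [affEval] using this
  · have := h (affNeg P (β.1, 1)) fun w hw => by
      rw [affEval_affNeg, neg_pos]
      exact affEval_neg_of_pos b β le_rfl (hw β).2
    rw [affEval_affNeg] at this
    simpa [affEval] using this

variable {b}

/-- The affine root that vanishes on the wall of `A_e` fixed by a simple affine reflection and
is positive on `A_e`. -/
def simpleAff (s : SimpleRefl b) : ι × ℤ :=
  if s.level = 0 then (s.root, s.level) else affNeg P (s.root, s.level)

omit [P.IsCrystallographic] in
theorem simpleAff_eq (s : SimpleRefl b) :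
    simpleAff s = (s.root.1, s.level) ∨ simpleAff s = affNeg P (s.root.1, s.level) := by
  unfold simpleAff
  split_ifs
  · exact Or.inl rfl
  · exact Or.inr rfl

omit [P.IsCrystallographic] in
theorem SimpleRefl.level_eq (s : SimpleRefl b) : s.level = 0 ∨ s.level = 1 := by
  rcases s.simple with h | h
  · exact Or.inl h.2
  · exact Or.inr h.2

omit [P.IsCrystallographic] in
theorem affEval_simpleAff_pos (s : SimpleRefl b) {v : W} (hv : v ∈ fundAlcove b) :
    0 < affEval P (simpleAff s) v := by
  unfold simpleAff
  split_ifs with h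
  · exact affEval_pos_of_nonpos b _ h.le (hv _).1
  · rw [affEval_affNeg, neg_pos]
    exact affEval_neg_of_pos b _ (s.level_eq.resolve_left h).ge (hv _).2

omit [P.IsCrystallographic] in
theorem affEval_simpleAff_fundWall (s : SimpleRefl b) {v : W} (hv : v ∈ fundWall s) :
    affEval P (simpleAff s) v = 0 := by
  have : affEval P (s.root.1, s.level) v = 0 := sub_eq_zero.mpr hv.1
  rcases simpleAff_eq s with h | h
  · rw [h, this]
  · rw [h, affEval_affNeg, this, neg_zero]

omit [P.IsCrystallographic] in
theorem reflOf_simpleAff_fundWall (s : SimpleRefl b) {v : W} (hv : v ∈ fundWall s) :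
    reflOf P (simpleAff s) v = v := by
  rw [reflOf_apply, affEval_simpleAff_fundWall s hv, zero_smul, sub_zero]

omit [P.IsCrystallographic] in
/-- An affine root that does not vanish on the wall has the same sign on the wall and on `A_e`. -/
theorem affEval_fundWall (s : SimpleRefl b) (p : ι × ℤ) (h : p ≠ simpleAff s)
    (h' : p ≠ affNeg P (simpleAff s)) :
    ((∀ v ∈ fundAlcove b, 0 < affEval P p v) ∧ ∀ v ∈ fundWall s, 0 < affEval P p v) ∨
      ((∀ v ∈ fundAlcove b, affEval P p v < 0) ∧ ∀ v ∈ fundWall s, affEval P p v < 0) := by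
  obtain ⟨β, n, hp⟩ := affine_root_cases b p
  have hne : β = s.root → n ≠ s.level := by
    rintro rfl rfl
    rcases hp with rfl | rfl <;> rcases simpleAff_eq s with hs | hs <;> rw [hs] at h h'
    · exact h rfl
    · exact h' (affNeg_affNeg P _).symm
    · exact h' rfl
    · exact h rfl
  have h1 : ((∀ v ∈ fundAlcove b, 0 < affEval P (β.1, n) v) ∧
      ∀ v ∈ fundWall s, 0 < affEval P (β.1, n) v) ∨
      ((∀ v ∈ fundAlcove b, affEval P (β.1, n) v < 0) ∧
      ∀ v ∈ fundWall s, affEval P (β.1, n) v < 0) := by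
    by_cases hβ : β = s.root
    · have hnl := hne hβ
      have hw : ∀ v ∈ fundWall s, affEval P (β.1, n) v = s.level - n := fun v hv => by
        simp only [affEval, hβ]
        rw [hv.1]
      rcases le_or_gt n 0 with hn | hn
      · refine Or.inl ⟨fun v hv => affEval_pos_of_nonpos b β hn (hv β).1, fun v hv => ?_⟩
        rw [hw v hv, sub_pos, Int.cast_lt]
        rcases s.level_eq with h | h <;> omega
      · refine Or.inr ⟨fun v hv => affEval_neg_of_pos b β hn (hv β).2, fun v hv => ?_⟩
        rw [hw v hv, sub_neg, Int.cast_lt]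
        rcases s.level_eq with h | h <;> omega
    · rcases le_or_gt n 0 with hn | hn
      · exact Or.inl ⟨fun v hv => affEval_pos_of_nonpos b β hn (hv β).1,
          fun v hv => affEval_pos_of_nonpos b β hn (hv.2 β hβ).1⟩
      · exact Or.inr ⟨fun v hv => affEval_neg_of_pos b β hn (hv β).2,
          fun v hv => affEval_neg_of_pos b β hn (hv.2 β hβ).2⟩
  rcases hp with rfl | rfl
  · exact h1
  · simp only [affEval_affNeg, neg_pos, neg_neg_iff_pos]
    exact h1.symm

variable [Finite ι] [P.IsRootSystem]

omit [P.IsCrystallographic] in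
variable (b) in
/-- A point of `A_e` at which the values of the affine roots have bounded denominators. -/
theorem exists_mem_fundAlcove :
    ∃ v ∈ fundAlcove b, ∃ N : ℕ, 0 < N ∧ ∀ p, ∃ z : ℤ, affEval P p v * N = z := by
  obtain ⟨ρ, hρ⟩ := exists_root'_eq_height b
  obtain ⟨M, hM⟩ := (Set.finite_range b.height).bddAbove
  have hN : (0 : ℚ) < (M.toNat + 1 : ℕ) := by positivity
  -- All heights are at most `M`, so dividing the height vector by `M + 1` brings the values of the
  -- positive roots into the open unit interval; `M + 1` also clears all denominators.
  refine ⟨((M.toNat + 1 : ℕ) : ℚ)⁻¹ • ρ, fun β => ?_, M.toNat + 1, by omega, fun p =>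
    ⟨b.height p.1 - p.2 * (M.toNat + 1), ?_⟩⟩
  · rw [map_smul, hρ, smul_eq_mul]
    have hβ : 0 < b.height β := β.2
    refine ⟨mul_pos (inv_pos.mpr hN) (by exact_mod_cast hβ), ?_⟩
    rw [inv_mul_lt_one₀ hN]
    have := hM (Set.mem_range_self β.1)
    have : b.height β < (M.toNat + 1 : ℕ) := by omega
    exact_mod_cast this
  · simp only [affEval, map_smul, hρ, smul_eq_mul]
    rw [sub_mul, mul_right_comm, inv_mul_cancel₀ hN.ne', one_mul]
    push_cast
    ring

omit [P.IsCrystallographic] in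
theorem fundAlcove_nonempty : (fundAlcove b).Nonempty :=
  let ⟨v, hv, _⟩ := exists_mem_fundAlcove b
  ⟨v, hv⟩

variable [P.IsReduced]

/-- For a simple root, take a point of `A_e` and set its coordinate at that root to `0`, keeping the
other simple coordinates. For the highest root, rescale a point of `A_e` until the highest root
takes the value `1`; all other positive roots are then strictly smaller. -/
theorem fundWall_nonempty (s : SimpleRefl b) : (fundWall s).Nonempty := by
  obtain ⟨v, hv, -⟩ := exists_mem_fundAlcove b
  rcases s.simple with ⟨hs, hl⟩ | ⟨hs, hl⟩
  · classical
    obtain ⟨w, hw⟩ := exists_root'_eq b (fun i => if i = s.root.1 then 0 else P.root' i v)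
    have hnn : ∀ i ∈ b.support, 0 ≤ P.root' i w := fun i hi => by
      rw [hw i hi]
      split_ifs
      · exact le_rfl
      · exact (hv ⟨i, RootPairing.Base.isPos_of_mem_support hi⟩).1.le
    refine ⟨w, by rw [hl, hw _ hs]; simp, fun β hβ => ⟨?_, ?_⟩⟩
    · have h0 : 0 ≤ P.root' β w := toLinearMap_nonneg_of_mem_closure (root_mem_closure β.2) hnn
      -- If `β` vanished at `w`, it would be a multiple of the simple root `α` of the wall. Then
      -- `s_α(β) = -β`, whereas `s_α` keeps positive roots other than `α` positive.
      refine h0.lt_of_ne' fun h => ?_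
      have h1 := RootPairing.Base.IsPos.reflectionPerm β.2 hs fun h => hβ (Subtype.ext h)
      obtain ⟨c, hc, hc0⟩ := exists_root_eq_sum_of_isPos β.2
      have hβw : P.root' β w = ∑ i ∈ b.support, c i * P.root' i w := by
        rw [RootPairing.root', hc, map_sum, LinearMap.sum_apply]
        exact Finset.sum_congr rfl fun i _ => by rw [map_smul, LinearMap.smul_apply]; rfl
      rw [hβw, Finset.sum_eq_zero_iff_of_nonneg fun i hi => mul_nonneg (hc0 i hi) (hnn i hi)] at h
      have hc1 : ∀ i ∈ b.support, i ≠ s.root.1 → c i = 0 := fun i hi his => by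
        refine (mul_eq_zero.mp (h i hi)).resolve_right ?_
        rw [hw i hi, if_neg his]
        exact (hv ⟨i, RootPairing.Base.isPos_of_mem_support hi⟩).1.ne'
      rw [Finset.sum_eq_single_of_mem _ hs fun i hi his => by rw [hc1 i hi his, zero_smul]] at hc
      have h2 := (hv ⟨_, h1⟩).1
      have h3 := (hv s.root).1
      have h4 : P.root' β v = c s.root * P.root' s.root v := by
        rw [RootPairing.root', hc, map_smul, LinearMap.smul_apply]
        rfl
      have h5 : P.pairing β s.root = c s.root * 2 := by
        rw [← P.root_coroot_eq_pairing, hc, map_smul, LinearMap.smul_apply,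
          P.root_coroot_eq_pairing, P.pairing_same, smul_eq_mul]
      have h6 := (hv β).1
      simp only [root'_reflectionPerm] at h2
      rw [h5, h4] at h2
      rw [h4] at h6
      linarith
    · have hle : 0 ≤ P.root' β (v - w) := by
        refine toLinearMap_nonneg_of_mem_closure (root_mem_closure β.2) fun i hi => ?_
        rw [map_sub, hw i hi]
        split_ifs
        · simpa using (hv ⟨i, RootPairing.Base.isPos_of_mem_support hi⟩).1.le
        · simp
      rw [map_sub] at hle
      linarith [(hv β).2]
  · have hpos := (hv s.root).1
    have hsup : ∀ i ∈ b.support, 0 < P.root' i v := fun i hi =>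
      (hv ⟨i, RootPairing.Base.isPos_of_mem_support hi⟩).1
    refine ⟨(P.root' s.root v)⁻¹ • v, ?_, fun β hβ => ?_⟩
    · rw [map_smul, smul_eq_mul, inv_mul_cancel₀ hpos.ne', hl, Int.cast_one]
    · rw [map_smul, smul_eq_mul]
      refine ⟨mul_pos (inv_pos.mpr hpos) (hv β).1, ?_⟩
      rw [inv_mul_lt_one₀ hpos]
      have := toLinearMap_pos_of_mem_closure (hs β)
        (sub_ne_zero.mpr fun h => hβ (Subtype.ext (P.root.injective h)).symm) hsup
      rw [map_sub, LinearMap.sub_apply, sub_pos] at this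
      exact this

/-- A simple affine reflection keeps all affine roots positive on `A_e` but one. -/
theorem affEval_reflOf_simpleAff_pos (s : SimpleRefl b) {p : ι × ℤ} (hp : p ≠ simpleAff s)
    (hpos : ∀ v ∈ fundAlcove b, 0 < affEval P p v) :
    ∀ v ∈ fundAlcove b, 0 < affEval P p (reflOf P (simpleAff s) v) := by
  obtain ⟨x, hx⟩ := fundAlcove_nonempty (b := b)
  obtain ⟨y, hy⟩ := fundWall_nonempty s
  have hp' : p ≠ affNeg P (simpleAff s) := by
    rintro rfl
    have := hpos x hx
    rw [affEval_affNeg] at this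
    linarith [affEval_simpleAff_pos s hx]
  have hyp : 0 < affEval P p y := by
    rcases affEval_fundWall s p hp hp' with h | h
    · exact h.2 y hy
    · linarith [h.1 x hx, hpos x hx]
  obtain ⟨q, hq, -⟩ := exists_affEval_reflOf P (simpleAff s) p
  -- The reflection fixes the wall point `y`, so `q`, the composite of `p` with the reflection, is
  -- positive at `y`. It therefore does not vanish on the wall and has the same sign on `A_e`.
  have hqy : 0 < affEval P q y := by rwa [hq, reflOf_simpleAff_fundWall s hy]
  intro v hv
  rw [← hq]
  have h0 := affEval_simpleAff_fundWall s hy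
  rcases affEval_fundWall s q (by rintro rfl; linarith)
    (by rintro rfl; rw [affEval_affNeg] at hqy; linarith) with h | h
  · exact h.1 v hv
  · linarith [h.2 y hy]

variable [P.IsIrreducible]

-- Positivity on simple roots gives positivity on all positive roots, and the bound `< 1` for the
-- highest root dominates all the others.
variable (b) in
theorem mem_fundAlcove_of_simpleAff {v : W}
    (h : ∀ s : SimpleRefl b, 0 < affEval P (simpleAff s) v) : v ∈ fundAlcove b := by
  have hsup : ∀ i ∈ b.support, 0 < P.root' i v := fun i hi => by
    have := h ⟨⟨i, RootPairing.Base.isPos_of_mem_support hi⟩, 0, Or.inl ⟨hi, rfl⟩⟩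
    simpa [simpleAff, affEval] using this
  obtain ⟨γ, hγ⟩ := exists_isHighest b
  have h1 : P.root' γ v < 1 := by
    have := h ⟨γ, 1, Or.inr ⟨hγ, rfl⟩⟩
    rw [simpleAff, if_neg one_ne_zero, affEval_affNeg] at this
    simpa [affEval] using this
  refine fun β => ⟨root'_pos_of_isPos β.2 hsup, ?_⟩
  have := toLinearMap_nonneg_of_mem_closure (hγ β) fun i hi => (hsup i hi).le
  rw [map_sub, LinearMap.sub_apply, sub_nonneg] at this
  exact this.trans_lt h1

end FundamentalAlcove

/-! ### Words in simple affine reflections and freeness of the action on alcoves. -/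

section Words

variable {ι : Type t} {V : Type u} {W : Type v} [AddCommGroup V] [Module ℚ V] [AddCommGroup W]
  [Module ℚ W] {P : RootPairing ι ℚ V W} {b : P.Base}

/-- The product of the simple affine reflections in a list. -/
def word (l : List (SimpleRefl b)) : W ≃ᵃ[ℚ] W := (l.map fun s => reflOf P (simpleAff s)).prod

theorem word_cons (s : SimpleRefl b) (l : List (SimpleRefl b)) :
    word (s :: l) = reflOf P (simpleAff s) * word l := by
  simp [word]

theorem word_append (l l' : List (SimpleRefl b)) : word (l ++ l') = word l * word l' := by
  simp [word]

theorem word_singleton (s : SimpleRefl b) : word [s] = reflOf P (simpleAff s) := by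
  simp [word]

theorem exists_word_eq_inv (l : List (SimpleRefl b)) : ∃ l' : List (SimpleRefl b), word l' = (word l)⁻¹ := by
  induction l with
  | nil => exact ⟨[], by simp [word]⟩
  | cons s l ih =>
    obtain ⟨l', h⟩ := ih
    exact ⟨l' ++ [s], by rw [word_append, word_singleton, word_cons, mul_inv_rev, h, reflOf_inv]⟩

variable [P.IsCrystallographic] [Finite ι] [P.IsRootSystem] [P.IsReduced]

/-- The exchange property: a word that crosses the zero set of an affine root can be shortened by
the reflection in it. -/
theorem exists_word_shorter {x : W} (hx : x ∈ fundAlcove b) (l : List (SimpleRefl b)) :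
    ∀ p : ι × ℤ, 0 < affEval P p x → affEval P p (word l x) < 0 →
      ∃ l' : List (SimpleRefl b), l'.length < l.length ∧ reflOf P p * word l = word l' := by
  induction l with
  | nil =>
    intro p h h'
    exact absurd h' (not_lt.mpr h.le)
  | cons s l ih =>
    intro p h h'
    by_cases hp : p = simpleAff s
    -- If `p` belongs to the first letter, the reflection cancels that letter.
    · exact ⟨l, by simp, by rw [word_cons, ← mul_assoc, hp, reflOf_mul_self, one_mul]⟩
    -- Otherwise move the reflection past the first letter: the transformed root `q` is still
    -- positive on `A_e` and is crossed by the remaining word.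
    · obtain ⟨q, hq, hqr⟩ := exists_affEval_reflOf P (simpleAff s) p
      have hpos : ∀ v ∈ fundAlcove b, 0 < affEval P p v := by
        rcases affEval_fundAlcove b p with h1 | h1
        · exact h1
        · linarith [h1 x hx]
      obtain ⟨l', hl, h2⟩ := ih q (by
        rw [hq]
        exact affEval_reflOf_simpleAff_pos s hp hpos x hx) (by
        rw [hq]
        rw [word_cons] at h'
        exact h')
      refine ⟨s :: l', by simpa using hl, ?_⟩
      rw [word_cons, word_cons, ← h2, hqr]
      simp only [← mul_assoc, reflOf_mul_self, one_mul]

/-- Induction on the length. When a word with first letter `s` returns to `A_e`, the remaining word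
has already crossed the wall of `s`, so the exchange property replaces the word by a strictly
shorter one. -/
theorem word_eq_one_of_mem {x : W} (hx : x ∈ fundAlcove b) (l : List (SimpleRefl b))
    (h : word l x ∈ fundAlcove b) : word l = 1 := by
  induction hn : l.length using Nat.strong_induction_on generalizing l with
  | _ n ih =>
    rcases l with _ | ⟨s, l⟩
    · simp [word]
    · have h1 : affEval P (simpleAff s) (word l x) < 0 := by
        have h2 := affEval_simpleAff_pos s h
        have h3 : word (s :: l) x = reflOf P (simpleAff s) (word l x) := by
          rw [word_cons]
          rfl
        rw [h3, affEval_reflOf_self] at h2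
        linarith
      obtain ⟨l', hl', h2⟩ := exists_word_shorter hx l _ (affEval_simpleAff_pos s hx) h1
      rw [← word_cons] at h2
      rw [h2]
      refine ih l'.length ?_ l' (h2 ▸ h) rfl
      rw [← hn, List.length_cons]
      omega

variable [P.IsIrreducible]

-- Induction on the value of a positive affine root `p` at a point `x` of `A_e`; bounded
-- denominators make this value discrete. If `p` is not simple, its reflection takes `x` out of
-- `A_e`, hence across the wall of some simple affine reflection `s`. Transforming `p` by `s` lowers
-- its value at `x` and keeps it positive, and the reflection in `p` is a conjugate by `s`.
variable (b) in
theorem exists_word_eq_reflOf (p : ι × ℤ) : ∃ l : List (SimpleRefl b), word l = reflOf P p := by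
  obtain ⟨x, hx, N, hN, hint⟩ := exists_mem_fundAlcove b
  have hN' : (0 : ℚ) < N := by exact_mod_cast hN
  have key : ∀ (m : ℕ) (p : ι × ℤ), 0 < affEval P p x → affEval P p x * N < m →
      ∃ l : List (SimpleRefl b), word l = reflOf P p := by
    intro m
    induction m with
    | zero =>
      intro p h h'
      rw [Nat.cast_zero] at h'
      exact absurd h' (not_lt.mpr (mul_pos h hN').le)
    | succ m ih =>
      intro p h h'
      by_cases hs : ∃ s : SimpleRefl b, p = simpleAff s
      · obtain ⟨s, rfl⟩ := hs
        exact ⟨[s], word_singleton s⟩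
      · have hpos : ∀ v ∈ fundAlcove b, 0 < affEval P p v := by
          rcases affEval_fundAlcove b p with h1 | h1
          · exact h1
          · linarith [h1 x hx]
        obtain ⟨s, hsn⟩ : ∃ s : SimpleRefl b, affEval P (simpleAff s) (reflOf P p x) < 0 := by
          by_contra! hall
          have hmem : reflOf P p x ∈ fundAlcove b := by
            refine mem_fundAlcove_of_simpleAff b fun s => (hall s).lt_of_ne' fun h0 => ?_
            obtain ⟨q, hq, -⟩ := exists_affEval_reflOf P p (simpleAff s)
            rw [← hq] at h0
            rcases affEval_fundAlcove b q with h1 | h1 <;> linarith [h1 x hx]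
          have := hpos _ hmem
          rw [affEval_reflOf_self] at this
          linarith
        have hps : p ≠ simpleAff s := fun h => hs ⟨s, h⟩
        have hsx := affEval_simpleAff_pos s hx
        rw [affEval_reflOf] at hsn
        -- The simple affine root is positive at `x` and negative at its mirror image in `p`, which
        -- forces a positive pairing; this is what makes the value drop.
        have hpair : 0 < P.pairing (simpleAff s).1 p.1 := by
          by_contra! hle
          have := mul_nonpos_of_nonneg_of_nonpos h.le hle
          linarith
        rw [pairing_pos_comm] at hpair
        obtain ⟨q, hq, hqr⟩ := exists_affEval_reflOf P (simpleAff s) p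
        have hq0 : 0 < affEval P q x := by
          rw [hq]
          exact affEval_reflOf_simpleAff_pos s hps hpos x hx
        have hlt : affEval P q x < affEval P p x := by
          rw [hq, affEval_reflOf]
          have := mul_pos hsx hpair
          linarith
        obtain ⟨l, hl⟩ := ih q hq0 (by
          obtain ⟨c, hc⟩ := hint p
          obtain ⟨d, hd⟩ := hint q
          have h1 := mul_lt_mul_of_pos_right hlt hN'
          rw [hc, hd, Int.cast_lt] at h1
          rw [hc] at h'
          rw [hd]
          have h2 : c < (m + 1 : ℕ) := by exact_mod_cast h'
          have h3 : d < m := by push_cast at h2; omega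
          exact_mod_cast h3)
        refine ⟨s :: (l ++ [s]), ?_⟩
        rw [word_cons, word_append, word_singleton, hl, hqr]
        simp only [mul_assoc, reflOf_mul_self, mul_one]
        rw [← mul_assoc, reflOf_mul_self, one_mul]
  rcases lt_trichotomy (affEval P p x) 0 with h | h | h
  · obtain ⟨m, hm⟩ := exists_nat_gt (affEval P (affNeg P p) x * N)
    rw [← reflOf_affNeg]
    exact key m _ (by rw [affEval_affNeg]; linarith) hm
  · rcases affEval_fundAlcove b p with h1 | h1 <;> linarith [h1 x hx]
  · obtain ⟨m, hm⟩ := exists_nat_gt (affEval P p x * N)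
    exact key m _ h hm

variable (b) in
theorem exists_word_eq {g : W ≃ᵃ[ℚ] W} (hg : g ∈ affWeyl P) :
    ∃ l : List (SimpleRefl b), word l = g := by
  unfold affWeyl at hg
  induction hg using Subgroup.closure_induction with
  | mem g hg =>
    obtain ⟨i, n, rfl⟩ := hg
    exact exists_word_eq_reflOf b (i, n)
  | one => exact ⟨[], by simp [word]⟩
  | mul g h _ _ ihg ihh =>
    obtain ⟨l, rfl⟩ := ihg
    obtain ⟨l', rfl⟩ := ihh
    exact ⟨l ++ l', word_append l l'⟩
  | inv g _ ih =>
    obtain ⟨l, rfl⟩ := ih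
    exact exists_word_eq_inv l

/-- The affine Weyl group acts freely on the set of alcoves. -/
theorem eq_one_of_mem_fundAlcove {g : W ≃ᵃ[ℚ] W} (hg : g ∈ affWeyl P) {x : W}
    (hx : x ∈ fundAlcove b) (h : g x ∈ fundAlcove b) : g = 1 := by
  obtain ⟨l, rfl⟩ := exists_word_eq b hg
  exact word_eq_one_of_mem hx l h

end Words

/-! ### Alcoves and walls: separation, adjacency and the map from alcoves to walls. -/

section Facets

variable {ι : Type t} {V : Type u} {W : Type v} [AddCommGroup V] [Module ℚ V] [AddCommGroup W]
  [Module ℚ W] {P : RootPairing ι ℚ V W} [P.IsCrystallographic] {b : P.Base}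

theorem affEval_alcove (C : Alcove b) (p : ι × ℤ) :
    (∀ v ∈ C.1, 0 < affEval P p v) ∨ ∀ v ∈ C.1, affEval P p v < 0 := by
  obtain ⟨g, hg⟩ := C.2
  obtain ⟨q, hq⟩ := exists_affEval_comp P g p
  rw [hg]
  simp only [Set.forall_mem_image, ← hq]
  exact affEval_fundAlcove b q

omit [P.IsCrystallographic] in
theorem subset_hypPos_iff (F : Set W) (β : PosRoot b) (n : ℤ) :
    F ⊆ hypPos P β n ↔ ∀ v ∈ F, 0 < affEval P (β.1, n) v :=
  forall₂_congr fun v _ => (sub_pos (a := P.root' β v) (b := (n : ℚ))).symm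

omit [P.IsCrystallographic] in
theorem subset_hypNeg_iff (F : Set W) (β : PosRoot b) (n : ℤ) :
    F ⊆ hypNeg P β n ↔ ∀ v ∈ F, affEval P (β.1, n) v < 0 :=
  forall₂_congr fun v _ => (sub_neg (a := P.root' β v) (b := (n : ℚ))).symm

omit [P.IsCrystallographic] in
theorem subset_hyp_iff (F : Set W) (β : PosRoot b) (n : ℤ) :
    F ⊆ hyp P β n ↔ ∀ v ∈ F, affEval P (β.1, n) v = 0 :=
  forall₂_congr fun v _ => (sub_eq_zero (a := P.root' β v) (b := (n : ℚ))).symm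

theorem alcove_subset_hypPos_or (C : Alcove b) (β : PosRoot b) (n : ℤ) :
    C.1 ⊆ hypPos P β n ∨ C.1 ⊆ hypNeg P β n := by
  rw [subset_hypPos_iff, subset_hypNeg_iff]
  exact affEval_alcove C _

-- Phrased with affine roots of both signs, the closure is visibly equivariant, since the affine
-- Weyl group permutes these.
omit [P.IsCrystallographic] in
theorem mem_clos_iff {F : Set W} {w : W} :
    w ∈ clos b F ↔ ∀ p, (∀ v ∈ F, 0 < affEval P p v) → 0 ≤ affEval P p w := by
  have hpos : ∀ (β : PosRoot b) (n : ℤ), 0 ≤ affEval P (β.1, n) w ↔ (n : ℚ) ≤ P.root' β w :=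
    fun β n => sub_nonneg
  have hneg : ∀ (β : PosRoot b) (n : ℤ), affEval P (β.1, n) w ≤ 0 ↔ P.root' β w ≤ n :=
    fun β n => sub_nonpos
  constructor
  · intro hw p h
    obtain ⟨β, n, rfl | rfl⟩ := affine_root_cases b p
    · exact (hpos β n).mpr ((hw β n).1 ((subset_hypPos_iff _ _ _).mpr h))
    · simp only [affEval_affNeg, neg_pos] at h
      rw [affEval_affNeg, neg_nonneg]
      exact (hneg β n).mpr ((hw β n).2 ((subset_hypNeg_iff _ _ _).mpr h))
  · intro h β n
    refine ⟨fun hF => (hpos β n).mp (h _ ((subset_hypPos_iff _ _ _).mp hF)), fun hF => ?_⟩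
    have := h (affNeg P (β.1, n)) fun w hw => by
      rw [affEval_affNeg, neg_pos]
      exact (subset_hypNeg_iff _ _ _).mp hF w hw
    rw [affEval_affNeg, neg_nonneg] at this
    exact (hneg β n).mp this

theorem image_subset_clos {F F' : Set W} (h : F ⊆ clos b F') (g : affWeyl P) :
    (g : W ≃ᵃ[ℚ] W) '' F ⊆ clos b ((g : W ≃ᵃ[ℚ] W) '' F') := by
  rintro _ ⟨v, hv, rfl⟩
  rw [mem_clos_iff]
  intro p hp
  obtain ⟨q, hq⟩ := exists_affEval_comp P g p
  rw [← hq]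
  refine mem_clos_iff.mp (h hv) q fun w hw => ?_
  rw [hq]
  exact hp _ ⟨w, hw, rfl⟩

/-- The translate of an element of an orbit. -/
def Orb.act {F₀ : Set W} (g : affWeyl P) (F : Orb P F₀) : Orb P F₀ :=
  ⟨(g : W ≃ᵃ[ℚ] W) '' F.1, by
    obtain ⟨h, hh⟩ := F.2
    exact ⟨g * h, by rw [hh, Set.image_image]; rfl⟩⟩

omit [P.IsCrystallographic] in
theorem exists_eq_act {F₀ : Set W} (F : Orb P F₀) : ∃ g, F = Orb.act g (Orb.base P F₀) := by
  obtain ⟨g, hg⟩ := F.2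
  exact ⟨g, Subtype.ext hg⟩

omit [P.IsCrystallographic] in
theorem act_mul {F₀ : Set W} (g h : affWeyl P) (F : Orb P F₀) :
    Orb.act (g * h) F = Orb.act g (Orb.act h F) :=
  Subtype.ext (Set.image_image (g : W ≃ᵃ[ℚ] W) (h : W ≃ᵃ[ℚ] W) F.1).symm

variable [Finite ι] [P.IsRootSystem]

omit [P.IsCrystallographic] in
theorem alcove_nonempty (C : Alcove b) : C.1.Nonempty := by
  obtain ⟨g, hg⟩ := C.2
  rw [hg]
  exact fundAlcove_nonempty.image _

omit [P.IsCrystallographic] in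
theorem alcove_not_hypPos_and_hypNeg (C : Alcove b) {β : PosRoot b} {n : ℤ}
    (h : C.1 ⊆ hypPos P β n) (h' : C.1 ⊆ hypNeg P β n) : False := by
  obtain ⟨v, hv⟩ := alcove_nonempty C
  have h1 : (n : ℚ) < P.root' β v := h hv
  exact lt_asymm h1 (h' hv)

omit [Finite ι] [P.IsRootSystem] in
theorem alcove_subset (C D : Alcove b)
    (h : ∀ p, (∀ v ∈ D.1, 0 < affEval P p v) → ∀ v ∈ C.1, 0 < affEval P p v) : C.1 ⊆ D.1 := by
  intro v hv
  obtain ⟨g, hg⟩ := D.2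
  rw [hg]
  refine ⟨(g : W ≃ᵃ[ℚ] W)⁻¹ v, (mem_fundAlcove_iff b _).mpr fun p hp => ?_,
    (g : W ≃ᵃ[ℚ] W).apply_symm_apply v⟩
  obtain ⟨q, hq⟩ := exists_affEval_comp_inv P g p
  rw [← hq, show (g : W ≃ᵃ[ℚ] W) ((g : W ≃ᵃ[ℚ] W)⁻¹ v) = v from
    (g : W ≃ᵃ[ℚ] W).apply_symm_apply v]
  refine h q ?_ v hv
  rw [hg]
  simp only [Set.forall_mem_image, hq]
  exact hp

/-- Two alcoves that are not separated by a hyperplane are equal. -/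
theorem alcove_ext (C D : Alcove b)
    (h : ∀ (β : PosRoot b) (n : ℤ), C.1 ⊆ hypPos P β n ↔ D.1 ⊆ hypPos P β n) : C = D := by
  have key : ∀ C D : Alcove b, (∀ (β : PosRoot b) (n : ℤ), C.1 ⊆ hypPos P β n ↔ D.1 ⊆ hypPos P β n) →
      C.1 ⊆ D.1 := by
    intro C D h
    refine alcove_subset C D fun p hp => ?_
    obtain ⟨β, n, h1 | h1⟩ := affine_root_cases b p
    · rw [h1, ← subset_hypPos_iff] at hp ⊢
      exact (h β n).mpr hp
    · simp only [h1, affEval_affNeg, neg_pos] at hp ⊢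
      rw [← subset_hypNeg_iff] at hp ⊢
      refine (alcove_subset_hypPos_or C β n).resolve_left fun h2 => ?_
      exact alcove_not_hypPos_and_hypNeg D ((h β n).mp h2) hp
  exact Subtype.ext (Set.Subset.antisymm (key C D h) (key D C fun β n => (h β n).symm))

variable [P.IsReduced]

theorem wall_nonempty {s : SimpleRefl b} (B : Wall s) : B.1.Nonempty := by
  obtain ⟨g, hg⟩ := B.2
  rw [hg]
  exact (fundWall_nonempty s).image _

omit [P.IsCrystallographic] [P.IsReduced] in
theorem fundWall_subset_clos (s : SimpleRefl b) : fundWall s ⊆ clos b (fundAlcove b) := by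
  intro v hv
  rw [mem_clos_iff]
  intro p hp
  obtain ⟨x, hx⟩ := fundAlcove_nonempty (b := b)
  have h0 := affEval_simpleAff_fundWall s hv
  by_cases h1 : p = simpleAff s
  · rw [h1, h0]
  by_cases h2 : p = affNeg P (simpleAff s)
  · rw [h2, affEval_affNeg, h0, neg_zero]
  rcases affEval_fundWall s p h1 h2 with h | h
  · exact (h.2 v hv).le
  · linarith [h.1 x hx, hp x hx]

omit [Finite ι] [P.IsRootSystem] [P.IsReduced] in
/-- A wall lies in exactly one hyperplane and strictly on one side of all others. -/
theorem exists_wall_subset_hyp {s : SimpleRefl b} (B : Wall s) :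
    ∃ (α : PosRoot b) (n : ℤ), B.1 ⊆ hyp P α n ∧ ∀ (β : PosRoot b) (m : ℤ),
      (β, m) ≠ (α, n) → B.1 ⊆ hypPos P β m ∨ B.1 ⊆ hypNeg P β m := by
  obtain ⟨g, hg⟩ := B.2
  obtain ⟨p, hp⟩ := exists_affEval_comp_inv P g (simpleAff s)
  obtain ⟨α, n, h⟩ := affine_root_cases b p
  have h0 : ∀ v, affEval P (α.1, n) ((g : W ≃ᵃ[ℚ] W) v) = affEval P (simpleAff s) v ∨
      affEval P (α.1, n) ((g : W ≃ᵃ[ℚ] W) v) = -affEval P (simpleAff s) v := by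
    intro v
    rcases h with rfl | rfl
    · exact Or.inl (hp v)
    · right
      rw [← hp, affEval_affNeg, neg_neg]
  refine ⟨α, n, ?_, fun β m hne => ?_⟩
  · rw [subset_hyp_iff, hg]
    simp only [Set.forall_mem_image]
    intro v hv
    have := affEval_simpleAff_fundWall s hv
    rcases h0 v with h | h <;> rw [h, this]
    exact neg_zero
  · rw [subset_hypPos_iff, subset_hypNeg_iff, hg]
    simp only [Set.forall_mem_image]
    obtain ⟨q, hq⟩ := exists_affEval_comp P g (β.1, m)
    simp only [← hq]
    have hsurj : ∀ w, ∃ v, (g : W ≃ᵃ[ℚ] W) v = w := (g : W ≃ᵃ[ℚ] W).surjective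
    have hβα : (β.1, m) = (α.1, n) → False := fun h => hne (by
      rw [Prod.mk.injEq] at h ⊢
      exact ⟨Subtype.ext h.1, h.2⟩)
    have hβα' : (β.1, m) = affNeg P (α.1, n) → False := fun h => by
      have h1 := congrArg Prod.fst h
      simp only [affNeg] at h1
      have := β.2
      rw [h1, isPos_reflectionPerm_self] at this
      exact this α.2
    -- If the pullback `q` of `(β, m)` were the simple affine root or its negative, then `(β, m)`
    -- would be `(α, n)` or its negative; the first is excluded by assumption, the second because
    -- `α` and `β` are both positive.
    have hone : ∀ q', q' = simpleAff s ∨ q' = affNeg P (simpleAff s) → q = q' → False := by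
      rintro q' hq' rfl
      have h1 : (∀ v, affEval P (β.1, m) v = affEval P p v) ∨
          ∀ v, affEval P (β.1, m) v = affEval P (affNeg P p) v := by
        rcases hq' with h' | h'
        · left
          intro v
          obtain ⟨w, rfl⟩ := hsurj v
          rw [hp, ← hq, h']
        · right
          intro v
          obtain ⟨w, rfl⟩ := hsurj v
          rw [affEval_affNeg, hp, ← hq, h', affEval_affNeg]
      rcases h1 with h1 | h1 <;> have h2 := affEval_injective P h1 <;> rcases h with rfl | rfl
      · exact hβα h2
      · exact hβα' h2
      · exact hβα' h2
      · rw [affNeg_affNeg] at h2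
        exact hβα h2
    rcases affEval_fundWall s q (fun h => hone _ (Or.inl rfl) h)
      (fun h => hone _ (Or.inr rfl) h) with h | h
    · exact Or.inl h.2
    · exact Or.inr h.2

theorem wall_hyp_unique {s : SimpleRefl b} {B : Wall s} {α β : PosRoot b} {n m : ℤ}
    (h : B.1 ⊆ hyp P α n) (h' : B.1 ⊆ hyp P β m) : β = α ∧ m = n := by
  obtain ⟨γ, l, -, hs⟩ := exists_wall_subset_hyp B
  obtain ⟨v, hv⟩ := wall_nonempty B
  have key : ∀ (δ : PosRoot b) (r : ℤ), B.1 ⊆ hyp P δ r → (δ, r) = (γ, l) := by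
    intro δ r hδ
    by_contra hne
    have h1 : P.root' δ v = r := hδ hv
    rcases hs δ r hne with h2 | h2
    · exact (h2 hv).ne' h1
    · exact (h2 hv).ne h1
  have := (key β m h').trans (key α n h).symm
  exact Prod.mk.inj this

theorem wall_subset_hypPos_or {s : SimpleRefl b} {B : Wall s} {α β : PosRoot b} {n m : ℤ}
    (h : B.1 ⊆ hyp P α n) (hne : (β, m) ≠ (α, n)) :
    B.1 ⊆ hypPos P β m ∨ B.1 ⊆ hypNeg P β m := by
  obtain ⟨γ, l, h', hs⟩ := exists_wall_subset_hyp B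
  obtain ⟨rfl, rfl⟩ := wall_hyp_unique h h'
  exact hs β m hne

omit [Finite ι] [P.IsRootSystem] [P.IsReduced] in
theorem wallType_spec {s : SimpleRefl b} (B : Wall s) : ∃ n : ℤ, B.1 ⊆ hyp P (wallType s B) n := by
  obtain ⟨α, n, h, -⟩ := exists_wall_subset_hyp B
  exact Classical.epsilon_spec (p := fun α : PosRoot b => ∃ n : ℤ, B.1 ⊆ hyp P α n) ⟨α, n, h⟩

/-- Alcoves on the same side of a common wall are not separated by any hyperplane other than that
of the wall. -/
theorem subset_hypPos_of_common_wall {s : SimpleRefl b} {B : Wall s} {C D : Alcove b}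
    {α β : PosRoot b} {n m : ℤ} (h : B.1 ⊆ hyp P α n) (hC : B.1 ⊆ clos b C.1)
    (hD : B.1 ⊆ clos b D.1) (hne : (β, m) ≠ (α, n)) (hp : C.1 ⊆ hypPos P β m) :
    D.1 ⊆ hypPos P β m := by
  obtain ⟨v, hv⟩ := wall_nonempty B
  have h1 := (hC hv β m).1 hp
  -- The wall lies strictly on one side of `H_{β,m}`; an alcove with the wall in its closure must be
  -- on that same side.
  have h2 : (m : ℚ) < P.root' β v := by
    rcases wall_subset_hypPos_or h hne with h2 | h2
    · exact h2 hv
    · exact absurd (h2 hv) (not_lt.mpr h1)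
  refine (alcove_subset_hypPos_or D β m).resolve_right fun h3 => ?_
  exact absurd h2 (not_lt.mpr ((hD hv β m).2 h3))

theorem eq_of_common_wall {s : SimpleRefl b} {B : Wall s} {C D : Alcove b} {α : PosRoot b} {n : ℤ}
    (h : B.1 ⊆ hyp P α n) (hC : B.1 ⊆ clos b C.1) (hD : B.1 ⊆ clos b D.1)
    (hs : C.1 ⊆ hypPos P α n ↔ D.1 ⊆ hypPos P α n) : C = D := by
  refine alcove_ext C D fun β m => ?_
  by_cases hne : (β, m) = (α, n)
  · obtain ⟨rfl, rfl⟩ := Prod.mk.inj hne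
    exact hs
  · exact ⟨subset_hypPos_of_common_wall h hC hD hne, subset_hypPos_of_common_wall h hD hC hne⟩

omit [P.IsReduced] in
/-- Both alcoves at a wall. -/
theorem exists_alcoves_of_wall {s : SimpleRefl b} (g : affWeyl P) :
    let B : Wall s := Orb.act g (Orb.base P _)
    let C : Alcove b := Orb.act g (Orb.base P _)
    let D : Alcove b := Orb.act (g * ⟨_, reflOf_mem P (simpleAff s)⟩) (Orb.base P _)
    B.1 ⊆ clos b C.1 ∧ B.1 ⊆ clos b D.1 ∧ ∃ (α : PosRoot b) (n : ℤ), B.1 ⊆ hyp P α n ∧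
      (C.1 ⊆ hypPos P α n ∧ D.1 ⊆ hypNeg P α n ∨ C.1 ⊆ hypNeg P α n ∧ D.1 ⊆ hypPos P α n) := by
  intro B C D
  have hB : B.1 = (g : W ≃ᵃ[ℚ] W) '' fundWall s := rfl
  have hC : C.1 = (g : W ≃ᵃ[ℚ] W) '' fundAlcove b := rfl
  have hD : D.1 = (g : W ≃ᵃ[ℚ] W) '' (reflOf P (simpleAff s) '' fundAlcove b) :=
    (Set.image_image (g : W ≃ᵃ[ℚ] W) (reflOf P (simpleAff s)) (fundAlcove b)).symm
  have h1 : fundWall s ⊆ clos b (reflOf P (simpleAff s) '' fundAlcove b) := by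
    have := image_subset_clos (fundWall_subset_clos s) ⟨_, reflOf_mem P (simpleAff s)⟩
    refine Set.Subset.trans ?_ this
    intro v hv
    exact ⟨v, hv, reflOf_simpleAff_fundWall s hv⟩
  refine ⟨?_, ?_, ?_⟩
  · rw [hB, hC]
    exact image_subset_clos (fundWall_subset_clos s) g
  · rw [hB, hD]
    exact image_subset_clos h1 g
  · obtain ⟨p, hp⟩ := exists_affEval_comp_inv P g (simpleAff s)
    obtain ⟨α, n, h⟩ := affine_root_cases b p
    have hzero : ∀ v ∈ fundWall s, affEval P p ((g : W ≃ᵃ[ℚ] W) v) = 0 := fun v hv => by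
      rw [hp, affEval_simpleAff_fundWall s hv]
    have hCp : ∀ v ∈ fundAlcove b, 0 < affEval P p ((g : W ≃ᵃ[ℚ] W) v) := fun v hv => by
      rw [hp]
      exact affEval_simpleAff_pos s hv
    have hDp : ∀ v ∈ fundAlcove b,
        affEval P p ((g : W ≃ᵃ[ℚ] W) (reflOf P (simpleAff s) v)) < 0 := fun v hv => by
      rw [hp, affEval_reflOf_self, neg_neg_iff_pos]
      exact affEval_simpleAff_pos s hv
    refine ⟨α, n, ?_⟩
    simp only [subset_hyp_iff, subset_hypPos_iff, subset_hypNeg_iff, hB, hC, hD,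
      Set.forall_mem_image]
    rcases h with rfl | rfl
    · exact ⟨hzero, Or.inl ⟨hCp, hDp⟩⟩
    · simp only [affEval_affNeg, neg_pos, neg_neg_iff_pos, neg_eq_zero] at hzero hCp hDp
      exact ⟨hzero, Or.inr ⟨hCp, hDp⟩⟩

/-- For `B = g A_{e,s}` the two alcoves `g A_e` and `g s A_e` lie on opposite sides of the
hyperplane of `B`, so both choices have a candidate. Uniqueness of that hyperplane allows any
description `H_{α,n}` of it to be used. -/
theorem minus_plus_spec {s : SimpleRefl b} (B : Wall s) {α : PosRoot b} {n : ℤ}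
    (h : B.1 ⊆ hyp P α n) :
    (B.1 ⊆ clos b (minus s B).1 ∧ (minus s B).1 ⊆ hypNeg P α n) ∧
      B.1 ⊆ clos b (plus s B).1 ∧ (plus s B).1 ⊆ hypPos P α n := by
  have hex : ∃ C D : Alcove b, (B.1 ⊆ clos b C.1 ∧ C.1 ⊆ hypNeg P α n) ∧
      B.1 ⊆ clos b D.1 ∧ D.1 ⊆ hypPos P α n := by
    obtain ⟨g, rfl⟩ := exists_eq_act B
    obtain ⟨hC, hD, α', n', h', hs⟩ := exists_alcoves_of_wall (s := s) g
    obtain ⟨rfl, rfl⟩ := wall_hyp_unique h h'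
    rcases hs with ⟨h1, h2⟩ | ⟨h1, h2⟩
    · exact ⟨_, _, ⟨hD, h2⟩, hC, h1⟩
    · exact ⟨_, _, ⟨hC, h1⟩, hD, h2⟩
  obtain ⟨C, D, hC, hD⟩ := hex
  constructor
  · obtain ⟨h1, α', n', h2, h3⟩ := Classical.epsilon_spec (p := fun C : Alcove b =>
      B.1 ⊆ clos b C.1 ∧ ∃ (α : PosRoot b) (n : ℤ), B.1 ⊆ hyp P α n ∧ C.1 ⊆ hypNeg P α n)
      ⟨C, hC.1, α, n, h, hC.2⟩
    obtain ⟨rfl, rfl⟩ := wall_hyp_unique h h2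
    exact ⟨h1, h3⟩
  · obtain ⟨h1, α', n', h2, h3⟩ := Classical.epsilon_spec (p := fun C : Alcove b =>
      B.1 ⊆ clos b C.1 ∧ ∃ (α : PosRoot b) (n : ℤ), B.1 ⊆ hyp P α n ∧ C.1 ⊆ hypPos P α n)
      ⟨D, hD.1, α, n, h, hD.2⟩
    obtain ⟨rfl, rfl⟩ := wall_hyp_unique h h2
    exact ⟨h1, h3⟩

theorem subset_clos_minus {s : SimpleRefl b} (B : Wall s) : B.1 ⊆ clos b (minus s B).1 :=
  let ⟨_, hn⟩ := wallType_spec B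
  (minus_plus_spec B hn).1.1

theorem subset_clos_plus {s : SimpleRefl b} (B : Wall s) : B.1 ⊆ clos b (plus s B).1 :=
  let ⟨_, hn⟩ := wallType_spec B
  (minus_plus_spec B hn).2.1

theorem minus_ne_plus {s : SimpleRefl b} (B : Wall s) : minus s B ≠ plus s B := by
  intro h
  obtain ⟨n, hn⟩ := wallType_spec B
  have h1 := minus_plus_spec B hn
  rw [← h] at h1
  exact alcove_not_hypPos_and_hypNeg _ h1.2.2 h1.1.2

theorem eq_minus_or_plus_of_subset_clos {s : SimpleRefl b} {B : Wall s} {C : Alcove b}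
    (h : B.1 ⊆ clos b C.1) : C = minus s B ∨ C = plus s B := by
  obtain ⟨n, hn⟩ := wallType_spec B
  obtain ⟨⟨h1, h2⟩, h3, h4⟩ := minus_plus_spec B hn
  rcases alcove_subset_hypPos_or C (wallType s B) n with h5 | h5
  · exact Or.inr (eq_of_common_wall hn h h3 (iff_of_true h5 h4))
  · exact Or.inl (eq_of_common_wall hn h h1 (iff_of_false
      (fun h6 => alcove_not_hypPos_and_hypNeg _ h6 h5)
      fun h6 => alcove_not_hypPos_and_hypNeg _ h6 h2))

variable [P.IsIrreducible]

/-- `bar` is defined through a chosen group element; as the action on alcoves is free, there is only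
one choice. -/
theorem bar_act_base (s : SimpleRefl b) (g : affWeyl P) :
    bar s (Orb.act g (Orb.base P (fundAlcove b))) = Orb.act g (Orb.base P (fundWall s)) := by
  set C : Alcove b := Orb.act g (Orb.base P (fundAlcove b)) with hC
  have h1 : C.1 = (g : W ≃ᵃ[ℚ] W) '' fundAlcove b := rfl
  have h2 := C.2.choose_spec
  set h := C.2.choose with hh
  obtain ⟨x, hx⟩ := fundAlcove_nonempty (b := b)
  have h3 : (g : W ≃ᵃ[ℚ] W) x ∈ (h : W ≃ᵃ[ℚ] W) '' fundAlcove b := by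
    rw [← h2, h1]
    exact ⟨x, hx, rfl⟩
  obtain ⟨y, hy, hyx⟩ := h3
  have h4 : (h⁻¹ * g : affWeyl P).1 = 1 := by
    refine eq_one_of_mem_fundAlcove (b := b) (h⁻¹ * g : affWeyl P).2 hx ?_
    have : (h⁻¹ * g : affWeyl P).1 x = y := by
      change (h : W ≃ᵃ[ℚ] W)⁻¹ ((g : W ≃ᵃ[ℚ] W) x) = y
      rw [← hyx]
      exact (h : W ≃ᵃ[ℚ] W).symm_apply_apply y
    rw [this]
    exact hy
  have h5 : h = g := inv_mul_eq_one.mp (Subtype.ext h4)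
  refine Subtype.ext ?_
  change (h : W ≃ᵃ[ℚ] W) '' fundWall s = (g : W ≃ᵃ[ℚ] W) '' fundWall s
  rw [h5]

/-- The map from alcoves to walls is equivariant. -/
theorem bar_act (s : SimpleRefl b) (g : affWeyl P) (C : Alcove b) :
    bar s (Orb.act g C) = Orb.act g (bar s C) := by
  obtain ⟨h, rfl⟩ := exists_eq_act C
  rw [← act_mul, bar_act_base, bar_act_base, act_mul]

theorem bar_subset_clos (s : SimpleRefl b) (C : Alcove b) : (bar s C).1 ⊆ clos b C.1 := by
  obtain ⟨g, rfl⟩ := exists_eq_act C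
  rw [bar_act_base]
  exact image_subset_clos (fundWall_subset_clos s) g

theorem eq_minus_or_plus (s : SimpleRefl b) (C : Alcove b) :
    C = minus s (bar s C) ∨ C = plus s (bar s C) :=
  eq_minus_or_plus_of_subset_clos (bar_subset_clos s C)

/-- An alcove at `B = g A_{e,s}` is `g A_e` or `g s A_e`, according to its side. Both have image `B`
under `bar`, because `s` fixes `A_{e,s}` pointwise. -/
theorem bar_eq_of_subset_clos {s : SimpleRefl b} {B : Wall s} {C : Alcove b}
    (h : B.1 ⊆ clos b C.1) : bar s C = B := by
  obtain ⟨g, rfl⟩ := exists_eq_act B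
  obtain ⟨hC, hD, α, n, hn, hs⟩ := exists_alcoves_of_wall (s := s) g
  have hfix : Orb.act ⟨_, reflOf_mem P (simpleAff s)⟩ (Orb.base P (fundWall s)) =
      Orb.base P (fundWall s) := by
    refine Subtype.ext ?_
    change reflOf P (simpleAff s) '' fundWall s = fundWall s
    exact (Set.image_congr fun v hv => reflOf_simpleAff_fundWall s hv).trans (Set.image_id _)
  have key : ∀ D : Alcove b, (Orb.act g (Orb.base P (fundWall s))).1 ⊆ clos b D.1 →
      (C.1 ⊆ hypPos P α n ↔ D.1 ⊆ hypPos P α n) →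
      bar s D = Orb.act g (Orb.base P (fundWall s)) →
      bar s C = Orb.act g (Orb.base P (fundWall s)) := fun D hD hside hbar => by
    rw [eq_of_common_wall hn h hD hside, hbar]
  have hbarC : bar s (Orb.act g (Orb.base P (fundAlcove b))) =
      Orb.act g (Orb.base P (fundWall s)) := bar_act_base s g
  have hbarD : bar s (Orb.act (g * ⟨_, reflOf_mem P (simpleAff s)⟩)
      (Orb.base P (fundAlcove b))) = Orb.act g (Orb.base P (fundWall s)) := by
    rw [bar_act_base, act_mul, hfix]
  have hnot : ∀ {E : Alcove b}, E.1 ⊆ hypNeg P α n → ¬ E.1 ⊆ hypPos P α n :=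
    fun h1 h2 => alcove_not_hypPos_and_hypNeg _ h2 h1
  rcases alcove_subset_hypPos_or C α n with h1 | h1 <;> rcases hs with ⟨h2, h3⟩ | ⟨h2, h3⟩
  · exact key _ hC (iff_of_true h1 h2) hbarC
  · exact key _ hD (iff_of_true h1 h3) hbarD
  · exact key _ hD (iff_of_false (hnot h1) (hnot h3)) hbarD
  · exact key _ hC (iff_of_false (hnot h1) (hnot h2)) hbarC

theorem bar_minus (s : SimpleRefl b) (B : Wall s) : bar s (minus s B) = B :=
  bar_eq_of_subset_clos (subset_clos_minus B)

theorem bar_plus (s : SimpleRefl b) (B : Wall s) : bar s (plus s B) = B :=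
  bar_eq_of_subset_clos (subset_clos_plus B)

end Facets

/-! ### The operation `β ↑` in terms of strips between consecutive hyperplanes. -/

section Up

variable {ι : Type t} {V : Type u} {W : Type v} [AddCommGroup V] [Module ℚ V] [AddCommGroup W]
  [Module ℚ W] {P : RootPairing ι ℚ V W} [P.IsCrystallographic] {b : P.Base}

omit [P.IsCrystallographic] in
theorem reflNeg_self (β : PosRoot b) : ReflNeg β β := by
  have h := isPos_reflectionPerm_self (b := b) β.1
  exact fun h' => h.mp h' β.2

/-- The reflection `s_{β,n}` as an element of the affine Weyl group. -/
def reflAct (β : PosRoot b) (n : ℤ) : affWeyl P := ⟨_, reflOf_mem P (β.1, n)⟩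

omit [P.IsCrystallographic] in
theorem reflAct_apply (β : PosRoot b) (n : ℤ) (v : W) :
    (reflAct β n : W ≃ᵃ[ℚ] W) v = v - (P.root' β v - n) • P.coroot β :=
  reflOf_apply P (β.1, n) v

omit [P.IsCrystallographic] in
theorem root'_reflAct (β : PosRoot b) (n : ℤ) (i : ι) (v : W) :
    P.root' i ((reflAct β n : W ≃ᵃ[ℚ] W) v) =
      P.root' i v - (P.root' β v - n) * P.pairing i β := by
  rw [reflAct_apply, map_sub, map_smul, P.root'_coroot_eq_pairing, smul_eq_mul]

omit [P.IsCrystallographic] in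
theorem root'_reflAct_self (β : PosRoot b) (n : ℤ) (v : W) :
    P.root' β ((reflAct β n : W ≃ᵃ[ℚ] W) v) = 2 * n - P.root' β v := by
  rw [root'_reflAct, P.pairing_same]
  ring

omit [P.IsCrystallographic] in
theorem forall_mem_act {F₀ : Set W} {g : affWeyl P} {F : Orb P F₀} {p : W → Prop} :
    (∀ v ∈ (Orb.act g F).1, p v) ↔ ∀ v ∈ F.1, p ((g : W ≃ᵃ[ℚ] W) v) :=
  Set.forall_mem_image

-- The two bounds single out `m` as the least integer in the definition of `β ↑ F`. The upper bound
-- is not strict, so that facets inside `H_{β,m}` are covered as well.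
omit [P.IsCrystallographic] in
theorem up_eq_act {F₀ : Set W} (β : PosRoot b) (F : Orb P F₀) (hne : F.1.Nonempty) {m : ℤ}
    (h1 : ∀ v ∈ F.1, (m : ℚ) - 1 < P.root' β v) (h2 : ∀ v ∈ F.1, P.root' β v ≤ m) :
    up β F = Orb.act (reflAct β m) F := by
  have hl : IsLeast {n : ℤ | F.1 ⊆ hypNeg P β n ∪ hyp P β n} m := by
    refine ⟨fun v hv => (h2 v hv).lt_or_eq, fun n hn => ?_⟩
    obtain ⟨v, hv⟩ := hne
    have h3 : P.root' β v ≤ n := (hn hv).elim (fun h => le_of_lt h) fun h => le_of_eq h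
    have h4 : (m : ℚ) - 1 < n := (h1 v hv).trans_le h3
    have h5 : m - 1 < n := by exact_mod_cast h4
    omega
  refine Subtype.ext ?_
  change affRefl P β (sInf {n : ℤ | F.1 ⊆ hypNeg P β n ∪ hyp P β n}) '' F.1 = _
  rw [hl.csInf_eq]
  rfl

/-- The set lies strictly between the hyperplanes `H_{β,m-1}` and `H_{β,m}`. -/
def InStrip (β : PosRoot b) (m : ℤ) (F : Set W) : Prop :=
  ∀ v ∈ F, (m : ℚ) - 1 < P.root' β v ∧ P.root' β v < m

omit [P.IsCrystallographic] in
theorem InStrip.eq {β : PosRoot b} {m n : ℤ} {F : Set W} (h : InStrip β m F) (h' : InStrip β n F)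
    (hne : F.Nonempty) : m = n := by
  obtain ⟨v, hv⟩ := hne
  have h1 := h v hv
  have h2 := h' v hv
  have h3 : (m : ℚ) < n + 1 := by linarith
  have h4 : (n : ℚ) < m + 1 := by linarith
  have h5 : m < n + 1 := by exact_mod_cast h3
  have h6 : n < m + 1 := by exact_mod_cast h4
  omega

omit [P.IsCrystallographic] in
theorem InStrip.up_eq {F₀ : Set W} {β : PosRoot b} {m : ℤ} {F : Orb P F₀} (h : InStrip β m F.1)
    (hne : F.1.Nonempty) : up β F = Orb.act (reflAct β m) F :=
  up_eq_act β F hne (fun v hv => (h v hv).1) fun v hv => (h v hv).2.le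

omit [P.IsCrystallographic] in
theorem InStrip.act {F₀ : Set W} {β : PosRoot b} {m : ℤ} {F : Orb P F₀} (h : InStrip β m F.1) :
    InStrip β (m + 1) (Orb.act (reflAct β m) F).1 := by
  refine forall_mem_act.mpr fun v hv => ?_
  have := h v hv
  rw [root'_reflAct_self]
  push_cast
  constructor <;> linarith

omit [P.IsCrystallographic] in
theorem InStrip.subset_hypPos_iff {β : PosRoot b} {m n : ℤ} {F : Set W} (h : InStrip β m F)
    (hne : F.Nonempty) : F ⊆ hypPos P β n ↔ n < m := by
  constructor
  · intro h'
    obtain ⟨v, hv⟩ := hne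
    have h1 : (n : ℚ) < P.root' β v := h' hv
    exact_mod_cast h1.trans (h v hv).2
  · intro h' v hv
    have h1 : (n : ℚ) ≤ m - 1 := by exact_mod_cast Int.le_sub_one_of_lt h'
    exact h1.trans_lt (h v hv).1

omit [P.IsCrystallographic] in
theorem InStrip.subset_hypNeg_iff {β : PosRoot b} {m n : ℤ} {F : Set W} (h : InStrip β m F)
    (hne : F.Nonempty) : F ⊆ hypNeg P β n ↔ m ≤ n := by
  constructor
  · intro h'
    obtain ⟨v, hv⟩ := hne
    have h1 : P.root' β v < n := h' hv
    have h2 : ((m - 1 : ℤ) : ℚ) < n := by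
      push_cast
      exact (h v hv).1.trans h1
    have h3 : m - 1 < n := by exact_mod_cast h2
    omega
  · intro h' v hv
    have h1 : (m : ℚ) ≤ n := by exact_mod_cast h'
    exact (h v hv).2.trans_le h1

variable [Finite ι] [P.IsRootSystem]

/-- No hyperplane meets an alcove, so the floor of `β` at one point is valid at all points; the
strip is indexed by its upper end, hence the floor plus one. -/
theorem exists_inStrip_alcove (β : PosRoot b) (C : Alcove b) : ∃ m, InStrip β m C.1 := by
  obtain ⟨v, hv⟩ := alcove_nonempty C
  have h1 : C.1 ⊆ hypPos P β ⌊P.root' β v⌋ := by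
    refine (alcove_subset_hypPos_or C β _).resolve_right fun h => ?_
    exact absurd (show P.root' β v < _ from h hv) (not_lt.mpr (Int.floor_le _))
  have h2 : C.1 ⊆ hypNeg P β (⌊P.root' β v⌋ + 1) := by
    refine (alcove_subset_hypPos_or C β _).resolve_left fun h => ?_
    have h3 : ((⌊P.root' β v⌋ + 1 : ℤ) : ℚ) < P.root' β v := h hv
    push_cast at h3
    linarith [Int.lt_floor_add_one (P.root' β v)]
  refine ⟨⌊P.root' β v⌋ + 1, fun w hw => ⟨?_, h2 hw⟩⟩
  have h3 : (⌊P.root' β v⌋ : ℚ) < P.root' β w := h1 hw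
  push_cast
  linarith

/-- `β ↑` raises the index of the strip by one. -/
theorem up_ne_self (β : PosRoot b) (C : Alcove b) : up β C ≠ C := by
  intro h
  obtain ⟨m, hm⟩ := exists_inStrip_alcove β C
  have h1 := hm.act
  rw [← hm.up_eq (alcove_nonempty C), h] at h1
  have := hm.eq h1 (alcove_nonempty C)
  omega

variable [P.IsReduced] {s : SimpleRefl b}

theorem exists_inStrip_wall {β : PosRoot b} {B : Wall s} (h : wallType s B ≠ β) :
    ∃ m, InStrip β m B.1 := by
  obtain ⟨v, hv⟩ := wall_nonempty B
  obtain ⟨n, hn⟩ := wallType_spec B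
  have hne : ∀ m, (β, m) ≠ (wallType s B, n) := fun m h' => h (Prod.mk.inj h').1.symm
  have h1 : B.1 ⊆ hypPos P β ⌊P.root' β v⌋ := by
    refine (wall_subset_hypPos_or hn (hne _)).resolve_right fun h => ?_
    exact absurd (show P.root' β v < _ from h hv) (not_lt.mpr (Int.floor_le _))
  have h2 : B.1 ⊆ hypNeg P β (⌊P.root' β v⌋ + 1) := by
    refine (wall_subset_hypPos_or hn (hne _)).resolve_left fun h => ?_
    have h3 : ((⌊P.root' β v⌋ + 1 : ℤ) : ℚ) < P.root' β v := h hv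
    push_cast at h3
    linarith [Int.lt_floor_add_one (P.root' β v)]
  refine ⟨⌊P.root' β v⌋ + 1, fun w hw => ⟨?_, h2 hw⟩⟩
  have h3 : (⌊P.root' β v⌋ : ℚ) < P.root' β w := h1 hw
  push_cast
  linarith

theorem up_wall_of_subset_hyp {β : PosRoot b} {n : ℤ} {B : Wall s} (h : B.1 ⊆ hyp P β n) :
    up β B = B := by
  have h0 : ∀ v ∈ B.1, P.root' β v = n := fun v hv => h hv
  rw [up_eq_act β B (wall_nonempty B) (m := n) (fun v hv => by rw [h0 v hv]; linarith)
    fun v hv => (h0 v hv).le]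
  refine Subtype.ext ?_
  refine (Set.image_congr fun v hv => ?_).trans (Set.image_id _)
  rw [reflAct_apply, h0 v hv, sub_self, zero_smul, sub_zero]
  rfl

/-- A wall of another type lies in an open strip and is moved to the next one; a wall of type `β`
lies in the hyperplane in which it is reflected. -/
theorem up_wall_eq_self_iff {β : PosRoot b} {B : Wall s} : up β B = B ↔ wallType s B = β := by
  constructor
  · intro h
    by_contra hne
    obtain ⟨m, hm⟩ := exists_inStrip_wall hne
    have h1 := hm.act
    rw [← hm.up_eq (wall_nonempty B), h] at h1
    have := hm.eq h1 (wall_nonempty B)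
    omega
  · rintro rfl
    obtain ⟨n, hn⟩ := wallType_spec B
    exact up_wall_of_subset_hyp hn

theorem InStrip.of_subset_clos {β : PosRoot b} {m : ℤ} {B : Wall s} {C : Alcove b}
    (h : InStrip β m B.1) (hc : B.1 ⊆ clos b C.1) : InStrip β m C.1 := by
  obtain ⟨n, hn⟩ := exists_inStrip_alcove β C
  obtain ⟨v, hv⟩ := wall_nonempty B
  have h1 := (hc hv β (n - 1)).1 ((hn.subset_hypPos_iff (alcove_nonempty C)).mpr (by omega))
  have h2 := (hc hv β n).2 ((hn.subset_hypNeg_iff (alcove_nonempty C)).mpr le_rfl)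
  have h3 := h v hv
  push_cast at h1
  have h4 : (n : ℚ) < m + 1 := by linarith
  have h5 : (m : ℚ) < n + 1 := by linarith
  have h6 : m < n + 1 := by exact_mod_cast h5
  have h7 : n < m + 1 := by exact_mod_cast h4
  obtain rfl : m = n := by omega
  exact hn

theorem inStrip_minus {α : PosRoot b} {n : ℤ} {B : Wall s} (h : B.1 ⊆ hyp P α n) :
    InStrip α n (minus s B).1 := by
  obtain ⟨m, hm⟩ := exists_inStrip_alcove α (minus s B)
  obtain ⟨⟨h1, h2⟩, -⟩ := minus_plus_spec B h
  obtain ⟨v, hv⟩ := wall_nonempty B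
  have h3 := (hm.subset_hypNeg_iff (alcove_nonempty _)).mp h2
  have h4 := (h1 hv α m).2 ((hm.subset_hypNeg_iff (alcove_nonempty _)).mpr le_rfl)
  have h5 : P.root' α v = n := h hv
  rw [h5] at h4
  have h6 : n ≤ m := by exact_mod_cast h4
  obtain rfl : m = n := by omega
  exact hm

omit [P.IsCrystallographic] [P.IsReduced] in
theorem ne_of_inStrip {β : PosRoot b} {m n : ℤ} {C D : Alcove b} (h : InStrip β m C.1)
    (h' : InStrip β n D.1) (hne : m ≠ n) : C ≠ D := by
  rintro rfl
  exact hne (h.eq h' (alcove_nonempty C))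

theorem InStrip.minus {β : PosRoot b} {m : ℤ} {B : Wall s} (h : InStrip β m B.1) :
    InStrip β m (minus s B).1 :=
  h.of_subset_clos (subset_clos_minus B)

theorem InStrip.plus {β : PosRoot b} {m : ℤ} {B : Wall s} (h : InStrip β m B.1) :
    InStrip β m (plus s B).1 :=
  h.of_subset_clos (subset_clos_plus B)

variable [P.IsIrreducible]

/-- Wall and alcove lie in the same strip, so the same reflection moves both, and `bar` is
equivariant. -/
theorem InStrip.bar_up {β : PosRoot b} {m : ℤ} {C : Alcove b} (h : InStrip β m (bar s C).1) :
    bar s (up β C) = up β (bar s C) := by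
  rw [h.up_eq (wall_nonempty _), ← bar_act,
    (h.of_subset_clos (bar_subset_clos s C)).up_eq (alcove_nonempty C)]

theorem bar_up_ne {β : PosRoot b} {C : Alcove b} (h : up β (bar s C) ≠ bar s C) :
    bar s (up β C) ≠ bar s C := by
  obtain ⟨m, hm⟩ := exists_inStrip_wall fun h' => h (up_wall_eq_self_iff.mpr h')
  rwa [hm.bar_up]

/-- Reflection in `H_{β,m}` carries `H_{β,n}` to `H_{β,2m-n}`, so the wall of `β ↑ C` is again of
type `β`, though it may be a different wall. -/
theorem up_bar_up {β : PosRoot b} {C : Alcove b} (h : up β (bar s C) = bar s C) :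
    up β (bar s (up β C)) = bar s (up β C) := by
  obtain ⟨n, hn⟩ := wallType_spec (bar s C)
  rw [up_wall_eq_self_iff.mp h] at hn
  obtain ⟨m, hm⟩ := exists_inStrip_alcove β C
  rw [hm.up_eq (alcove_nonempty C), bar_act]
  refine up_wall_of_subset_hyp (n := 2 * m - n) (forall_mem_act.mpr fun v hv => ?_)
  have h1 : P.root' β v = n := hn hv
  change P.root' β _ = _
  rw [root'_reflAct_self, h1]
  push_cast
  ring

end Up

/-! ### Units of `S^β` and the identities between the constants. -/

section Constants

variable (k : Type z) [Field k] {ι : Type t} {V : Type u} {W : Type v} [AddCommGroup V]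
  [Module ℚ V] [AddCommGroup W] [Module ℚ W] {P : RootPairing ι ℚ V W} [P.IsCrystallographic]
  {b : P.Base}

theorem rootUnit_coe (β : PosRoot b) :
    (rootUnit k β : Sempty k b) = algebraMap (Sk k P) (Sempty k b) (rootElt k (β : ι)) :=
  rfl

theorem rootElt_of_root_eq {i j l : ι} {c : ℤ} (h : P.root l = c • P.root i - P.root j) :
    (rootElt k l : Sk k P) = c • rootElt k i - rootElt k j := by
  simp only [rootElt]
  rw [← map_zsmul, ← map_sub, ← TensorProduct.tmul_smul, ← TensorProduct.tmul_sub]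
  congr 2
  exact Subtype.ext h

theorem rootUnit_of_root_eq {α β γ : PosRoot b} {c : ℤ}
    (h : P.root γ = c • P.root β - P.root α) :
    (rootUnit k γ : Sempty k b) = c * rootUnit k β - rootUnit k α := by
  rw [rootUnit_coe, rootElt_of_root_eq k h, map_sub, map_zsmul, zsmul_eq_mul]
  rfl

theorem rootUnit_mem_Sbeta (α β : PosRoot b) : (rootUnit k α : Sempty k b) ∈ Sbeta k β :=
  (Algebra.adjoin (Sk k P) _).algebraMap_mem _

theorem inv_rootUnit_mem_Sbeta {α β : PosRoot b} (h : α ≠ β) :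
    (↑(rootUnit k α)⁻¹ : Sempty k b) ∈ Sbeta k β :=
  Algebra.subset_adjoin ⟨α, h, rfl⟩

/-- The units of `S^∅` that are units of `S^β`. -/
def SbetaUnits (β : PosRoot b) : Subgroup (Sempty k b)ˣ where
  carrier := {u | (u : Sempty k b) ∈ Sbeta k β ∧ (↑u⁻¹ : Sempty k b) ∈ Sbeta k β}
  mul_mem' {u v} hu hv := ⟨by rw [Units.val_mul]; exact mul_mem hu.1 hv.1, by
    rw [mul_inv, Units.val_mul]
    exact mul_mem hu.2 hv.2⟩
  one_mem' := ⟨by rw [Units.val_one]; exact one_mem _, by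
    rw [inv_one, Units.val_one]
    exact one_mem _⟩
  inv_mem' {u} hu := ⟨hu.2, by rw [inv_inv]; exact hu.1⟩

theorem rootUnit_mem_SbetaUnits {α β : PosRoot b} (h : α ≠ β) : rootUnit k α ∈ SbetaUnits k β :=
  ⟨rootUnit_mem_Sbeta k α β, inv_rootUnit_mem_Sbeta k h⟩

/-- The units `u` of `S^∅` for which `u` and `u⁻¹` lie in `1 + β S^β`. -/
def IsOneUnit (β : PosRoot b) (u : (Sempty k b)ˣ) : Prop :=
  (∃ f ∈ Sbeta k β, (u : Sempty k b) = 1 + f * rootUnit k β) ∧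
    ∃ f ∈ Sbeta k β, (↑u⁻¹ : Sempty k b) = 1 + f * rootUnit k β

theorem isOneUnit_one (β : PosRoot b) : IsOneUnit k β 1 :=
  ⟨⟨0, zero_mem _, by simp⟩, 0, zero_mem _, by simp⟩

/-- Substituting `γ = cβ - α` gives `-γα⁻¹ = 1 - cβα⁻¹`. The relation is symmetric in `α` and `γ`,
so the inverse has the same shape. Both roots differ from `β`, hence are invertible in `S^β`. -/
theorem isOneUnit_of_root_eq {α β γ : PosRoot b} {c : ℤ}
    (h : P.root γ = c • P.root β - P.root α) (hα : α ≠ β) (hγ : γ ≠ β) :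
    IsOneUnit k β (-(rootUnit k γ * (rootUnit k α)⁻¹)) := by
  have h1 := rootUnit_of_root_eq k h
  refine ⟨⟨-c * ↑(rootUnit k α)⁻¹, mul_mem (neg_mem (intCast_mem _ c))
    (inv_rootUnit_mem_Sbeta k hα), ?_⟩, -c * ↑(rootUnit k γ)⁻¹, mul_mem (neg_mem
    (intCast_mem _ c)) (inv_rootUnit_mem_Sbeta k hγ), ?_⟩
  · rw [Units.val_neg, Units.val_mul, h1]
    linear_combination (rootUnit k α).mul_inv
  · have h2 : (-(rootUnit k γ * (rootUnit k α)⁻¹))⁻¹ = -(rootUnit k α * (rootUnit k γ)⁻¹) := by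
      rw [inv_neg, mul_inv, inv_inv, mul_comm]
    have h3 : (rootUnit k α : Sempty k b) = c * rootUnit k β - rootUnit k γ := by
      rw [h1]
      ring
    rw [h2, Units.val_neg, Units.val_mul, h3]
    linear_combination (rootUnit k γ).mul_inv

/-- The hyperplanes in the product `d_C^β`. -/
def crossSet (C : Alcove b) (β : PosRoot b) : Set (PosRoot b × ℤ) :=
  {p | C.1 ⊆ hypNeg P p.1 p.2 ∧ (up β C).1 ⊆ hypPos P p.1 p.2 ∧ ReflNeg β p.1}

theorem dAlc_eq (C : Alcove b) (β : PosRoot b) :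
    dAlc k C β = ∏ᶠ p ∈ crossSet C β, (rootUnit k p.1)⁻¹ :=
  rfl

/-- The positive root `-s_β(α)`. -/
def negRefl {β α : PosRoot b} (h : ReflNeg β α) : PosRoot b :=
  ⟨P.reflectionPerm (P.reflectionPerm β α) (P.reflectionPerm β α),
    (isPos_reflectionPerm_self _).mpr h⟩

omit [P.IsCrystallographic] in
theorem root'_negRefl {β α : PosRoot b} (h : ReflNeg β α) (v : W) :
    P.root' (negRefl h) v = P.pairing α β * P.root' β v - P.root' α v := by
  change P.root' (P.reflectionPerm _ _) v = _
  rw [root'_indexNeg, root'_reflectionPerm]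
  ring

omit [P.IsCrystallographic] in
theorem root_negRefl {β α : PosRoot b} (h : ReflNeg β α) {c : ℤ} (hc : P.pairing α β = c) :
    P.root (negRefl h) = c • P.root β - P.root α := by
  change P.root (P.reflectionPerm _ _) = _
  rw [RootPairing.root_reflectionPerm, RootPairing.reflection_apply_self,
    RootPairing.root_reflectionPerm, RootPairing.reflection_apply_root, hc,
    Int.cast_smul_eq_zsmul]
  abel

variable [Finite ι] [P.IsRootSystem]

omit [P.IsCrystallographic] [Finite ι] [P.IsRootSystem] in
theorem root'_injective {i j : ι} (h : ∀ v, P.root' i v = P.root' j v) : i = j := by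
  have := affEval_injective P (p := (i, 0)) (q := (j, 0)) fun v => by
    simp only [affEval, h v]
  exact (Prod.mk.inj this).1

-- At a point of `A_e` the positive root `-s_β(α) = cβ - α` is positive, and so are `α` and `β`;
-- this forces `c > 0`.
omit [P.IsCrystallographic] in
theorem pairing_pos_of_reflNeg {β α : PosRoot b} (h : ReflNeg β α) : 0 < P.pairing α β := by
  obtain ⟨v, hv⟩ := fundAlcove_nonempty (b := b)
  have h1 := (hv (negRefl h)).1
  rw [root'_negRefl] at h1
  by_contra! h2
  have := mul_nonpos_of_nonpos_of_nonneg h2 (hv β).1.le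
  linarith [(hv α).1]

omit [P.IsCrystallographic] in
theorem reflNeg_of_root'_eq {β α γ : PosRoot b}
    (h : ∀ v, P.root' γ v = P.pairing α β * P.root' β v - P.root' α v) :
    ReflNeg β α := by
  intro h1
  obtain ⟨v, hv⟩ := fundAlcove_nonempty (b := b)
  have h2 := (hv ⟨_, h1⟩).1
  rw [root'_reflectionPerm] at h2
  linarith [(hv γ).1, h v]

omit [P.IsCrystallographic] [Finite ι] [P.IsRootSystem] in
theorem pairing_negRefl {β α : PosRoot b} (h : ReflNeg β α) :
    P.pairing (negRefl h) β = P.pairing α β := by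
  have := root'_negRefl h (P.coroot β)
  rw [P.root'_coroot_eq_pairing, P.root'_coroot_eq_pairing, P.root'_coroot_eq_pairing,
    P.pairing_same] at this
  linarith

omit [P.IsCrystallographic] [Finite ι] [P.IsRootSystem] in
theorem negRefl_ne {β α : PosRoot b} (h : ReflNeg β α) (hne : α ≠ β) : negRefl h ≠ β := by
  intro h1
  have h2 := pairing_negRefl h
  rw [h1, P.pairing_same] at h2
  refine hne (Subtype.ext (root'_injective (P := P) fun v => ?_))
  have := root'_negRefl h v
  rw [h1, ← h2] at this
  linarith

omit [P.IsCrystallographic] in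
theorem reflNeg_negRefl {β α : PosRoot b} (h : ReflNeg β α) : ReflNeg β (negRefl h) := by
  refine reflNeg_of_root'_eq (γ := α) fun v => ?_
  rw [pairing_negRefl, root'_negRefl]
  ring

omit [P.IsCrystallographic] in
theorem crossSet_finite (C : Alcove b) (β : PosRoot b) : (crossSet C β).Finite := by
  obtain ⟨v, hv⟩ := alcove_nonempty C
  obtain ⟨w, hw⟩ := alcove_nonempty (up β C)
  refine Set.Finite.subset (Set.finite_iUnion fun η : PosRoot b =>
    (Set.finite_Icc ⌊P.root' η v⌋ ⌈P.root' η w⌉).image (Prod.mk η)) ?_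
  rintro ⟨η, l⟩ ⟨h1, h2, -⟩
  have h3 : P.root' η v < l := h1 hv
  have h4 : (l : ℚ) < P.root' η w := h2 hw
  refine Set.mem_iUnion.mpr ⟨η, l, ⟨?_, ?_⟩, rfl⟩
  · exact_mod_cast (Int.floor_le (P.root' η v)).trans h3.le
  · exact_mod_cast h4.le.trans (Int.le_ceil _)

/-- Between `C` and `β ↑ C`, which lie in adjacent strips, there is exactly one hyperplane of type
`β`. So `β⁻¹` occurs once in the product, and all other factors are units of `S^β`. -/
theorem dAlc_mul_rootUnit_mem (C : Alcove b) (β : PosRoot b) :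
    dAlc k C β * rootUnit k β ∈ SbetaUnits k β := by
  obtain ⟨m, hm⟩ := exists_inStrip_alcove β C
  have hup : InStrip β (m + 1) (up β C).1 := by
    rw [hm.up_eq (alcove_nonempty C)]
    exact hm.act
  have hmem : ∀ l, (β, l) ∈ crossSet C β ↔ l = m := by
    intro l
    refine ⟨fun h => ?_, fun h => ?_⟩
    · have h1 := (hm.subset_hypNeg_iff (alcove_nonempty C)).mp h.1
      have h2 := (hup.subset_hypPos_iff (alcove_nonempty _)).mp h.2.1
      omega
    · exact ⟨(hm.subset_hypNeg_iff (alcove_nonempty C)).mpr h.ge,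
        (hup.subset_hypPos_iff (alcove_nonempty _)).mpr (show l < m + 1 by omega), reflNeg_self β⟩
  have h1 : crossSet C β = insert (β, m) (crossSet C β \ {(β, m)}) := by
    rw [Set.insert_sdiff_singleton, Set.insert_eq_of_mem ((hmem m).mpr rfl)]
  rw [dAlc_eq, h1, finprod_mem_insert _ (by simp) ((crossSet_finite C β).sdiff),
    mul_comm, mul_inv_cancel_left]
  refine finprod_mem_induction (· ∈ SbetaUnits k β) (one_mem _) (fun _ _ => mul_mem) ?_
  rintro ⟨η, l⟩ ⟨h2, h3⟩
  refine inv_mem (rootUnit_mem_SbetaUnits k ?_)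
  rintro rfl
  exact h3 (by rw [(hmem l).mp h2]; rfl)

variable [P.IsReduced] {s : SimpleRefl b}

/-- Here `β ↑` reflects `B₋` in the hyperplane of `B` itself. The two alcoves share the wall `B`, so
nothing else separates them. -/
theorem dAlc_minus_of_wallType_eq {B : Wall s} {β : PosRoot b} (h : wallType s B = β) :
    dAlc k (minus s B) β = (rootUnit k β)⁻¹ := by
  obtain ⟨n, hn⟩ := wallType_spec B
  rw [h] at hn
  have hm := inStrip_minus hn
  have hup := hm.up_eq (alcove_nonempty _)
  have hcl : B.1 ⊆ clos b (up β (minus s B)).1 := by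
    have h1 : Orb.act (reflAct β n) B = B := by
      rw [← up_eq_act β B (wall_nonempty B) (m := n)
        (fun v hv => by rw [show P.root' β v = n from hn hv]; linarith)
        fun v hv => le_of_eq (hn hv)]
      exact up_wall_of_subset_hyp hn
    have h2 : (Orb.act (reflAct β n) B).1 ⊆ clos b (up β (minus s B)).1 := by
      rw [hup]
      exact image_subset_clos (subset_clos_minus B) _
    rwa [h1] at h2
  have h1 : crossSet (minus s B) β = {(β, n)} := by
    ext ⟨η, l⟩
    rw [Set.mem_singleton_iff]
    constructor
    · intro h2
      by_contra hne
      exact alcove_not_hypPos_and_hypNeg _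
        (subset_hypPos_of_common_wall hn hcl (subset_clos_minus B) hne h2.2.1) h2.1
    · intro h2
      obtain ⟨rfl, rfl⟩ := Prod.mk.inj h2
      refine ⟨(minus_plus_spec B hn).1.2, ?_, reflNeg_self _⟩
      rw [hup]
      exact (hm.act.subset_hypPos_iff (alcove_nonempty _)).mpr (by omega)
  rw [dAlc_eq, h1, finprod_mem_singleton]

section Wall

variable {B : Wall s} {β : PosRoot b}

theorem subset_clos_up {m : ℤ} (hm : InStrip β m B.1) {C : Alcove b} (hC : B.1 ⊆ clos b C.1) :
    (Orb.act (reflAct β m) B).1 ⊆ clos b (up β C).1 := by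
  rw [(hm.of_subset_clos hC).up_eq (alcove_nonempty C)]
  exact image_subset_clos hC _

/-- Hyperplanes that contribute to only one of `d_{B_-}^β` and `d_{B_+}^β` contain `B` or
`β ↑ B`. -/
theorem mem_crossSet_of_mem {m n : ℤ} (hm : InStrip β m B.1) (hn : B.1 ⊆ hyp P (wallType s B) n)
    {C D : Alcove b} (hC : B.1 ⊆ clos b C.1) (hD : B.1 ⊆ clos b D.1) {p : PosRoot b × ℤ}
    (hp : p ∈ crossSet C β) (h1 : p ≠ (wallType s B, n))
    (h2 : ¬ (Orb.act (reflAct β m) B).1 ⊆ hyp P p.1 p.2) : p ∈ crossSet D β := by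
  refine ⟨(alcove_subset_hypPos_or D p.1 p.2).resolve_left fun h => ?_, ?_, hp.2.2⟩
  · exact alcove_not_hypPos_and_hypNeg C (subset_hypPos_of_common_wall hn hD hC h1 h) hp.1
  · obtain ⟨l, hl⟩ := wallType_spec (Orb.act (reflAct β m) B)
    refine subset_hypPos_of_common_wall hl (subset_clos_up hm hC) (subset_clos_up hm hD)
      (fun h => h2 ?_) hp.2.1
    obtain ⟨h3, h4⟩ := Prod.mk.inj h
    rw [h3, h4]
    exact hl

/-- The reflection in `H_{β,m}` takes a hyperplane of type `η` through the image of `B` back to one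
of type `-s_β(η)` through `B`. -/
theorem reflect_hyp {α η : PosRoot b} {m n l : ℤ} (hn : B.1 ⊆ hyp P α n)
    (hη : ReflNeg β η) (h : (Orb.act (reflAct β m) B).1 ⊆ hyp P η l) :
    negRefl hη = α := by
  have h1 : ∀ v ∈ B.1, P.root' η v - (P.root' β v - m) * P.pairing η β = l := fun v hv => by
    rw [← root'_reflAct]
    exact h ⟨v, hv, rfl⟩
  obtain ⟨c, hc⟩ := exists_pairing_eq_intCast (P := P) η.1 β.1
  refine (wall_hyp_unique hn (β := negRefl hη) (m := m * c - l) fun v hv => ?_).1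
  change P.root' _ v = _
  have := h1 v hv
  rw [root'_negRefl, hc]
  rw [hc] at this
  push_cast
  linarith

/-- The hyperplanes that could distinguish the two products have type `α_B`, or a type `η` with
`-s_β(η) = α_B`. The sign condition would make `s_β(α_B)` negative in either case. -/
theorem dAlc_minus_eq_plus (hβ : up β B ≠ B) (h : ¬ ReflNeg β (wallType s B)) :
    dAlc k (minus s B) β = dAlc k (plus s B) β := by
  obtain ⟨m, hm⟩ := exists_inStrip_wall fun h' => hβ (up_wall_eq_self_iff.mpr h')
  obtain ⟨n, hn⟩ := wallType_spec B
  have key : ∀ {C D : Alcove b}, B.1 ⊆ clos b C.1 → B.1 ⊆ clos b D.1 →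
      crossSet C β ⊆ crossSet D β := by
    intro C D hC hD p hp
    refine mem_crossSet_of_mem hm hn hC hD hp (fun h1 => ?_) fun h1 => ?_
    · have := hp.2.2
      rw [h1] at this
      exact h this
    · have h2 := reflect_hyp hn hp.2.2 h1
      rw [← h2] at h
      exact h (reflNeg_negRefl _)
  rw [dAlc_eq, dAlc_eq, (key (subset_clos_minus B) (subset_clos_plus B)).antisymm
    (key (subset_clos_plus B) (subset_clos_minus B))]

/-- The extra factors come from the hyperplane of `B` and its image under the reflection in
`H_{β,m}`, of type `-s_β(α_B)`. Both separate `B₋` from `β ↑ B₋`, since the positive pairing pushes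
`β ↑ B` above the hyperplane of `B`. Neither counts for `B₊`, which is already above the first,
while `β ↑ B₊` is still below the second. -/
theorem dAlc_minus_eq_mul (hβ : up β B ≠ B) (h : ReflNeg β (wallType s B)) :
    dAlc k (minus s B) β =
      (rootUnit k (wallType s B))⁻¹ * ((rootUnit k (negRefl h))⁻¹ * dAlc k (plus s B) β) := by
  obtain ⟨m, hm⟩ := exists_inStrip_wall fun h' => hβ (up_wall_eq_self_iff.mpr h')
  obtain ⟨n, hn⟩ := wallType_spec B
  obtain ⟨⟨hC, hCn⟩, hD, hDp⟩ := minus_plus_spec B hn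
  obtain ⟨c, hc⟩ := exists_pairing_eq_intCast (P := P) (wallType s B).1 β.1
  have hcpos := pairing_pos_of_reflNeg h
  obtain ⟨v, hv⟩ := wall_nonempty B
  have hvn : P.root' (wallType s B) v = n := hn hv
  have hvm := (hm v hv).2
  have hupC := (hm.of_subset_clos hC).up_eq (alcove_nonempty _)
  have hupD := (hm.of_subset_clos hD).up_eq (alcove_nonempty _)
  have hγ : ∀ w, P.root' (negRefl h) ((reflAct β m : W ≃ᵃ[ℚ] W) w) =
      m * c - P.root' (wallType s B) w := by
    intro w
    rw [root'_reflAct, pairing_negRefl, root'_negRefl, hc]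
    ring
  have hγB : (Orb.act (reflAct β m) B).1 ⊆ hyp P (negRefl h) (m * c - n) := by
    refine forall_mem_act.mpr fun w hw => ?_
    change P.root' _ _ = _
    rw [hγ, show P.root' (wallType s B) w = n from hn hw]
    push_cast
    rfl
  have hlt : 0 < (m - P.root' β v) * P.pairing (wallType s B) β :=
    mul_pos (sub_pos.mpr hvm) hcpos
  -- Two equal hyperplanes would both contain the point `v` of `B`, and then `v` would lie on
  -- `H_{β,m}`, although `B` is strictly below it.
  have hne : (wallType s B, n) ≠ (negRefl h, m * c - n) := by
    intro h1
    obtain ⟨h1, h2⟩ := Prod.mk.inj h1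
    have h3 : P.root' (negRefl h) v = n := by rw [← h1, hvn]
    have h4 : ((m * c - n : ℤ) : ℚ) = n := by rw [← h2]
    rw [root'_negRefl, hvn] at h3
    push_cast at h4
    rw [hc] at h3 hlt
    linarith
  have hmem1 : (wallType s B, n) ∈ crossSet (minus s B) β := by
    refine ⟨hCn, (alcove_subset_hypPos_or _ _ _).resolve_right fun h1 => ?_, h⟩
    have h2 := (subset_clos_up hm hC ⟨v, hv, rfl⟩ (wallType s B) n).2 h1
    rw [root'_reflAct, hvn] at h2
    linarith
  have hmem2 : (negRefl h, m * c - n) ∈ crossSet (minus s B) β := by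
    refine ⟨(alcove_subset_hypPos_or _ _ _).resolve_left fun h1 => ?_, ?_, reflNeg_negRefl h⟩
    · have h2 := (hC hv (negRefl h) (m * c - n)).1 h1
      rw [root'_negRefl, hvn] at h2
      rw [hc] at h2 hlt
      push_cast at h2
      linarith
    · rw [hupC]
      refine forall_mem_act.mpr fun w hw => ?_
      change _ < P.root' _ _
      rw [hγ]
      have : P.root' (wallType s B) w < n := hCn hw
      push_cast
      linarith
  have hnot1 : (wallType s B, n) ∉ crossSet (plus s B) β := fun h1 =>
    alcove_not_hypPos_and_hypNeg _ hDp h1.1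
  have hnot2 : (negRefl h, m * c - n) ∉ crossSet (plus s B) β := fun h1 => by
    have h2 := h1.2.1
    rw [hupD] at h2
    obtain ⟨w, hw⟩ := alcove_nonempty (plus s B)
    have h3 : ((m * c - n : ℤ) : ℚ) < P.root' (negRefl h) ((reflAct β m : W ≃ᵃ[ℚ] W) w) :=
      h2 ⟨w, hw, rfl⟩
    rw [hγ] at h3
    have : (n : ℚ) < P.root' (wallType s B) w := hDp hw
    push_cast at h3
    linarith
  have hset : crossSet (minus s B) β =
      insert (wallType s B, n) (insert (negRefl h, m * c - n) (crossSet (plus s B) β)) := by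
    have hyp' : ∀ {p : PosRoot b × ℤ}, ReflNeg β p.1 →
        (Orb.act (reflAct β m) B).1 ⊆ hyp P p.1 p.2 → p = (negRefl h, m * c - n) :=
      fun {p} _ h2 => Prod.ext_iff.mpr (wall_hyp_unique hγB h2)
    ext p
    rw [Set.mem_insert_iff, Set.mem_insert_iff]
    constructor
    · intro hp
      by_contra! hp'
      exact hp'.2.2 (mem_crossSet_of_mem hm hn hC hD hp hp'.1 fun h1 => hp'.2.1 (hyp' hp.2.2 h1))
    · rintro (rfl | rfl | hp)
      · exact hmem1
      · exact hmem2
      · refine mem_crossSet_of_mem hm hn hD hC hp (fun h1 => hnot1 (h1 ▸ hp)) fun h1 => ?_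
        exact hnot2 (hyp' hp.2.2 h1 ▸ hp)
  rw [dAlc_eq, hset, finprod_mem_insert _ _ ((crossSet_finite _ _).insert _),
    finprod_mem_insert _ hnot2 (crossSet_finite _ _)]
  · rfl
  · rw [Set.mem_insert_iff]
    exact fun h1 => h1.elim hne hnot1

end Wall

variable [P.IsIrreducible]

theorem aConst_minus {B : Wall s} {β : PosRoot b} (h : ReflNeg β (wallType s B)) :
    aConst k s (minus s B) β = (rootUnit k (wallType s B))⁻¹ := by
  rw [aConst, bar_minus, if_pos h, if_neg (minus_ne_plus B)]

theorem aConst_plus {B : Wall s} {β : PosRoot b} (h : ReflNeg β (wallType s B)) :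
    aConst k s (plus s B) β = -rootUnit k (wallType s B) := by
  rw [aConst, bar_plus, if_pos h, if_pos rfl]

omit [Finite ι] [P.IsRootSystem] [P.IsReduced] [P.IsIrreducible] in
theorem aConst_of_not_reflNeg {C : Alcove b} {β : PosRoot b}
    (h : ¬ ReflNeg β (wallType s (bar s C))) : aConst k s C β = 1 := by
  rw [aConst, if_neg h]

theorem dAlc_minus_eq_aConst {B : Wall s} {β : PosRoot b} (h : up β B = B) :
    dAlc k (minus s B) β = aConst k s (minus s B) β := by
  have h1 := up_wall_eq_self_iff.mp h
  rw [dAlc_minus_of_wallType_eq k h1, aConst_minus k (by rw [h1]; exact reflNeg_self β), h1]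

theorem dAlc_minus_eq (B : Wall s) (β : PosRoot b) :
    dAlc k (minus s B) β = aConst k s (minus s B) β * dWall k s B β := by
  unfold dWall
  split_ifs with h
  · rw [aConst_minus k h, inv_mul_cancel_left]
  · rw [aConst_of_not_reflNeg k (by rwa [bar_minus]), one_mul]

/-- With `α = α_B` and `γ = -s_β(α)`, the preceding comparison gives `d_B = α d_{B₋} = γ⁻¹ d_{B₊}`,
while `a_{B₊} = -α`; the discrepancy is `-γα⁻¹`. The sign in the constant `a` is what brings it into
`1 + β S^β`. -/
theorem dAlc_plus_eq {B : Wall s} {β : PosRoot b} (hβ : up β B ≠ B) :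
    ∃ u, IsOneUnit k β u ∧
      dAlc k (plus s B) β = u * (aConst k s (plus s B) β * dWall k s B β) := by
  unfold dWall
  split_ifs with h
  · obtain ⟨c, hc⟩ := exists_pairing_eq_intCast (P := P) (wallType s B).1 β.1
    have hne : wallType s B ≠ β := fun h => hβ (up_wall_eq_self_iff.mpr h)
    refine ⟨_, isOneUnit_of_root_eq k (root_negRefl h hc) hne (negRefl_ne h hne), ?_⟩
    rw [aConst_plus k h, dAlc_minus_eq_mul k hβ h, mul_inv_cancel_left, ← mul_assoc, neg_mul_neg,
      inv_mul_cancel_right, mul_inv_cancel_left]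
  · refine ⟨1, isOneUnit_one k β, ?_⟩
    rw [aConst_of_not_reflNeg k (by rwa [bar_plus]), one_mul, one_mul, dAlc_minus_eq_plus k hβ h]

theorem dAlc_eq_mul {C : Alcove b} {β : PosRoot b} (hβ : up β (bar s C) ≠ bar s C) :
    ∃ u, IsOneUnit k β u ∧
      dAlc k C β = u * (aConst k s C β * dWall k s (bar s C) β) := by
  rcases eq_minus_or_plus s C with h | h
  · refine ⟨1, isOneUnit_one k β, ?_⟩
    have := dAlc_minus_eq k (bar s C) β
    rw [← h] at this
    rw [this, one_mul]
  · have := dAlc_plus_eq k hβ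
    rwa [← h] at this

end Constants

/-! ### Additive structure of the categories, rescaling, and the stability property. -/

section Additive

variable {A : Type w} [CommRing A] {Rp : Type x} {O : Type y} {deg : ℤ → AddSubgroup A}
  {loc : Rp → Subring A} {up : Rp → O → O}

theorem KObj.hom_ext {M N : KObj deg loc up} {f g : M ⟶ N} (h : ∀ F m, f.app F m = g.app F m) :
    f = g :=
  KHom.ext (funext fun F => LinearMap.ext (h F))

instance (M N : KObj deg loc up) : Zero (M ⟶ N) :=
  ⟨⟨fun _ => 0, fun F i _ _ => zero_mem (N.gr F i), fun F β _ _ => zero_mem (N.sub F β)⟩⟩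

instance (M N : KObj deg loc up) : Add (M ⟶ N) :=
  ⟨fun f g => ⟨fun F => f.app F + g.app F,
    fun F i m hm => add_mem (f.app_gr F i m hm) (g.app_gr F i m hm),
    fun F β m hm => add_mem (f.app_sub F β m hm) (g.app_sub F β m hm)⟩⟩

instance (M N : KObj deg loc up) : Neg (M ⟶ N) :=
  ⟨fun f => ⟨fun F => -f.app F, fun F i m hm => neg_mem (f.app_gr F i m hm),
    fun F β m hm => neg_mem (f.app_sub F β m hm)⟩⟩

instance (M N : KObj deg loc up) : AddCommGroup (M ⟶ N) where
  add_assoc f g h := KObj.hom_ext fun F m => add_assoc (f.app F m) _ _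
  zero_add f := KObj.hom_ext fun F m => zero_add (f.app F m)
  add_zero f := KObj.hom_ext fun F m => add_zero (f.app F m)
  add_comm f g := KObj.hom_ext fun F m => add_comm (f.app F m) _
  neg_add_cancel f := KObj.hom_ext fun F m => neg_add_cancel (f.app F m)
  nsmul := nsmulRec
  zsmul := zsmulRec

instance : Preadditive (KObj deg loc up) where
  add_comp _ _ _ f g h := KObj.hom_ext fun F m => map_add (h.app F) (f.app F m) (g.app F m)
  comp_add _ _ _ _ _ _ := KObj.hom_ext fun _ _ => rfl

/-- The components of a morphism at `F` as a homomorphism. -/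
def KObj.appHom (M N : KObj deg loc up) (F : O) :
    (M ⟶ N) →+ (M.carrier F →ₗ[A] N.carrier F) where
  toFun f := f.app F
  map_zero' := rfl
  map_add' _ _ := rfl

theorem KObj.sum_app {M N : KObj deg loc up} {J : Type*} (s : Finset J) (f : J → (M ⟶ N)) (F : O)
    (m : M.carrier F) : (∑ j ∈ s, f j).app F m = ∑ j ∈ s, (f j).app F m := by
  have := map_sum (KObj.appHom M N F) f s
  exact (LinearMap.congr_fun this m).trans (LinearMap.sum_apply _ _ _)

section Dsum

variable {J : Type} [Finite J] (M : J → KObj deg loc up)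

/-- The projections of a direct sum. -/
def KObj.dsumπ (j : J) : KObj.dsum M ⟶ M j :=
  ⟨fun _ => LinearMap.proj j, fun _ _ _ hm => hm j (Set.mem_univ j), fun _ _ _ hm => hm j⟩

open Classical in
/-- The inclusions of a direct sum. -/
def KObj.dsumι (j : J) : M j ⟶ KObj.dsum M :=
  ⟨fun F => LinearMap.single A (fun j => (M j).carrier F) j,
    fun F i m hm j' _ => by
      change (Pi.single j m : ∀ j, (M j).carrier F) j' ∈ _
      rcases eq_or_ne j' j with rfl | h
      · rwa [Pi.single_eq_same]
      · rw [Pi.single_eq_of_ne h]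
        exact zero_mem ((M j').gr F i),
    fun F β m hm j' => by
      change (fun G => (Pi.single j (m G) : ∀ j, (M j).carrier G) j') ∈ _
      rcases eq_or_ne j' j with rfl | h
      · simpa only [Pi.single_eq_same] using hm
      · simp only [Pi.single_eq_of_ne h]
        exact zero_mem ((M j').sub F β)⟩

theorem KObj.dsumι_dsumπ_same (j : J) : KObj.dsumι M j ≫ KObj.dsumπ M j = 𝟙 (M j) := by
  classical
  refine KObj.hom_ext fun F m => ?_
  change (Pi.single j m : ∀ j, (M j).carrier F) j = m
  convert Pi.single_eq_same (M := fun j => (M j).carrier F) j m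

theorem KObj.dsumι_dsumπ_of_ne {i j : J} (h : i ≠ j) :
    KObj.dsumι M i ≫ KObj.dsumπ M j = 0 := by
  classical
  refine KObj.hom_ext fun F m => ?_
  change (Pi.single i m : ∀ j, (M j).carrier F) j = 0
  convert Pi.single_eq_of_ne (M := fun j => (M j).carrier F) h.symm m

open Classical in
/-- The direct sum as a bicone. -/
def KObj.dsumBicone : Limits.Bicone M where
  pt := KObj.dsum M
  π := KObj.dsumπ M
  ι := KObj.dsumι M
  ι_π i j := by
    split_ifs with h
    · subst h
      exact KObj.dsumι_dsumπ_same M i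
    · exact KObj.dsumι_dsumπ_of_ne M h

theorem KObj.dsum_total [Fintype J] :
    ∑ j, KObj.dsumπ M j ≫ KObj.dsumι M j = 𝟙 (KObj.dsum M) := by
  classical
  refine KObj.hom_ext fun F m => ?_
  rw [KObj.sum_app]
  change ∑ j, (Pi.single j (m j) : ∀ j, (M j).carrier F) = m
  convert Finset.univ_sum_single (M := fun j => (M j).carrier F) m

/-- The direct sum is a biproduct. -/
def KObj.dsumIsBilimit : (KObj.dsumBicone M).IsBilimit :=
  letI := Fintype.ofFinite J
  Limits.isBilimitOfTotal _ (KObj.dsum_total M)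

instance : Limits.HasBiproduct M :=
  ⟨⟨⟨KObj.dsumBicone M, KObj.dsumIsBilimit M⟩⟩⟩

/-- The direct sum is isomorphic to Mathlib's biproduct. -/
def KObj.dsumIso : KObj.dsum M ≅ Limits.biproduct M :=
  Limits.biproduct.uniqueUpToIso M (KObj.dsumIsBilimit M)

variable {M}

/-- Isomorphic objects have isomorphic direct sums. -/
def KObj.dsumMapIso {N : J → KObj deg loc up} (e : ∀ j, M j ≅ N j) :
    KObj.dsum M ≅ KObj.dsum N :=
  KObj.dsumIso M ≪≫ Limits.biproduct.mapIso e ≪≫ (KObj.dsumIso N).symm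

end Dsum

section Functor

variable {O' : Type z} {up' : Rp → O' → O'} (T : KObj deg loc up ⥤ KObj deg loc up') [T.Additive]

/-- An additive functor preserves direct sums. -/
def dsumCompIso {J : Type} [Finite J] (M : J → KObj deg loc up) :
    T.obj (KObj.dsum M) ≅ KObj.dsum fun j => T.obj (M j) :=
  T.mapIso (KObj.dsumIso M) ≪≫ T.mapBiproduct M ≪≫ (KObj.dsumIso _).symm

variable {T}

theorem IsDirectSummand.map {M N : KObj deg loc up} (h : IsDirectSummand M N) :
    IsDirectSummand (T.obj M) (T.obj N) := by
  obtain ⟨Z, ⟨e⟩⟩ := h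
  refine ⟨T.obj Z, ⟨?_ ≪≫ (dsumCompIso T _).symm ≪≫ T.mapIso e⟩⟩
  refine KObj.dsumMapIso fun i => ?_
  cases i
  · exact Iso.refl _
  · exact Iso.refl _

end Functor

theorem IsDirectSummand.trans_iso {M N N' : KObj deg loc up} (h : IsDirectSummand M N)
    (e : N ≅ N') : IsDirectSummand M N' :=
  let ⟨Z, ⟨e'⟩⟩ := h
  ⟨Z, ⟨e' ≪≫ e⟩⟩

theorem IsDirectSummand.retract {M N : KObj deg loc up} (h : IsDirectSummand M N) :
    ∃ (f : M ⟶ N) (g : N ⟶ M), f ≫ g = 𝟙 M := by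
  obtain ⟨Z, ⟨e⟩⟩ := h
  let i : M ⟶ _ := KObj.dsumι (fun i : Bool => cond i M Z) true
  let p : _ ⟶ M := KObj.dsumπ (fun i : Bool => cond i M Z) true
  have hip : i ≫ p = 𝟙 M := KObj.dsumι_dsumπ_same (fun i : Bool => cond i M Z) true
  exact ⟨i ≫ e.hom, e.inv ≫ p, by rw [Category.assoc, e.hom_inv_id_assoc, hip]⟩

/-- The degree shift of an isomorphism. -/
def KObj.shiftIso {M N : KObj deg loc up} (e : M ≅ N) (n : ℤ) : M.shift n ≅ N.shift n where
  hom := ⟨e.hom.app, fun F i => e.hom.app_gr F (i + n), e.hom.app_sub⟩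
  inv := ⟨e.inv.app, fun F i => e.inv.app_gr F (i + n), e.inv.app_sub⟩
  hom_inv_id := KObj.hom_ext fun F m =>
    LinearMap.congr_fun (congrFun (congrArg KHom.app e.hom_inv_id) F) m
  inv_hom_id := KObj.hom_ext fun F m =>
    LinearMap.congr_fun (congrFun (congrArg KHom.app e.inv_hom_id) F) m

/-- Iterated degree shifts. -/
def KObj.shiftShiftIso (M : KObj deg loc up) (m n l : ℤ) (h : m + n = l) :
    (M.shift m).shift n ≅ M.shift l where
  hom := ⟨fun _ => LinearMap.id, fun F i x hx => by
    change x ∈ M.gr F (i + l)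
    rw [← h, add_comm m n, ← add_assoc]
    exact hx, fun _ _ _ h => h⟩
  inv := ⟨fun _ => LinearMap.id, fun F i x hx => by
    change x ∈ M.gr F (i + n + m)
    rw [add_assoc, add_comm n m, h]
    exact hx, fun _ _ _ h => h⟩
  hom_inv_id := rfl
  inv_hom_id := rfl

/-- Isomorphism of objects with the same modules. -/
def KObj.isoOfSubEq {carrier : O → Type w} [grp : ∀ F, AddCommGroup (carrier F)]
    [mod : ∀ F, Module A (carrier F)] {gr : ∀ F, ℤ → AddSubgroup (carrier F)}
    {internal : ∀ F, DirectSum.IsInternal (gr F)}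
    {smul_mem : ∀ F i j, ∀ a ∈ deg i, ∀ m ∈ gr F j, a • m ∈ gr F (i + j)}
    {sub sub' : O → ∀ β : Rp, Submodule (loc β) (∀ F, carrier F)}
    {supp : ∀ F β, ∀ m ∈ sub F β, ∀ G, G ≠ F → G ≠ up β F → m G = 0}
    {supp' : ∀ F β, ∀ m ∈ sub' F β, ∀ G, G ≠ F → G ≠ up β F → m G = 0}
    (h : ∀ F β, sub F β = sub' F β) :
    (⟨carrier, gr, internal, smul_mem, sub, supp⟩ : KObj deg loc up) ≅
      ⟨carrier, gr, internal, smul_mem, sub', supp'⟩ where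
  hom := ⟨fun _ => LinearMap.id, fun _ _ _ h => h, fun F β _ hm => (h F β).le hm⟩
  inv := ⟨fun _ => LinearMap.id, fun _ _ _ h => h, fun F β _ hm => (h F β).ge hm⟩
  hom_inv_id := rfl
  inv_hom_id := rfl

instance (g : O → Rp → O → Aˣ) :
    (scaleFunctor g : KObj deg loc up ⥤ KObj deg loc up).Additive where
  map_add := rfl

section Images

variable {M N L : Type*} [AddCommGroup M] [Module A M] [AddCommGroup N] [Module A N]
  [AddCommGroup L] [Module A L] {B : Subring A}

theorem img_img (g : N →ₗ[A] L) (f : M →ₗ[A] N) (p : Submodule B M) :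
    img g (img f p) = img (g.comp f) p :=
  SetLike.ext fun x => ⟨by
    rintro ⟨_, ⟨m, hm, rfl⟩, rfl⟩
    exact ⟨m, hm, rfl⟩, by
    rintro ⟨m, hm, rfl⟩
    exact ⟨_, ⟨m, hm, rfl⟩, rfl⟩⟩

theorem img_sup (f : M →ₗ[A] N) (p q : Submodule B M) : img f (p ⊔ q) = img f p ⊔ img f q :=
  Submodule.map_sup p q (f.restrictScalars B)

theorem img_congr {f g : M →ₗ[A] N} {p : Submodule B M} (h : ∀ m ∈ p, f m = g m) :
    img f p = img g p :=
  SetLike.ext fun x => ⟨by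
    rintro ⟨m, hm, rfl⟩
    exact ⟨m, hm, (h m hm).symm⟩, by
    rintro ⟨m, hm, rfl⟩
    exact ⟨m, hm, h m hm⟩⟩

theorem img_eq_self {f : M →ₗ[A] M} {p : Submodule B M} (h : ∀ m ∈ p, f m = m) : img f p = p :=
  (img_congr (g := LinearMap.id) h).trans (SetLike.ext fun x => ⟨by
    rintro ⟨m, hm, rfl⟩
    exact hm, fun hx => (mem_img _ _ _).mpr ⟨x, hx, rfl⟩⟩)

/-- The image does not change under multiplication by a unit of the subring. -/
theorem img_smul_unit (f : M →ₗ[A] N) (p : Submodule B M) (u : Aˣ) (hu : (u : A) ∈ B)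
    (hu' : (↑u⁻¹ : A) ∈ B) : img ((u : A) • f) p = img f p := by
  have key : ∀ (g : M →ₗ[A] N) (c : A), c ∈ B → img (c • g) p ≤ img g p := by
    rintro g c hc _ ⟨m, hm, rfl⟩
    exact ⟨(⟨c, hc⟩ : B) • m, p.smul_mem _ hm, g.map_smul c m⟩
  refine le_antisymm (key f u hu) ?_
  have := key ((u : A) • f) _ hu'
  rwa [smul_smul, Units.inv_mul, one_smul] at this

end Images

section Stretch

open Classical in
/-- Multiplication of the component at `F` by `c` and of all others by `d`. -/
def stretch {M : O → Type w} [∀ F, AddCommGroup (M F)] [∀ F, Module A (M F)] (F : O) (c d : A) :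
    (∀ F, M F) →ₗ[A] (∀ F, M F) :=
  scaleMap fun G => if G = F then c else d

variable {M : O → Type w} [∀ F, AddCommGroup (M F)] [∀ F, Module A (M F)]

theorem scaleMap_apply (c : O → A) (m : ∀ F, M F) (G : O) : scaleMap c m G = c G • m G := rfl

theorem stretch_same (F : O) (c d : A) (m : ∀ F, M F) : stretch F c d m F = c • m F := by
  simp [stretch, scaleMap_apply]

theorem stretch_of_ne {F G : O} (h : G ≠ F) (c d : A) (m : ∀ F, M F) :
    stretch F c d m G = d • m G := by
  simp [stretch, scaleMap_apply, h]

theorem stretch_one_one (F : O) (m : ∀ F, M F) : stretch F (1 : A) 1 m = m := by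
  funext G
  simp [stretch, scaleMap_apply]

theorem stretch_comp (F : O) (c d : A) :
    (stretch (M := M) F c 1).comp (stretch F d 1) = stretch F (c * d) 1 := by
  refine LinearMap.ext fun m => funext fun G => ?_
  by_cases h : G = F
  · subst h
    simp [stretch_same, mul_smul]
  · simp [stretch_of_ne h]

end Stretch

/-- The submodules `M(F, β)` with `β ↑ F ≠ F` are stable under `(m, m') ↦ (β m, 0)`. -/
def Stab (e : Rp → A) (M : KObj deg loc up) : Prop :=
  ∀ F β, up β F ≠ F → ∀ m ∈ M.sub F β, stretch F (e β) 0 m ∈ M.sub F β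

variable {e : Rp → A}

theorem Stab.shift {M : KObj deg loc up} (h : Stab e M) (n : ℤ) : Stab e (M.shift n) := h

theorem Stab.dsum {J : Type} [Finite J] {M : J → KObj deg loc up} (h : ∀ j, Stab e (M j)) :
    Stab e (KObj.dsum M) :=
  fun F β hF _ hm j => h j F β hF _ (hm j)

/-- Morphisms are linear over `S^∅` at each facet, hence commute with scaling single components;
stability can be tested in `N` and brought back by the retraction. -/
theorem Stab.of_retract {M N : KObj deg loc up} (h : Stab e N) (f : M ⟶ N) (g : N ⟶ M)
    (hfg : f ≫ g = 𝟙 M) : Stab e M := by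
  intro F β hF m hm
  have h1 := g.app_sub F β _ (h F β hF _ (f.app_sub F β m hm))
  have h2 : ∀ G, g.app G (f.app G (m G)) = m G := fun G =>
    LinearMap.congr_fun (congrFun (congrArg KHom.app hfg) G) (m G)
  convert h1 using 1
  funext G
  by_cases hG : G = F
  · subst hG
    rw [stretch_same, stretch_same, map_smul, h2]
  · rw [stretch_of_ne hG, stretch_of_ne hG, zero_smul, zero_smul, map_zero]

theorem Stab.of_isDirectSummand {M N : KObj deg loc up} (h : Stab e N)
    (hMN : IsDirectSummand M N) : Stab e M :=
  let ⟨f, g, hfg⟩ := hMN.retract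
  h.of_retract f g hfg

section StretchStable

variable {M : O → Type w} [∀ F, AddCommGroup (M F)] [∀ F, Module A (M F)] {B : Subring A}
  {q : Submodule B (∀ F, M F)} {F : O} {c : A}

/-- `(1 + fc, 1) m = m + f (c, 0) m`, and `f` lies in the subring over which `q` is a module. -/
theorem stretch_mem_of_stable (h : ∀ m ∈ q, stretch F c 0 m ∈ q) {f : A} (hf : f ∈ B)
    {m : ∀ F, M F} (hm : m ∈ q) : stretch F (1 + f * c) 1 m ∈ q := by
  have h1 := add_mem hm (q.smul_mem (⟨f, hf⟩ : B) (h m hm))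
  convert h1 using 1
  funext G
  change _ = m G + f • stretch F c 0 m G
  by_cases hG : G = F
  · subst hG
    rw [stretch_same, stretch_same, add_smul, one_smul, mul_smul]
  · rw [stretch_of_ne hG, stretch_of_ne hG, zero_smul, smul_zero, one_smul, add_zero]

/-- This is how the discrepancy between the constants is absorbed. Since `u` and `u⁻¹` both have the
form `1 + fc`, each of the two scalings maps `q` into itself. -/
theorem img_stretch_of_stable (h : ∀ m ∈ q, stretch F c 0 m ∈ q) {u : Aˣ}
    (hu : ∃ f ∈ B, (u : A) = 1 + f * c) (hu' : ∃ f ∈ B, (↑u⁻¹ : A) = 1 + f * c) :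
    img (stretch F (u : A) 1) q = q := by
  obtain ⟨f, hf, huf⟩ := hu
  obtain ⟨f', hf', huf'⟩ := hu'
  apply le_antisymm
  · rintro _ ⟨m, hm, rfl⟩
    have := stretch_mem_of_stable h hf hm
    rwa [← huf] at this
  · intro m hm
    refine ⟨stretch F (↑u⁻¹ : A) 1 m, ?_, ?_⟩
    · have := stretch_mem_of_stable h hf' hm
      rwa [← huf'] at this
    · change (stretch F (u : A) 1).comp (stretch F (↑u⁻¹ : A) 1) m = m
      rw [stretch_comp, Units.mul_inv, stretch_one_one]

end StretchStable

end Additive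

/-! ### Compatibility of the translation functors with scaling one component. -/

section Translation

variable {A : Type w} [CommRing A] {Rp : Type x} {O₁ : Type y} {O₂ : Type z}
  {deg : ℤ → AddSubgroup A} {loc : Rp → Subring A} {up₁ : Rp → O₁ → O₁} {up₂ : Rp → O₂ → O₂}
  {minus plus : O₂ → O₁} {bar : O₁ → O₂}

instance (a : O₁ → Rp → Aˣ) :
    (onFunctor minus plus a : KObj deg loc up₁ ⥤ KObj deg loc up₂).Additive where
  map_add := rfl

instance (e : Rp → Aˣ) (a : O₁ → Rp → Aˣ) :
    (outFunctor minus bar e a : KObj deg loc up₂ ⥤ KObj deg loc up₁).Additive where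
  map_add := rfl

section Places

theorem placeOn_same {M : O₁ → Type w} [∀ F, AddCommGroup (M F)] [∀ F, Module A (M F)] (B : O₂)
    (m : ∀ F, M F) : placeOn (A := A) minus plus M B m B = (m (minus B), m (plus B)) := by
  simp [placeOn]

theorem placeOn_of_ne {M : O₁ → Type w} [∀ F, AddCommGroup (M F)] [∀ F, Module A (M F)]
    {B B' : O₂} (h : B' ≠ B) (m : ∀ F, M F) : placeOn (A := A) minus plus M B m B' = 0 := by
  simp [placeOn, h]

theorem placeOut_same {N : O₂ → Type w} [∀ F, AddCommGroup (N F)] [∀ F, Module A (N F)] (C : O₁)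
    (n : ∀ F, N F) : placeOut (A := A) bar N C n C = n (bar C) := by
  simp [placeOut]

theorem placeOut_of_ne {N : O₂ → Type w} [∀ F, AddCommGroup (N F)] [∀ F, Module A (N F)]
    {C C' : O₁} (h : C' ≠ C) (n : ∀ F, N F) : placeOut (A := A) bar N C n C' = 0 := by
  simp [placeOut, h]

/-- Translation onto the walls commutes with scaling at an alcove `C` of a wall `B`. -/
theorem stretch_placeOn {M : O₁ → Type w} [∀ F, AddCommGroup (M F)] [∀ F, Module A (M F)]
    {B B' : O₂} {C : O₁} (hB : B' ≠ B) (h1 : minus B' ≠ C) (h2 : plus B' ≠ C) (c d : A)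
    {m : ∀ F, M F} (h3 : minus B ≠ C → m (minus B) = 0) (h4 : plus B ≠ C → m (plus B) = 0) :
    stretch B c d ((placeOn minus plus M B + placeOn minus plus M B' :
        (∀ F, M F) →ₗ[A] ∀ B, M (minus B) × M (plus B)) m) =
      (placeOn minus plus M B + placeOn minus plus M B' :
        (∀ F, M F) →ₗ[A] ∀ B, M (minus B) × M (plus B)) (stretch C c d m) := by
  -- Scaling at `B` acts on both components at `B₋` and `B₊`. This agrees with scaling at `C` alone,
  -- because the component at the alcove different from `C` is zero.
  have hscale : ∀ G, (G ≠ C → m G = 0) → c • m G = stretch C c d m G := by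
    intro G hG
    by_cases h : G = C
    · subst h
      rw [stretch_same]
    · rw [hG h, stretch_of_ne h, hG h, smul_zero, smul_zero]
  funext G
  rw [LinearMap.add_apply, LinearMap.add_apply]
  by_cases hG : G = B
  · subst hG
    rw [stretch_same, Pi.add_apply, Pi.add_apply, placeOn_same, placeOn_of_ne hB.symm,
      placeOn_same, placeOn_of_ne hB.symm, add_zero, add_zero, Prod.smul_mk, hscale _ h3,
      hscale _ h4]
  · rw [stretch_of_ne hG, Pi.add_apply, Pi.add_apply, placeOn_of_ne hG, placeOn_of_ne hG, zero_add,
      zero_add]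
    by_cases hG' : G = B'
    · subst hG'
      rw [placeOn_same, placeOn_same, Prod.smul_mk, stretch_of_ne h1, stretch_of_ne h2]
    · rw [placeOn_of_ne hG', placeOn_of_ne hG', smul_zero]

/-- Translation out of the walls commutes with scaling at the wall of an alcove `C`. -/
theorem stretch_placeOut {N : O₂ → Type w} [∀ F, AddCommGroup (N F)] [∀ F, Module A (N F)]
    {C C' : O₁} (hC : C' ≠ C) (hb : bar C' ≠ bar C) (a c d : A) (n : ∀ F, N F) :
    stretch C c d ((a • placeOut bar N C + placeOut bar N C' : (∀ F, N F) →ₗ[A] ∀ C, N (bar C)) n) =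
      (a • placeOut bar N C + placeOut bar N C' : (∀ F, N F) →ₗ[A] ∀ C, N (bar C)) (stretch (bar C) c d n) := by
  funext G
  rw [LinearMap.add_apply, LinearMap.add_apply, LinearMap.smul_apply, LinearMap.smul_apply]
  by_cases hG : G = C
  · subst hG
    rw [stretch_same, Pi.add_apply, Pi.add_apply, Pi.smul_apply, Pi.smul_apply, placeOut_same,
      placeOut_of_ne hC.symm, placeOut_same, placeOut_of_ne hC.symm, stretch_same, add_zero,
      add_zero, smul_comm]
  · rw [stretch_of_ne hG, Pi.add_apply, Pi.add_apply, Pi.smul_apply, Pi.smul_apply,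
      placeOut_of_ne hG, placeOut_of_ne hG, smul_zero, zero_add, zero_add]
    by_cases hG' : G = C'
    · subst hG'
      rw [placeOut_same, placeOut_same, stretch_of_ne hb]
    · rw [placeOut_of_ne hG', placeOut_of_ne hG', smul_zero]

end Places

end Translation

/-! ### Submodules of translates under rescaling, for abstract constants. -/

section Submodules

variable {A : Type w} [CommRing A] {Rp : Type x} {O₁ : Type y} {O₂ : Type z}
  {deg : ℤ → AddSubgroup A} {loc : Rp → Subring A} {up₁ : Rp → O₁ → O₁} {up₂ : Rp → O₂ → O₂}
  {minus plus : O₂ → O₁} {bar : O₁ → O₂}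

/-- The quasi-inverse rescales by the inverse scalars; unit and counit are the identity on all
modules. -/
theorem scaleFunctor_isEquivalence (g : O₁ → Rp → O₁ → Aˣ) :
    (scaleFunctor g : KObj deg loc up₁ ⥤ KObj deg loc up₁).IsEquivalence := by
  have key : ∀ (g h : O₁ → Rp → O₁ → Aˣ), (∀ F β G, g F β G * h F β G = 1) →
      ∀ (M : KObj deg loc up₁) (F : O₁) (β : Rp),
      img (scaleMap fun G => (g F β G : A)) (img (scaleMap fun G => (h F β G : A)) (M.sub F β)) =
        M.sub F β := by
    intro g h hgh M F β
    rw [img_img]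
    refine img_eq_self fun m _ => funext fun G => ?_
    change (g F β G : A) • (h F β G : A) • m G = m G
    rw [smul_smul, ← Units.val_mul, hgh, Units.val_one, one_smul]
  exact Functor.IsEquivalence.mk' (scaleFunctor fun F β G => (g F β G)⁻¹)
    (NatIso.ofComponents
      (fun M => KObj.isoOfSubEq fun F β => (key _ g (fun _ _ _ => inv_mul_cancel _) M F β).symm)
      fun _ => rfl)
    (NatIso.ofComponents
      (fun M => KObj.isoOfSubEq fun F β => key g _ (fun _ _ _ => mul_inv_cancel _) M F β)
      fun _ => rfl)

open Classical in
theorem scaleMap_ite {O : Type*} {M : O → Type*} [∀ F, AddCommGroup (M F)]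
    [∀ F, Module A (M F)] (F : O) (u : Aˣ) (m : ∀ F, M F) (G : O) :
    ((if G = F then u else 1 : Aˣ) : A) • m G = (if G = F then (u : A) else 1) • m G := by
  split_ifs <;> rfl

section On

variable {M : O₁ → Type w} [∀ F, AddCommGroup (M F)] [∀ F, Module A (M F)]

open Classical in
/-- The submodules of a translate onto the walls. -/
def onSub (minus plus : O₂ → O₁) (up₂ : Rp → O₂ → O₂) (a : O₁ → Rp → Aˣ)
    (p : O₁ → ∀ β : Rp, Submodule (loc β) (∀ F, M F)) (B : O₂) (β : Rp) :
    Submodule (loc β) (∀ B, M (minus B) × M (plus B)) :=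
  if up₂ β B = B then
    img (placeOn minus plus M B) (img (twist (minus B) ↑(a (minus B) β)⁻¹) (p (minus B) β))
  else
    img (placeOn minus plus M B + placeOn minus plus M (up₂ β B))
      (img (twist (minus B) ↑(a (minus B) β)⁻¹) (p (minus B) β) ⊔
        img (twist (plus B) ↑(a (plus B) β)⁻¹) (p (plus B) β))

variable {a : O₁ → Rp → Aˣ} {p : O₁ → ∀ β : Rp, Submodule (loc β) (∀ F, M F)} {B : O₂} {β : Rp}

theorem onSub_of_eq (h : up₂ β B = B) : onSub minus plus up₂ a p B β =
    img ((placeOn minus plus M B).comp (stretch (minus B) ↑(a (minus B) β)⁻¹ 1))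
      (p (minus B) β) := by
  rw [← img_img]
  exact if_pos h

theorem onSub_of_ne (h : up₂ β B ≠ B) : onSub minus plus up₂ a p B β =
    img ((placeOn minus plus M B + placeOn minus plus M (up₂ β B)).comp
        (stretch (minus B) ↑(a (minus B) β)⁻¹ 1)) (p (minus B) β) ⊔
      img ((placeOn minus plus M B + placeOn minus plus M (up₂ β B)).comp
        (stretch (plus B) ↑(a (plus B) β)⁻¹ 1)) (p (plus B) β) := by
  rw [← img_img, ← img_img, ← img_sup]
  exact if_neg h

theorem onSub_one_of_ne (h : up₂ β B ≠ B) : onSub minus plus up₂ (fun _ _ => 1) p B β =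
    img (placeOn minus plus M B + placeOn minus plus M (up₂ β B)) (p (minus B) β) ⊔
      img (placeOn minus plus M B + placeOn minus plus M (up₂ β B)) (p (plus B) β) := by
  rw [onSub_of_ne h]
  congr 1 <;> refine img_congr fun m _ => ?_ <;>
    rw [LinearMap.comp_apply, inv_one, Units.val_one, stretch_one_one]

/-- Comparison of scalings before and after a map that turns scaling at `C` into scaling
at `B`. -/
theorem img_comp_stretch {N : O₂ → Type w} [∀ F, AddCommGroup (N F)] [∀ F, Module A (N F)]
    {S : Subring A} {q : Submodule S (∀ F, M F)} {C : O₁} {L : (∀ F, M F) →ₗ[A] ∀ F, N F}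
    (hL : ∀ (c : A), ∀ m ∈ q, stretch B c 1 (L m) = L (stretch C c 1 m)) {a d d' u : Aˣ}
    (hu : img (stretch C (u : A) 1) q = q) (hd : d = u * (a * d')) :
    img (L.comp (stretch C ↑a⁻¹ 1)) (img (stretch C (d : A) 1) q) =
      img (stretch B (d' : A) 1) (img L q) := by
  -- After division by `a`, the alcove scalar `d` becomes the wall scalar `d'` times `u`, and `u`
  -- acts on `q` as an automorphism.
  have h1 : (↑a⁻¹ : A) * d = d' * u := by
    rw [hd, ← Units.val_mul, ← Units.val_mul, mul_left_comm u, inv_mul_cancel_left, mul_comm u]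
  rw [img_img, LinearMap.comp_assoc, stretch_comp, h1, ← stretch_comp, ← LinearMap.comp_assoc,
    ← img_img, hu, img_img]
  exact img_congr fun m hm => (hL _ m hm).symm

theorem img_stable {N : O₂ → Type w} [∀ F, AddCommGroup (N F)] [∀ F, Module A (N F)]
    {S : Subring A} {q : Submodule S (∀ F, M F)} {C : O₁} {L : (∀ F, M F) →ₗ[A] ∀ F, N F} {c : A}
    (hL : ∀ m ∈ q, stretch B c 0 (L m) = L (stretch C c 0 m)) (hq : ∀ m ∈ q, stretch C c 0 m ∈ q) :
    ∀ n ∈ img L q, stretch B c 0 n ∈ img L q := by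
  rintro _ ⟨m, hm, rfl⟩
  exact ⟨_, hq m hm, (hL m hm).symm⟩

end On

section Out

variable {N : O₂ → Type w} [∀ F, AddCommGroup (N F)] [∀ F, Module A (N F)]

open Classical in
/-- The submodules of a translate out of the walls. -/
def outSub (minus : O₂ → O₁) (bar : O₁ → O₂) (up₁ : Rp → O₁ → O₁) (up₂ : Rp → O₂ → O₂)
    (e : Rp → Aˣ) (a : O₁ → Rp → Aˣ) (q : O₂ → ∀ β : Rp, Submodule (loc β) (∀ F, N F))
    (C : O₁) (β : Rp) : Submodule (loc β) (∀ C, N (bar C)) :=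
  if up₂ β (bar C) = bar C then
    if C = minus (bar C) then
      img ((e β : A) • placeOut bar N C) (q (bar C) β) ⊔
        img ((a C β : A) • placeOut bar N C + placeOut bar N (up₁ β C)) (q (bar C) β)
    else
      img ((e β : A) • placeOut bar N C) (q (bar C) β) ⊔
        img (placeOut bar N (up₁ β C)) (q (bar (up₁ β C)) β)
  else
    img ((a C β : A) • placeOut bar N C + placeOut bar N (up₁ β C)) (q (bar C) β)

variable {e : Rp → Aˣ} {a : O₁ → Rp → Aˣ} {q : O₂ → ∀ β : Rp, Submodule (loc β) (∀ F, N F)}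
  {C : O₁} {β : Rp}

theorem outSub_of_eq_minus (h : up₂ β (bar C) = bar C) (h' : C = minus (bar C)) :
    outSub minus bar up₁ up₂ e a q C β =
      img ((e β : A) • placeOut bar N C) (q (bar C) β) ⊔
        img ((a C β : A) • placeOut bar N C + placeOut bar N (up₁ β C)) (q (bar C) β) :=
  (if_pos h).trans (if_pos h')

theorem outSub_of_ne_minus (h : up₂ β (bar C) = bar C) (h' : C ≠ minus (bar C)) :
    outSub minus bar up₁ up₂ e a q C β =
      img ((e β : A) • placeOut bar N C) (q (bar C) β) ⊔
        img (placeOut bar N (up₁ β C)) (q (bar (up₁ β C)) β) :=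
  (if_pos h).trans (if_neg h')

theorem outSub_of_ne (h : up₂ β (bar C) ≠ bar C) :
    outSub minus bar up₁ up₂ e a q C β =
      img ((a C β : A) • placeOut bar N C + placeOut bar N (up₁ β C)) (q (bar C) β) :=
  if_neg h

theorem stretch_smul_placeOut (c d x : A) (n : ∀ F, N F) :
    stretch C c d ((x • placeOut bar N C : (∀ F, N F) →ₗ[A] ∀ C, N (bar C)) n) =
      ((c * x) • placeOut bar N C : (∀ F, N F) →ₗ[A] ∀ C, N (bar C)) n := by
  funext G
  rw [LinearMap.smul_apply, LinearMap.smul_apply]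
  by_cases hG : G = C
  · subst hG
    rw [stretch_same, Pi.smul_apply, Pi.smul_apply, smul_smul]
  · rw [stretch_of_ne hG, Pi.smul_apply, Pi.smul_apply, placeOut_of_ne hG, smul_zero, smul_zero,
      smul_zero]

theorem stretch_placeOut_of_ne {C' : O₁} (h : C' ≠ C) (c d : A) (n : ∀ F, N F) :
    stretch C c d (placeOut (A := A) bar N C' n) = d • placeOut (A := A) bar N C' n := by
  funext G
  by_cases hG : G = C
  · subst hG
    rw [stretch_same, Pi.smul_apply, placeOut_of_ne h.symm, smul_zero, smul_zero]
  · rw [stretch_of_ne hG, Pi.smul_apply]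

theorem stretch_add_placeOut {C' : O₁} (h : C' ≠ C) (c d x : A) (n : ∀ F, N F) :
    stretch C c d ((x • placeOut bar N C + placeOut bar N C' :
        (∀ F, N F) →ₗ[A] ∀ C, N (bar C)) n) =
      ((c * x) • placeOut bar N C + d • placeOut bar N C' :
        (∀ F, N F) →ₗ[A] ∀ C, N (bar C)) n := by
  rw [LinearMap.add_apply, map_add, stretch_smul_placeOut, stretch_placeOut_of_ne h]
  rfl

variable (hC : up₁ β C ≠ C)
include hC

/-- If the submodules of a family on the walls are stable under `(n, n') ↦ (β n, 0)`, then so are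
those of the translate out of the walls. -/
theorem outSub_stable (he : (e β : A) ∈ loc β)
    (hb : up₂ β (bar C) ≠ bar C → bar (up₁ β C) ≠ bar C)
    (hq : up₂ β (bar C) ≠ bar C → ∀ n ∈ q (bar C) β, stretch (bar C) (e β : A) 0 n ∈ q (bar C) β) :
    ∀ m ∈ outSub minus bar up₁ up₂ e (fun _ _ => 1) q C β,
      stretch C (e β : A) 0 m ∈ outSub minus bar up₁ up₂ e (fun _ _ => 1) q C β := by
  by_cases h : up₂ β (bar C) = bar C
  · have h1 : ∀ m ∈ img ((e β : A) • placeOut bar N C : (∀ F, N F) →ₗ[A] ∀ C, N (bar C))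
        (q (bar C) β), stretch C (e β : A) 0 m ∈ img ((e β : A) • placeOut bar N C :
          (∀ F, N F) →ₗ[A] ∀ C, N (bar C)) (q (bar C) β) := by
      rintro _ ⟨n, hn, rfl⟩
      refine ⟨(⟨_, he⟩ : loc β) • n, Submodule.smul_mem _ _ hn, ?_⟩
      exact (LinearMap.map_smul _ _ _).trans ((stretch_smul_placeOut _ _ _ n).trans
        (by rw [mul_smul]; rfl)).symm
    by_cases h' : C = minus (bar C)
    · rw [outSub_of_eq_minus h h']
      intro m hm
      obtain ⟨x, hx, _, ⟨n, hn, rfl⟩, rfl⟩ := Submodule.mem_sup.mp hm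
      rw [map_add]
      -- Scaling `(y, y)` by `(β, 0)` gives `(βy, 0)`, an element of the first summand.
      refine Submodule.mem_sup_left (add_mem (h1 x hx) ⟨n, hn, ?_⟩)
      refine Eq.trans ?_ (stretch_add_placeOut hC _ _ _ n).symm
      rw [Units.val_one, mul_one, zero_smul, add_zero]
      rfl
    · rw [outSub_of_ne_minus h h']
      intro m hm
      obtain ⟨x, hx, _, ⟨n, hn, rfl⟩, rfl⟩ := Submodule.mem_sup.mp hm
      rw [map_add]
      refine Submodule.mem_sup_left (add_mem (h1 x hx) ?_)
      have := stretch_placeOut_of_ne (A := A) (bar := bar) hC (e β : A) 0 n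
      rw [zero_smul] at this
      exact (congrArg (· ∈ _) this).mpr (zero_mem _)
  · rw [outSub_of_ne h]
    rintro _ ⟨n, hn, rfl⟩
    exact ⟨_, hq h n hn, (stretch_placeOut hC (hb h) _ _ _ n).symm⟩

/-- On the first summand the scalar `d e` is a unit of `S^β` and can be dropped; the diagonal
summand becomes `{(d y, y)}`, which is the required one since `d = a`. -/
theorem outSub_scale_of_eq_minus (h : up₂ β (bar C) = bar C) (h' : C = minus (bar C)) {d : Aˣ}
    (hd : ((d * e β : Aˣ) : A) ∈ loc β) (hd' : (↑(d * e β)⁻¹ : A) ∈ loc β) (hda : d = a C β) :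
    outSub minus bar up₁ up₂ (fun _ => 1) a q C β =
      img (stretch C (d : A) 1) (outSub minus bar up₁ up₂ e (fun _ _ => 1) q C β) := by
  rw [outSub_of_eq_minus h h', outSub_of_eq_minus h h', img_sup, img_img, img_img]
  congr 1
  · rw [Units.val_one, one_smul, ← img_smul_unit (placeOut bar N C) _ _ hd hd', Units.val_mul]
    exact img_congr fun n _ => (stretch_smul_placeOut _ _ _ n).symm
  · refine img_congr fun n _ => Eq.trans ?_ (stretch_add_placeOut hC _ _ _ n).symm
    rw [hda, Units.val_one, mul_one, one_smul]

/-- The summand at `C` changes only by the unit `d e` of `S^β`, and the summand at `β ↑ C` is not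
scaled, so no relation between `d` and `a` is needed. -/
theorem outSub_scale_of_ne_minus (h : up₂ β (bar C) = bar C) (h' : C ≠ minus (bar C)) {d : Aˣ}
    (hd : ((d * e β : Aˣ) : A) ∈ loc β) (hd' : (↑(d * e β)⁻¹ : A) ∈ loc β) :
    outSub minus bar up₁ up₂ (fun _ => 1) a q C β =
      img (stretch C (d : A) 1) (outSub minus bar up₁ up₂ e (fun _ _ => 1) q C β) := by
  rw [outSub_of_ne_minus h h', outSub_of_ne_minus h h', img_sup, img_img, img_img]
  congr 1
  · rw [Units.val_one, one_smul, ← img_smul_unit (placeOut bar N C) _ _ hd hd', Units.val_mul]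
    exact img_congr fun n _ => (stretch_smul_placeOut _ _ _ n).symm
  · refine img_congr fun n _ => Eq.trans ?_ (stretch_placeOut_of_ne hC _ _ n).symm
    rw [one_smul]

theorem outSub_scale_of_ne (h : up₂ β (bar C) ≠ bar C) (hb : bar (up₁ β C) ≠ bar C)
    {q' : O₂ → ∀ β : Rp, Submodule (loc β) (∀ F, N F)} {d d' u : Aˣ}
    (hu : img (stretch (bar C) (u : A) 1) (q (bar C) β) = q (bar C) β)
    (hq : q' (bar C) β = img (stretch (bar C) (d' : A) 1) (q (bar C) β))
    (hd : d = u * (a C β * d')) :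
    outSub minus bar up₁ up₂ (fun _ => 1) a q' C β =
      img (stretch C (d : A) 1) (outSub minus bar up₁ up₂ e (fun _ _ => 1) q C β) := by
  rw [outSub_of_ne h, outSub_of_ne h, hq]
  -- Inserting the automorphism `(u, 1)` of the submodule supplies the factor missing between `a d'`
  -- and `d`.
  conv_lhs => rw [← hu]
  rw [img_img, img_img, img_img]
  refine img_congr fun n _ => Eq.trans ?_ (stretch_add_placeOut hC _ _ _ n).symm
  have h1 := congrFun (congrArg DFunLike.coe (stretch_comp (M := N) (bar C) (d' : A) u)) n
  rw [LinearMap.comp_apply] at h1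
  rw [LinearMap.comp_apply, LinearMap.comp_apply, h1, ← stretch_placeOut hC hb]
  refine (stretch_add_placeOut hC _ _ _ n).trans ?_
  rw [hd]
  push_cast
  rw [mul_one, show (d' : A) * u * a C β = u * (a C β * d') by ring]

end Out

end Submodules

/-! ### The intertwining isomorphisms on stable objects. -/

section Intertwining

variable (k : Type z) [Field k] {ι : Type t} {V : Type u} {W : Type v} [AddCommGroup V]
  [Module ℚ V] [AddCommGroup W] [Module ℚ W] {P : RootPairing ι ℚ V W} [P.IsCrystallographic]
  {b : P.Base}

instance (s : SimpleRefl b) : (Ton k s).Additive :=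
  inferInstanceAs (onFunctor _ _ _).Additive

instance (s : SimpleRefl b) : (Ton' k s).Additive :=
  inferInstanceAs (onFunctor _ _ _).Additive

instance (s : SimpleRefl b) : (Tout k s).Additive :=
  inferInstanceAs (outFunctor _ _ _ _).Additive

instance (s : SimpleRefl b) : (Tout' k s).Additive :=
  inferInstanceAs (outFunctor _ _ _ _).Additive

instance (s : SimpleRefl b) : (Tr k s).Additive :=
  inferInstanceAs (Ton k s ⋙ Tout k s).Additive

instance (s : SimpleRefl b) : (Tr' k s).Additive :=
  inferInstanceAs (Ton' k s ⋙ Tout' k s).Additive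

variable (b) in
instance : (gammaAlc k b).Additive :=
  inferInstanceAs (scaleFunctor _).Additive

variable (b) in
instance gammaAlc_isEquivalence : (gammaAlc k b).IsEquivalence :=
  scaleFunctor_isEquivalence _

instance gammaWall_isEquivalence (s : SimpleRefl b) : (gammaWall k s).IsEquivalence :=
  scaleFunctor_isEquivalence _

variable {k}

open Classical in
theorem img_scaleMap_ite {F₀ : Set W} {M : Orb P F₀ → Type _} [∀ F, AddCommGroup (M F)]
    [∀ F, Module (Sempty k b) (M F)] {S : Subring (Sempty k b)} (q : Submodule S (∀ F, M F))
    (F : Orb P F₀) (d : (Sempty k b)ˣ) :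
    img (scaleMap fun G => ((if G = F then d else 1 : (Sempty k b)ˣ) : Sempty k b)) q =
      img (stretch F (d : Sempty k b) 1) q :=
  img_congr fun m _ => funext fun G => scaleMap_ite F d m G

/-- The property `Stab` with respect to the roots `β`. -/
abbrev RootStab {F₀ : Set W} (M : KCat k b F₀) : Prop :=
  Stab (fun β => (rootUnit k β : Sempty k b)) M

variable [Finite ι] [P.IsRootSystem] [P.IsReduced] [P.IsIrreducible] {s : SimpleRefl b}

-- Elements of `M(C, β)` are supported on `C` and `β ↑ C`. All alcoves at `B` lie in one `β`-strip
-- and those at `β ↑ B` in the next. So the component at the other alcove of `B` vanishes, and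
-- scaling at `C` does not affect the alcoves at `β ↑ B`.
omit [P.IsIrreducible] in
theorem stretch_placeOn_carrier (M : KAlc k b) {B : Wall s} {β : PosRoot b} (h : up β B ≠ B)
    {C : Alcove b} (hC : B.1 ⊆ clos b C.1) (c d : Sempty k b) {m : ∀ C, M.carrier C}
    (hm : m ∈ M.sub C β) :
    stretch B c d ((placeOn (minus s) (plus s) M.carrier B +
        placeOn (minus s) (plus s) M.carrier (up β B) :
          (∀ C, M.carrier C) →ₗ[Sempty k b] ∀ B, M.carrier (minus s B) × M.carrier (plus s B)) m) =
      (placeOn (minus s) (plus s) M.carrier B + placeOn (minus s) (plus s) M.carrier (up β B) :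
          (∀ C, M.carrier C) →ₗ[Sempty k b] ∀ B, M.carrier (minus s B) × M.carrier (plus s B))
        (stretch C c d m) := by
  obtain ⟨n, hn⟩ := exists_inStrip_wall fun h' => h (up_wall_eq_self_iff.mpr h')
  have hCn := hn.of_subset_clos hC
  have hB' : InStrip β (n + 1) (up β B).1 := by
    rw [hn.up_eq (wall_nonempty B)]
    exact hn.act
  have hC' : InStrip β (n + 1) (up β C).1 := by
    rw [hCn.up_eq (alcove_nonempty C)]
    exact hCn.act
  exact stretch_placeOn h (ne_of_inStrip hB'.minus hCn (by omega))
    (ne_of_inStrip hB'.plus hCn (by omega)) c d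
    (fun h1 => M.supp C β m hm _ h1 (ne_of_inStrip hn.minus hC' (by omega)))
    (fun h1 => M.supp C β m hm _ h1 (ne_of_inStrip hn.plus hC' (by omega)))

omit [P.IsIrreducible] in
theorem RootStab.Ton {M : KAlc k b} (hM : RootStab M) : RootStab ((Ton k s).obj M) := by
  intro B β h
  have key : ∀ m ∈ onSub (minus s) (plus s) up (fun _ _ => 1) M.sub B β,
      stretch B (rootUnit k β : Sempty k b) 0 m ∈
        onSub (minus s) (plus s) up (fun _ _ => 1) M.sub B β := by
    rw [onSub_one_of_ne h]
    exact map_sup (map_add _)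
      (img_stable (fun m hm => stretch_placeOn_carrier M h (subset_clos_minus B) _ _ hm)
        (hM _ β (up_ne_self β _)))
      (img_stable (fun m hm => stretch_placeOn_carrier M h (subset_clos_plus B) _ _ hm)
        (hM _ β (up_ne_self β _)))
  exact key

theorem RootStab.Tout {N : KWall k s} (hN : RootStab N) : RootStab ((Tout k s).obj N) :=
  fun C β hC => outSub_stable (q := N.sub) hC (rootUnit_mem_Sbeta k β β) bar_up_ne (hN (bar s C) β)

theorem RootStab.Tr {M : KAlc k b} (hM : RootStab M) : RootStab ((Tr k s).obj M) :=
  hM.Ton.Tout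

-- If `β ↑ B = B`, the scalars `d_{B₋}` and `a_{B₋}` cancel. Otherwise the `B₋` summand matches
-- exactly, and the `B₊` summand up to a unit in `1 + β S^β`, which stability of `M` absorbs.
open Classical in
theorem onSub_gamma {M : KAlc k b} (hM : RootStab M)
    {p : Alcove b → ∀ β : PosRoot b, Submodule (Sbeta k β) (∀ C, M.carrier C)} (B : Wall s)
    (β : PosRoot b) (hp : ∀ C, p C β = img (scaleMap fun G =>
      ((if G = C then dAlc k C β else 1 : (Sempty k b)ˣ) : Sempty k b)) (M.sub C β)) :
    onSub (minus s) (plus s) up (aConst k s) p B β =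
      img (scaleMap fun G => ((if up β B ≠ B ∧ G = B then dWall k s B β else 1 : (Sempty k b)ˣ) : Sempty k b))
        (onSub (minus s) (plus s) up (fun _ _ => 1) M.sub B β) := by
  have hγ : ∀ C : Alcove b, p C β = img (stretch C (dAlc k C β : Sempty k b) 1) (M.sub C β) :=
    fun C => (hp C).trans (img_scaleMap_ite (M.sub C β) C (dAlc k C β))
  by_cases h : up β B = B
  · rw [onSub_of_eq h, onSub_of_eq h, hγ]
    have h1 : ∀ q : Submodule (Sbeta k β) (∀ B, M.carrier (minus s B) × M.carrier (plus s B)),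
        img (scaleMap fun G => ((if up β B ≠ B ∧ G = B then dWall k s B β else 1 : (Sempty k b)ˣ) : Sempty k b)) q = q := by
      intro q
      refine img_eq_self fun m _ => funext fun G => ?_
      rw [scaleMap_apply, if_neg fun h' => h'.1 h, Units.val_one, one_smul]
    rw [h1, img_img, LinearMap.comp_assoc, stretch_comp, dAlc_minus_eq_aConst k h, Units.inv_mul,
      inv_one, Units.val_one]
  · have h1 : ∀ q : Submodule (Sbeta k β) (∀ B, M.carrier (minus s B) × M.carrier (plus s B)),
        img (scaleMap fun G => ((if up β B ≠ B ∧ G = B then dWall k s B β else 1 : (Sempty k b)ˣ) : Sempty k b)) q =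
        img (stretch B (dWall k s B β : Sempty k b) 1) q := by
      intro q
      rw [← img_scaleMap_ite]
      simp only [h, ne_eq, not_false_eq_true, true_and]
    rw [onSub_of_ne h, onSub_one_of_ne h, h1, img_sup, hγ, hγ]
    congr 1
    · exact img_comp_stretch (u := 1)
        (fun c m hm => stretch_placeOn_carrier M h (subset_clos_minus B) c 1 hm)
        (img_stretch_of_stable (hM _ β (up_ne_self β _)) (isOneUnit_one k β).1
          (isOneUnit_one k β).2) (by rw [dAlc_minus_eq, one_mul])
    · obtain ⟨u, hu, hd⟩ := dAlc_plus_eq k h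
      exact img_comp_stretch
        (fun c m hm => stretch_placeOn_carrier M h (subset_clos_plus B) c 1 hm)
        (img_stretch_of_stable (hM _ β (up_ne_self β _)) hu.1 hu.2) hd

/-- `T'_on ∘ γ` and `γ^s ∘ T_on` agree on objects with the property `RootStab`. -/
def onIso {M : KAlc k b} (hM : RootStab M) :
    (Ton' k s).obj ((gammaAlc k b).obj M) ≅ (gammaWall k s).obj ((Ton k s).obj M) :=
  KObj.isoOfSubEq fun B β => onSub_gamma hM B β fun _ => rfl

-- If `β ↑` fixes the wall of `C`, the wall submodules are unscaled and only two facts are used: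
-- `d_C β` is a unit of `S^β`, and `d_C = a_C` for the lower alcove. Otherwise `d_C = u a_C d_B`,
-- and stability of `N` absorbs `u`.
open Classical in
theorem outSub_gamma {N : KWall k s} (hN : RootStab N)
    {q : Wall s → ∀ β : PosRoot b, Submodule (Sbeta k β) (∀ B, N.carrier B)} (C : Alcove b)
    (β : PosRoot b) (hq : ∀ B, q B β = img (scaleMap fun G =>
      ((if up β B ≠ B ∧ G = B then dWall k s B β else 1 : (Sempty k b)ˣ) : Sempty k b))
        (N.sub B β)) :
    outSub (minus s) (bar s) up up (fun _ => 1) (aConst k s) q C β =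
      img (scaleMap fun G => ((if G = C then dAlc k C β else 1 : (Sempty k b)ˣ) : Sempty k b))
        (outSub (minus s) (bar s) up up (fun β => rootUnit k β) (fun _ _ => 1) N.sub C β) := by
  have hC := up_ne_self β C
  have hd := dAlc_mul_rootUnit_mem k C β
  rw [img_scaleMap_ite]
  have h0 : ∀ B : Wall s, up β B = B → q B β = N.sub B β := fun B h =>
    (hq B).trans <| img_eq_self fun m _ => funext fun G => by
      rw [scaleMap_apply, if_neg fun h' => h'.1 h, Units.val_one, one_smul]
  by_cases h : up β (bar s C) = bar s C
  · by_cases h' : C = minus s (bar s C)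
    · refine Eq.trans ?_ (outSub_scale_of_eq_minus (a := aConst k s) (q := N.sub) hC h h' hd.1 hd.2 ?_)
      · rw [outSub_of_eq_minus h h', outSub_of_eq_minus h h', h0 _ h]
      · have := dAlc_minus_eq_aConst k h
        rwa [← h'] at this
    · refine Eq.trans ?_ (outSub_scale_of_ne_minus (a := aConst k s) (q := N.sub) hC h h' hd.1 hd.2)
      -- The second summand is taken at the wall of `β ↑ C`, which is also of type `β` and hence
      -- unscaled.
      · rw [outSub_of_ne_minus h h', outSub_of_ne_minus h h', h0 _ h, h0 _ (up_bar_up h)]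
  · obtain ⟨u, hu, hd⟩ := dAlc_eq_mul k h
    refine outSub_scale_of_ne (q := N.sub) hC h (bar_up_ne h)
      (img_stretch_of_stable (hN _ β h) hu.1 hu.2) ?_ hd
    refine (hq _).trans (Eq.trans ?_ (img_scaleMap_ite _ _ _))
    refine img_congr fun m _ => ?_
    simp only [h, ne_eq, not_false_eq_true, true_and]

/-- `T'_out ∘ γ^s` and `γ ∘ T_out` agree on objects with the property `RootStab`. -/
def outIso {N : KWall k s} (hN : RootStab N) :
    (Tout' k s).obj ((gammaWall k s).obj N) ≅ (gammaAlc k b).obj ((Tout k s).obj N) :=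
  KObj.isoOfSubEq fun C β => outSub_gamma hN C β fun _ => rfl

/-- `T' ∘ γ` and `γ ∘ T` agree on objects with the property `RootStab`. -/
def trIso {M : KAlc k b} (hM : RootStab M) :
    (Tr' k s).obj ((gammaAlc k b).obj M) ≅ (gammaAlc k b).obj ((Tr k s).obj M) :=
  (Tout' k s).mapIso (onIso hM) ≪≫ outIso hM.Ton

end Intertwining

/-! ### Unit objects: stability and rescaling. -/

section UnitObject

variable {A : Type w} [CommRing A] {Rp : Type x} {O : Type y} {deg : ℤ → AddSubgroup A}
  {loc : Rp → Subring A} {up : Rp → O → O} (hint : DirectSum.IsInternal deg)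
  (hmul : ∀ i j, ∀ a ∈ deg i, ∀ b ∈ deg j, a * b ∈ deg (i + j)) (F₀ : O)

theorem mul_mem_span_singleton {B : Subring A} {a c d x : A} (u : A) (hu : u ∈ B)
    (h : a * c = u * d) (hx : x ∈ Submodule.span B {c}) : a * x ∈ Submodule.span B {d} := by
  obtain ⟨r, rfl⟩ := Submodule.mem_span_singleton.mp hx
  refine Submodule.mem_span_singleton.mpr ⟨r * ⟨u, hu⟩, ?_⟩
  change (r : A) * u * d = a * ((r : A) * c)
  rw [mul_assoc, ← h, mul_left_comm]

/-- At `F₀` the scalar lies in `S^β` and so preserves the given line; at any other facet the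
component that survives is zero. -/
theorem stab_unitObj {e : Rp → A} (he : ∀ β, e β ∈ loc β) (c c' : Rp → A) :
    Stab e (unitObj hint hmul F₀ c c' : KObj deg loc up) := by
  rintro F β - m (⟨rfl, hm⟩ | ⟨h, h', hm⟩ | rfl)
  · refine Or.inl ⟨rfl, ?_⟩
    have h1 := congrFun (stretch_same F (e β) 0 m) ⟨rfl⟩
    exact (congrArg (· ∈ Submodule.span (loc β) {c β}) h1).mpr
      (mul_mem_span_singleton _ (he β) rfl hm)
  · refine Or.inr (Or.inr (funext fun G => ?_))
    by_cases hG : G = F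
    · subst hG
      exact funext fun ⟨h0⟩ => absurd h0 h
    · rw [stretch_of_ne hG, zero_smul]
      rfl
  · exact Or.inr (Or.inr (map_zero _))

open Classical in
/-- Multiplication by a homogeneous unit identifies the rescaled unit object with a shift of
another one. -/
def scaleUnitObjIso (d : O → Rp → Aˣ) (e : Rp → Aˣ) (p : Aˣ) (n : ℤ) (hp : (p : A) ∈ deg n)
    (hp' : (↑p⁻¹ : A) ∈ deg (-n)) (hd : ∀ β, ((p * d F₀ β : Aˣ) : A) ∈ loc β)
    (hd' : ∀ β, (↑(p * d F₀ β)⁻¹ : A) ∈ loc β) (he : ∀ β, ((p * (e β)⁻¹ : Aˣ) : A) ∈ loc β)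
    (he' : ∀ β, (↑(p * (e β)⁻¹)⁻¹ : A) ∈ loc β) :
    (scaleFunctor fun F β G => if G = F then d F β else 1).obj
        (unitObj hint hmul F₀ (fun _ => 1) fun _ => 1 : KObj deg loc up) ≅
      (unitObj hint hmul F₀ (fun _ => 1) fun β => (e β : A) : KObj deg loc up).shift n where
  hom :=
    { app := fun _ => (p : A) • LinearMap.id
      app_gr := by
        intro F i m hm j hj
        change (p : A) * m j ∈ deg (i + n)
        rw [add_comm]
        exact hmul _ _ _ hp _ (hm j hj)
      app_sub := by
        rintro F β _ ⟨m, (⟨rfl, hm⟩ | ⟨h, h', hm⟩ | rfl), rfl⟩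
        · refine Or.inl ⟨rfl, ?_⟩
          change (p : A) * (((if F = F then d F β else 1 : Aˣ) : A) * m F ⟨rfl⟩) ∈ _
          rw [if_pos rfl, ← mul_assoc]
          exact mul_mem_span_singleton _ (hd β) (by rw [Units.val_mul]) hm
        · refine Or.inr (Or.inl ⟨h, h', ?_⟩)
          change (p : A) * (((if F₀ = F then d F β else 1 : Aˣ) : A) * m F₀ ⟨rfl⟩) ∈ _
          rw [if_neg (Ne.symm h), Units.val_one, one_mul]
          exact mul_mem_span_singleton _ (he β)
            (by rw [Units.val_mul, mul_one, mul_assoc, Units.inv_mul, mul_one]) hm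
        · refine Or.inr (Or.inr (funext fun G => ?_))
          change (p : A) • (((if G = F then d F β else 1 : Aˣ) : A) • (0 : PLift (G = F₀) → A)) = 0
          rw [smul_zero, smul_zero] }
  inv :=
    { app := fun _ => (↑p⁻¹ : A) • LinearMap.id
      app_gr := by
        intro F i m hm j hj
        change (↑p⁻¹ : A) * m j ∈ deg i
        have := hmul _ _ _ hp' _ (hm j hj)
        rwa [show -n + (i + n) = i by ring] at this
      app_sub := by
        intro F β m hm
        -- The preimage undoes both the multiplication by `p` and the rescaling by `d`. Its
        -- coefficient at `F₀` is `(p d)⁻¹` if `F = F₀` and `p⁻¹` otherwise, as the two conditions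
        -- on units require.
        refine ⟨fun G => (↑(p * if G = F then d F β else 1)⁻¹ : A) • m G, ?_, funext fun G => ?_⟩
        · rcases hm with ⟨rfl, hm⟩ | ⟨h, h', hm⟩ | rfl
          · refine Or.inl ⟨rfl, ?_⟩
            change (↑(p * if F = F then d F β else 1)⁻¹ : A) * m F ⟨rfl⟩ ∈ _
            rw [if_pos rfl]
            exact mul_mem_span_singleton _ (hd' β) rfl hm
          · refine Or.inr (Or.inl ⟨h, h', ?_⟩)
            change (↑(p * if F₀ = F then d F β else 1)⁻¹ : A) * m F₀ ⟨rfl⟩ ∈ _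
            rw [if_neg (Ne.symm h), mul_one]
            refine mul_mem_span_singleton _ (he' β) ?_ hm
            rw [mul_inv, inv_inv, Units.val_mul, mul_one]
          · refine Or.inr (Or.inr (funext fun G => ?_))
            change (_ : A) • (0 : PLift (G = F₀) → A) = 0
            rw [smul_zero]
        · change ((if G = F then d F β else 1 : Aˣ) : A) • (_ : A) • m G = (↑p⁻¹ : A) • m G
          rw [smul_smul, ← Units.val_mul, mul_inv, mul_left_comm, mul_inv_cancel, mul_one] }
  hom_inv_id := KObj.hom_ext fun F m => by
    change (↑p⁻¹ : A) • (p : A) • m = m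
    rw [smul_smul, Units.inv_mul, one_smul]
  inv_hom_id := KObj.hom_ext fun F m => by
    change (p : A) • (↑p⁻¹ : A) • m = m
    rw [smul_smul, Units.mul_inv, one_smul]

end UnitObject

/-! ### The image of the unit object under `γ`. -/

section Special

variable {k : Type z} [Field k] {ι : Type t} {V : Type u} {W : Type v} [AddCommGroup V]
  [Module ℚ V] [AddCommGroup W] [Module ℚ W] {P : RootPairing ι ℚ V W} [P.IsCrystallographic]
  {b : P.Base}

theorem rootUnit_mem_degS (β : PosRoot b) : (rootUnit k β : Sempty k b) ∈ degS k b 2 :=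
  AddSubgroup.subset_closure ⟨1, rootElt k (β : ι), 0, by rw [pow_one]; exact ⟨_, rfl⟩, by simp,
    by simp only [Multiset.map_zero, Multiset.prod_zero, Units.val_one, mul_one]; rfl⟩

theorem rootUnit_inv_mem_degS (β : PosRoot b) : (↑(rootUnit k β)⁻¹ : Sempty k b) ∈ degS k b (-2) :=
  AddSubgroup.subset_closure ⟨0, 1, {β}, by simp, by simp, by simp⟩

theorem prod_rootUnit_mem_degS (s : Finset (PosRoot b)) :
    ((∏ β ∈ s, rootUnit k β : (Sempty k b)ˣ) : Sempty k b) ∈ degS k b (2 * s.card) := by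
  classical
  induction s using Finset.induction with
  | empty =>
    rw [Finset.prod_empty, Units.val_one, Finset.card_empty, Nat.cast_zero, mul_zero]
    exact degS_one k b
  | insert β s hβ ih =>
    rw [Finset.prod_insert hβ, Finset.card_insert_of_notMem hβ, Units.val_mul,
      show (2 * ((s.card + 1 : ℕ) : ℤ)) = 2 + 2 * s.card by push_cast; ring]
    exact degS_mul k b _ _ _ (rootUnit_mem_degS β) _ ih

theorem prod_rootUnit_inv_mem_degS (s : Finset (PosRoot b)) :
    (↑(∏ β ∈ s, rootUnit k β : (Sempty k b)ˣ)⁻¹ : Sempty k b) ∈ degS k b (-(2 * s.card)) := by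
  classical
  induction s using Finset.induction with
  | empty =>
    rw [Finset.prod_empty, inv_one, Units.val_one, Finset.card_empty, Nat.cast_zero, mul_zero,
      neg_zero]
    exact degS_one k b
  | insert β s hβ ih =>
    rw [Finset.prod_insert hβ, Finset.card_insert_of_notMem hβ, mul_inv, Units.val_mul,
      show (-(2 * ((s.card + 1 : ℕ) : ℤ))) = -2 + -(2 * s.card) by push_cast; ring]
    exact degS_mul k b _ _ _ (rootUnit_inv_mem_degS β) _ ih

variable [Finite ι] [P.IsRootSystem] [P.IsReduced] [P.IsIrreducible]

variable (b) in
/-- The degree of the product of all positive roots. -/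
def topDeg : ℤ :=
  letI := Fintype.ofFinite (PosRoot b)
  2 * (Finset.univ : Finset (PosRoot b)).card

variable (k b) in
/-- The rescaled unit object is a shift of the other one. -/
def gammaUnitIso : (gammaAlc k b).obj (P₀ k b) ≅ (P₀' k b).shift (topDeg b) :=
  letI := Fintype.ofFinite (PosRoot b)
  -- Removing `β` from the product of all positive roots leaves only roots that are invertible in
  -- `S^β`.
  have h1 : ∀ β, (∏ α, rootUnit k α) * (rootUnit k β)⁻¹ ∈ SbetaUnits k β := by
    classical
    intro β
    rw [← Finset.mul_prod_erase _ _ (Finset.mem_univ β), mul_right_comm, mul_inv_cancel, one_mul]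
    exact prod_mem fun α hα => rootUnit_mem_SbetaUnits k (Finset.ne_of_mem_erase hα)
  -- Write `p d = (p β⁻¹)(d β)`, where `p` is the product of all positive roots; both factors are
  -- units of `S^β`.
  have h2 : ∀ β, (∏ α, rootUnit k α) * dAlc k (Orb.base P (fundAlcove b)) β ∈ SbetaUnits k β := by
    intro β
    have := mul_mem (h1 β) (dAlc_mul_rootUnit_mem k (Orb.base P (fundAlcove b)) β)
    rwa [mul_comm (dAlc k _ β), mul_assoc, inv_mul_cancel_left] at this
  scaleUnitObjIso (degS_internal k b) (degS_mul k b) _ (dAlc k) (rootUnit k) (∏ β, rootUnit k β) _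
    (prod_rootUnit_mem_degS _) (prod_rootUnit_inv_mem_degS _) (fun β => (h2 β).1)
    (fun β => (h2 β).2) (fun β => (h1 β).1) (fun β => (h1 β).2)

end Special

/-! ### Special objects and the restriction of `γ` to them. -/

section Special

variable {k : Type z} [Field k] {ι : Type t} {V : Type u} {W : Type v} [AddCommGroup V]
  [Module ℚ V] [AddCommGroup W] [Module ℚ W] {P : RootPairing ι ℚ V W} [P.IsCrystallographic]
  {b : P.Base}

theorem IsSpecial.of_isDirectSummand {T : SimpleRefl b → KAlc k b ⥤ KAlc k b} {U M : KAlc k b}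
    {m : ℕ} {l : Fin m → List (SimpleRefl b)} {n : Fin m → ℤ} {X : Fin m → KAlc k b}
    (h : IsDirectSummand M (KObj.dsum X)) (e : ∀ i, X i ≅ (iterTr T U (l i)).shift (n i)) :
    IsSpecial T U M :=
  ⟨m, l, n, h.trans_iso (KObj.dsumMapIso e)⟩

/-- An additive functor preserves sums and summands, and it commutes with shifts; on a generator it
only lengthens the sequence by one letter. -/
theorem IsSpecial.map {T : SimpleRefl b → KAlc k b ⥤ KAlc k b} [∀ s, (T s).Additive]
    (hT : ∀ s (X : KAlc k b) n, (T s).obj (X.shift n) = ((T s).obj X).shift n) {U M : KAlc k b}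
    (s : SimpleRefl b) (h : IsSpecial T U M) : IsSpecial T U ((T s).obj M) := by
  obtain ⟨m, l, n, h⟩ := h
  exact IsSpecial.of_isDirectSummand (l := fun i => s :: l i) (n := n)
    ((h.map (T := T s)).trans_iso (dsumCompIso (T s) _)) fun i => eqToIso (hT s _ _)

theorem Tr_obj_shift (s : SimpleRefl b) (X : KAlc k b) (n : ℤ) :
    (Tr k s).obj (X.shift n) = ((Tr k s).obj X).shift n := rfl

theorem Tr'_obj_shift (s : SimpleRefl b) (X : KAlc k b) (n : ℤ) :
    (Tr' k s).obj (X.shift n) = ((Tr' k s).obj X).shift n := rfl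

theorem gammaAlc_obj_shift (X : KAlc k b) (n : ℤ) :
    (gammaAlc k b).obj (X.shift n) = ((gammaAlc k b).obj X).shift n := rfl

theorem SpecialM.tr (s : SimpleRefl b) {M : KAlc k b} (h : SpecialM k b M) :
    SpecialM k b ((Tr k s).obj M) :=
  IsSpecial.map Tr_obj_shift s h

theorem SpecialM'.tr' (s : SimpleRefl b) {M : KAlc k b} (h : SpecialM' k b M) :
    SpecialM' k b ((Tr' k s).obj M) :=
  IsSpecial.map Tr'_obj_shift s h

variable [Finite ι] [P.IsRootSystem] [P.IsReduced] [P.IsIrreducible]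

theorem rootStab_iterTr (l : List (SimpleRefl b)) : RootStab (iterTr (Tr k) (P₀ k b) l) := by
  induction l with
  | nil => exact stab_unitObj (degS_internal k b) (degS_mul k b) _ (fun β => rootUnit_mem_Sbeta k β β) _ _
  | cons s l ih => exact RootStab.Tr ih

theorem SpecialM.rootStab {M : KAlc k b} (h : SpecialM k b M) : RootStab M := by
  obtain ⟨m, l, n, h⟩ := h
  exact Stab.of_isDirectSummand (Stab.dsum fun i => (rootStab_iterTr (l i)).shift (n i)) h

theorem SpecialW.rootStab {s : SimpleRefl b} {N : KWall k s} (h : SpecialW k s N) :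
    RootStab N := by
  obtain ⟨M, hM, h⟩ := h
  exact Stab.of_isDirectSummand hM.rootStab.Ton h

/-- The functor `γ` identifies the generating objects up to a shift. -/
def gammaIterIso (l : List (SimpleRefl b)) :
    (gammaAlc k b).obj (iterTr (Tr k) (P₀ k b) l) ≅
      (iterTr (Tr' k) (P₀' k b) l).shift (topDeg b) :=
  match l with
  | [] => gammaUnitIso k b
  | s :: l => (trIso (rootStab_iterTr l)).symm ≪≫ (Tr' k s).mapIso (gammaIterIso l) ≪≫
      eqToIso (Tr'_obj_shift s _ _)

/-- The functor `γ` identifies the shifted generating objects. -/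
def gammaIterShiftIso (l : List (SimpleRefl b)) (n n' : ℤ) (h : topDeg b + n = n') :
    (gammaAlc k b).obj ((iterTr (Tr k) (P₀ k b) l).shift n) ≅
      (iterTr (Tr' k) (P₀' k b) l).shift n' :=
  eqToIso (gammaAlc_obj_shift _ _) ≪≫ KObj.shiftIso (gammaIterIso l) n ≪≫
    KObj.shiftShiftIso _ _ _ _ h

theorem SpecialM.gamma {M : KAlc k b} (h : SpecialM k b M) :
    SpecialM' k b ((gammaAlc k b).obj M) := by
  obtain ⟨m, l, n, h⟩ := h
  exact IsSpecial.of_isDirectSummand ((h.map (T := gammaAlc k b)).trans_iso (dsumCompIso _ _))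
    fun i => gammaIterShiftIso (l i) (n i) _ rfl

theorem SpecialM'.gamma_inv {N : KAlc k b} (h : SpecialM' k b N) :
    SpecialM k b ((gammaAlc k b).inv.obj N) := by
  obtain ⟨m, l, n, h⟩ := h
  have : (gammaAlc k b).asEquivalence.functor.Additive := inferInstanceAs (gammaAlc k b).Additive
  have : (gammaAlc k b).inv.Additive := Equivalence.inverse_additive (gammaAlc k b).asEquivalence
  exact IsSpecial.of_isDirectSummand
    ((h.map (T := (gammaAlc k b).inv)).trans_iso (dsumCompIso _ _)) fun i =>
      -- `γ` introduces the shift by the degree of the product of positive roots, which the source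
      -- generator has to compensate.
      (gammaAlc k b).inv.mapIso (gammaIterShiftIso (l i) (n i - topDeg b) (n i) (by ring)).symm ≪≫
        (gammaAlc k b).asEquivalence.unitIso.symm.app _

/-- Fullness and faithfulness are inherited from `γ`; the content is that the inverse of `γ`
preserves special objects. -/
theorem gamma_lift_isEquivalence (h : ∀ M : (SpecialM k b).FullSubcategory,
    SpecialM' k b (((SpecialM k b).ι ⋙ gammaAlc k b).obj M)) :
    ((SpecialM' k b).lift ((SpecialM k b).ι ⋙ gammaAlc k b) h).IsEquivalence where
  essSurj := ⟨fun N => ⟨⟨_, SpecialM'.gamma_inv N.property⟩,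
    ⟨(SpecialM' k b).fullyFaithfulι.preimageIso
      ((gammaAlc k b).asEquivalence.counitIso.app N.obj)⟩⟩⟩

end Special

end AJS

end

open CategoryTheory AJS in
theorem theorem5 {k : Type*} [Field k] {ι V W : Type*} [AddCommGroup V] [Module ℚ V]
    [AddCommGroup W] [Module ℚ W] [Finite ι] (P : RootPairing ι ℚ V W) [P.IsRootSystem]
    [P.IsCrystallographic] [P.IsReduced] [P.IsIrreducible] (b : P.Base)
    (h2 : (2 : k) ≠ 0) (h3 : P.IsG2 → (3 : k) ≠ 0) :
    -- `γ` and all `γ^s` are autoequivalences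
    (gammaAlc k b).IsEquivalence ∧
    (∀ s : SimpleRefl b, (gammaWall k s).IsEquivalence) ∧
    -- on special objects they intertwine the translation functors onto and out of the walls
    (∀ s : SimpleRefl b, Nonempty ((SpecialM k b).ι ⋙ gammaAlc k b ⋙ Ton' k s ≅
      (SpecialM k b).ι ⋙ Ton k s ⋙ gammaWall k s)) ∧
    (∀ s : SimpleRefl b, Nonempty ((SpecialW k s).ι ⋙ gammaWall k s ⋙ Tout' k s ≅
      (SpecialW k s).ι ⋙ Tout k s ⋙ gammaAlc k b)) ∧
    -- `T^s`, `T'^s` and `γ` restrict to functors `M_k → M_k`, `M_k' → M_k'` and `M_k → M_k'`;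
    -- the latter is an equivalence that intertwines the former
    ∃ (hT : ∀ (s : SimpleRefl b) (M : (SpecialM k b).FullSubcategory),
          SpecialM k b (((SpecialM k b).ι ⋙ Tr k s).obj M))
      (hT' : ∀ (s : SimpleRefl b) (M : (SpecialM' k b).FullSubcategory),
          SpecialM' k b (((SpecialM' k b).ι ⋙ Tr' k s).obj M))
      (hγ : ∀ M : (SpecialM k b).FullSubcategory,
          SpecialM' k b (((SpecialM k b).ι ⋙ gammaAlc k b).obj M)),
      ((SpecialM' k b).lift ((SpecialM k b).ι ⋙ gammaAlc k b) hγ).IsEquivalence ∧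
      ∀ s : SimpleRefl b, Nonempty
        ((SpecialM k b).lift ((SpecialM k b).ι ⋙ Tr k s) (hT s) ⋙
            (SpecialM' k b).lift ((SpecialM k b).ι ⋙ gammaAlc k b) hγ ≅
          (SpecialM' k b).lift ((SpecialM k b).ι ⋙ gammaAlc k b) hγ ⋙
            (SpecialM' k b).lift ((SpecialM' k b).ι ⋙ Tr' k s) (hT' s)) := by
  refine ⟨gammaAlc_isEquivalence k b, gammaWall_isEquivalence k, fun s => ⟨?_⟩, fun s => ⟨?_⟩,
    fun s M => SpecialM.tr s M.property, fun s M => SpecialM'.tr' s M.property,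
    fun M => SpecialM.gamma M.property, gamma_lift_isEquivalence _, fun s => ⟨?_⟩⟩
  -- The components are identities on the underlying modules, so naturality is definitional.
  · exact NatIso.ofComponents (fun M => onIso (SpecialM.rootStab M.property))
      fun _ => KObj.hom_ext fun _ _ => rfl
  · exact NatIso.ofComponents (fun N => outIso (SpecialW.rootStab N.property))
      fun _ => KObj.hom_ext fun _ _ => rfl
  -- The inclusion of the full subcategory is fully faithful, so the isomorphism may be constructed
  -- in the ambient category.
  · exact Functor.fullyFaithfulCancelRight (SpecialM' k b).ι <|
      NatIso.ofComponents (fun M => (trIso (SpecialM.rootStab M.property)).symm)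
        fun _ => KObj.hom_ext fun _ _ => rfl
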